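/- Let $N\ge 2$, let $\kappa=(-1)^{N/2+1}$ if $N$ is even and $\kappa\in\{1,-1\}$ if $N$ is odd. Let $$A_N(z)=\frac1{2\pi i}\int_{c-i\infty}^{c+i\infty}e^{z\xi+\kappa\xi^N}\,d\xi ,$$ where $c=0$ if $N$ is even, and, if $N$ is odd, $c=1$ when $\kappa=(-1)^{(N+1)/2}$ and $c=-1$ when $\kappa=(-1)^{(N-1)/2}$ (the integral converges absolutely), and put $$a_j(x,y,t)=t^{-(j+1)/N}A_N^{(j)}\!\left(\frac{x-y}{t^{1/N}}\right),\qquad t>0 .$$ Let $D\subseteq\mathbb R$ be open, let $u_0,\dots,u_{N-2}\colon D\to\mathbb C$ be smooth, and let $$\mathcal L=\partial_x^N+u_{N-2}(x)\partial_x^{N-2}+\cdots+u_0(x),\qquad \mathcal L^*=(-\partial_x)^N+\sum_{i=0}^{N-2}(-\partial_x)^i\circ u_i(x)$$ ($\mathcal L^*$ is the formal adjoint). Let $U\subseteq D\times D$ be an open set that contains the diagonal of $D\times D$, and let $H_k^j\colon U\to\mathbb C$ ($k\ge1$, $0\le j\le N-2$) be the Hadamard's coefficients of the heat equation $\partial_t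 v=\kappa\mathcal L v$, that is, smooth functions on $U$ such that the formal series $$\mathcal H(x,y,t)=a_0(x,y,t)+\sum_{j=0}^{N-2}a_j(x,y,t)\sum_{k=1}^{\infty}H_k^j(x,y)\,t^k$$ is, for fixed $y$, a formal solution of $\partial_t v=\kappa\mathcal L v$. Here "formal solution" means: for every $K\ge0$, if $\mathcal H_K$ denotes the sum with $k$ restricted to $1\le k\le K$, there are functions $R_{K,j}(x,y)$ on $U$ with $$(\partial_t-\kappa\mathcal L)\,\mathcal H_K(x,y,t)=t^K\sum_{j=0}^{N-2}R_{K,j}(x,y)\,a_j(x,y,t)\qquad\text{for all }(x,y)\in U,\ t>0 .$$ Let $V$ be the set of all $(x,y)$ such that $(s,y)\in U$ and $(s,x)\in U$ for every $s$ in the closed interval with endpoints $x$ and $y$; it contains a neighborhood of the diagonal of $D\times D$, and $V=D\times D$ if $D$ is an interval and $U=D\times D$. Then, for all $n\ge1$, $0\le j\le N-2$ and $(x,y)\in V$: (i) if $N$ is even and $\mathcal L$ is formally self-adjoint, i.e. $\mathcal L^*=\mathcal L$, then $H_n^j(x,y)=(-1)^jH_n^j(y,x)$; (ii) if $N$ is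 odd and $\mathcal L$ is formally skew-adjoint, i.e. $\mathcal L^*=-\mathcal L$, then $H_n^j(x,y)=(-1)^{n+j}H_n^j(y,x)$. -/

import Mathlib

open scoped ContDiff

noncomputable section

namespace HigherHeat

/-- The admissible signs: `κ = (-1)^(N/2+1)` for even `N`, and `κ = 1` or `κ = -1` for odd `N`. -/
def IsHeatSign (N : ℕ) (κ : ℝ) : Prop :=
  (Even N → κ = (-1) ^ (N / 2 + 1)) ∧ (Odd N → κ = 1 ∨ κ = -1)

/-- The abscissa `c` of the line of integration `c + iℝ` of the Airy-type integral: the imaginary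
axis for even `N`; for odd `N`, `c = 1` if `κ = (-1)^((N+1)/2)` and `c = -1` if
`κ = (-1)^((N-1)/2)`. With these choices the integral below converges absolutely. -/
def airyAbscissa (N : ℕ) (κ : ℝ) : ℝ :=
  if Even N then 0 else κ * (-1) ^ ((N + 1) / 2)

/-- The Airy-type function
`A_N(z; κ) = (1 / 2πi) ∫_{c - i∞}^{c + i∞} exp (z ξ + κ ξ ^ N) dξ`, where `ξ = c + i s`. -/
def airy (N : ℕ) (κ : ℝ) (z : ℝ) : ℂ :=
  (1 / (2 * (Real.pi : ℂ))) *
    ∫ s : ℝ, Complex.exp ((z : ℂ) * ((airyAbscissa N κ : ℂ) + (s : ℂ) * Complex.I)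
      + (κ : ℂ) * ((airyAbscissa N κ : ℂ) + (s : ℂ) * Complex.I) ^ N)

/-- `t ^ (-(j+1)/N) * A_N^{(j)} ((x - y) / t ^ (1/N))`. -/
def airyTerm (N : ℕ) (κ : ℝ) (j : ℕ) (x y t : ℝ) : ℂ :=
  ((t ^ (-(((j : ℝ) + 1) / (N : ℝ))) : ℝ) : ℂ) *
    iteratedDeriv j (airy N κ) ((x - y) / t ^ (1 / (N : ℝ)))

/-- The differential operator `L = ∂^N + u_{N-2} ∂^{N-2} + ⋯ + u_0` (only `u i` with `i < N - 1`
matter). -/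
def diffOp (N : ℕ) (u : ℕ → ℝ → ℂ) (f : ℝ → ℂ) (x : ℝ) : ℂ :=
  iteratedDeriv N f x + ∑ i ∈ Finset.range (N - 1), u i x * iteratedDeriv i f x

/-- The formal adjoint `L^* f = (-∂)^N f + ∑_i (-∂)^i (u_i f)`, the image of `L` under the
antiautomorphism with `∂^* = -∂` that fixes functions (no complex conjugation). -/
def adjointOp (N : ℕ) (u : ℕ → ℝ → ℂ) (f : ℝ → ℂ) (x : ℝ) : ℂ :=
  (-1) ^ N * iteratedDeriv N f x +
    ∑ i ∈ Finset.range (N - 1), (-1) ^ i * iteratedDeriv i (fun s => u i s * f s) x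

/-- `L^* = L` as operators on the smooth functions on `D`. -/
def IsFormallySelfAdjoint (N : ℕ) (u : ℕ → ℝ → ℂ) (D : Set ℝ) : Prop :=
  ∀ f : ℝ → ℂ, ContDiffOn ℝ ∞ f D → ∀ x ∈ D, adjointOp N u f x = diffOp N u f x

/-- `L^* = -L` as operators on the smooth functions on `D`. -/
def IsFormallySkewAdjoint (N : ℕ) (u : ℕ → ℝ → ℂ) (D : Set ℝ) : Prop :=
  ∀ f : ℝ → ℂ, ContDiffOn ℝ ∞ f D → ∀ x ∈ D, adjointOp N u f x = -diffOp N u f x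

/-- The heat kernel series truncated after the terms with `t ^ K`; `H k j x y` is `H_k^j(x, y)`,
used for `1 ≤ k` and `0 ≤ j ≤ N - 2`. -/
def truncatedKernel (N : ℕ) (κ : ℝ) (H : ℕ → ℕ → ℝ → ℝ → ℂ) (K : ℕ) (x y t : ℝ) : ℂ :=
  airyTerm N κ 0 x y t +
    ∑ j ∈ Finset.range (N - 1),
      airyTerm N κ j x y t * ∑ k ∈ Finset.Icc 1 K, H k j x y * (t : ℂ) ^ k

/-- The formal series with coefficients `H` solves `∂_t v = κ L v` on `U` (with `L` acting on `x`):
when the partial sum up to `t ^ K` is substituted into `∂_t v - κ L v`, all the terms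
`t ^ k * airyTerm j` with `k < K` cancel, and what is left is a combination of the
`t ^ K * airyTerm j` with coefficients independent of `t`; and this for every `K`. -/
def IsFormalSolution (N : ℕ) (κ : ℝ) (u : ℕ → ℝ → ℂ) (U : Set (ℝ × ℝ))
    (H : ℕ → ℕ → ℝ → ℝ → ℂ) : Prop :=
  ∀ K : ℕ, ∃ R : ℕ → ℝ → ℝ → ℂ, ∀ x y : ℝ, (x, y) ∈ U → ∀ t : ℝ, 0 < t →
    deriv (fun τ : ℝ => truncatedKernel N κ H K x y τ) t
        - (κ : ℂ) * diffOp N u (fun ξ : ℝ => truncatedKernel N κ H K ξ y t) x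
      = (t : ℂ) ^ K * ∑ j ∈ Finset.range (N - 1), R j x y * airyTerm N κ j x y t

/-- `H` is the family of Hadamard's coefficients of `∂_t v = κ L v`, for `L` with coefficients on
the open set `D`: they are smooth on the neighbourhood `U` of the diagonal of `D × D`, and the heat
kernel series built from them is a formal solution. -/
structure IsHadamardFamily (N : ℕ) (κ : ℝ) (u : ℕ → ℝ → ℂ) (D : Set ℝ) (U : Set (ℝ × ℝ))
    (H : ℕ → ℕ → ℝ → ℝ → ℂ) : Prop where
  isOpen : IsOpen U
  subset : U ⊆ D ×ˢ D
  diagonal : ∀ x ∈ D, (x, x) ∈ U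
  smooth : ∀ k j : ℕ, 1 ≤ k → j < N - 1 → ContDiffOn ℝ ∞ (fun p : ℝ × ℝ => H k j p.1 p.2) U
  solution : IsFormalSolution N κ u U H

/-- The points `(x, y)` such that the segments parallel to the first axis that join `(x, y)` to
`(y, y)` and `(y, x)` to `(x, x)` lie in `U`. For `U` open this contains a neighbourhood of every
diagonal point of `U`; it is all of `U` if `U` is the square of an interval. -/
def symmetricCore (U : Set (ℝ × ℝ)) : Set (ℝ × ℝ) :=
  {p | ∀ s ∈ Set.uIcc p.1 p.2, (s, p.2) ∈ U ∧ (s, p.1) ∈ U}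

end HigherHeat

end

noncomputable section

namespace HigherHeat

open Polynomial

/-! ### Degree bounds for polynomials -/

section Degree

variable {A : Type*} [CommRing A]

/-! Write N = n + 1. Replacing a_j by ξ^j turns kernels into series in t of polynomials in ξ over
the smooth functions of (x, y). Then ∂_x becomes ∂ + ξ, ∂_t acts on a_j as κ ξ^N, and integration by
parts in the Airy integral gives the relation θ + κ N t ξ^n = 0, where θ = δ + ∂/∂ξ and δ = x - y.

Put S = L(∂ + ξ) - ξ^N and divide S f by N ξ^n, with quotient P f and remainder of degree less than
n. The relation trades the quotient for θ P f at one power of t lower. The heat equation for Σ t^k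
h_k then becomes the transport recursion (k+1) h_{k+1} + θ P h_{k+1} = κ rem(S h_k), h_0 = 1.
Comparing coefficients is legitimate because the t^k a_j with j < n are linearly independent off the
diagonal (`termEval_linearIndependent`, `isTransport_hadamardPoly`).

Let T be (-1)^N times the conjugate of S by the flip that exchanges x and y and sends ξ to -ξ. Apart
from ξ, S involves only x and T only y, so they commute; both have commutator -N ξ^n with θ.
Applying the heat operator in y to a solution of the heat equation in x gives again a solution in x.
The symbolic form of this is `transportDefect_transport`: the defects g_k of h in the recursion of T
obey the recursion of S, started from θ P g_0 = 0. Since the recursion is triangular in the degree,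
g vanishes as soon as g_0 does, and g_0 vanishes as soon as certain functions constant in x vanish
on the diagonal. The functionals `adjointCoeff` turn θ into multiplication by δ, hence kill the
θ-terms of g_0 on the diagonal. What remains there is the comparison of the coefficients of L and of
its adjoint.

So h solves the recursion of T, and (-1)^{Nk} flip(h_k) solves that of S. Uniqueness gives
`IsTransport.eq_smul_flip`, which is the symmetry.

The given H lives only on U, which need not contain a square around (x, y). The recursion is
therefore solved afresh on a square I × I around the segment, and compared with H on two thin
horizontal strips. -/

/-- `f` has degree less than `n`. -/
def DegLT (n : ℕ) (f : A[X]) : Prop := ∀ m, n ≤ m → f.coeff m = 0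

theorem DegLT.add {n : ℕ} {f g : A[X]} (hf : DegLT n f) (hg : DegLT n g) : DegLT n (f + g) :=
  fun m hm => by simp [hf m hm, hg m hm]

theorem DegLT.sub {n : ℕ} {f g : A[X]} (hf : DegLT n f) (hg : DegLT n g) : DegLT n (f - g) :=
  fun m hm => by simp [hf m hm, hg m hm]

theorem DegLT.mono {n k : ℕ} {f : A[X]} (hf : DegLT n f) (h : n ≤ k) : DegLT k f :=
  fun m hm => hf m (h.trans hm)

theorem DegLT.sum {ι : Type*} {s : Finset ι} {n : ℕ} {f : ι → A[X]}
    (hf : ∀ i ∈ s, DegLT n (f i)) : DegLT n (∑ i ∈ s, f i) := fun m hm => by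
  rw [finsetSum_coeff]; exact Finset.sum_eq_zero fun i hi => hf i hi m hm

theorem DegLT.eq_zero {f : A[X]} (hf : DegLT 0 f) : f = 0 :=
  Polynomial.ext fun m => by simpa using hf m (Nat.zero_le m)

end Degree

/-! ### Symbol calculus: ∂ + ξ, θ, and division by ξ^n -/

section Operators

variable {A : Type*} [CommRing A] [Algebra ℝ A]

/-- A linear map applied to every coefficient of a polynomial. -/
def coeffMap (φ : A →ₗ[ℝ] A) : Module.End ℝ A[X] :=
  Polynomial.lsum fun n => (Polynomial.monomial n).restrictScalars ℝ ∘ₗ φ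

@[simp] theorem coeff_coeffMap (φ : A →ₗ[ℝ] A) (f : A[X]) (m : ℕ) :
    (coeffMap φ f).coeff m = φ (f.coeff m) := by
  induction f using Polynomial.induction_on' with
  | add p q hp hq => simp [hp, hq]
  | monomial k a =>
    simp only [coeffMap, Polynomial.lsum_apply, LinearMap.coe_comp, Function.comp_apply,
      LinearMap.coe_restrictScalars]
    rw [Polynomial.sum_monomial_index _ _ (by simp)]
    simp only [coeff_monomial]
    split_ifs <;> simp

/-- Multiplication by the variable. -/
def mulX : Module.End ℝ A[X] := LinearMap.mulLeft ℝ X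

/-- Multiplication by a scalar. -/
def mulC (a : A) : Module.End ℝ A[X] := LinearMap.mulLeft ℝ (C a)

/-- The derivative with respect to the variable. -/
def derivX : Module.End ℝ A[X] := (Polynomial.derivative (R := A)).restrictScalars ℝ

/-- Division by the variable, without remainder. -/
def divXEnd : Module.End ℝ A[X] where
  toFun f := divX f
  map_add' f g := by ext; simp [coeff_divX]
  map_smul' c f := by ext; simp [coeff_divX]

@[simp] theorem mulX_apply (f : A[X]) : mulX f = X * f := rfl
@[simp] theorem mulC_apply (a : A) (f : A[X]) : mulC a f = C a * f := rfl
@[simp] theorem derivX_apply (f : A[X]) : derivX f = derivative f := rfl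
@[simp] theorem divXEnd_apply (f : A[X]) : divXEnd f = divX f := rfl

theorem mulX_pow_apply (k : ℕ) (f : A[X]) : (mulX ^ k) f = X ^ k * f := by
  induction k with
  | zero => simp
  | succ k ih => rw [pow_succ', Module.End.mul_apply, ih, mulX_apply]; ring

theorem coeff_divXEnd_pow (k : ℕ) (f : A[X]) (m : ℕ) :
    ((divXEnd ^ k) f).coeff m = f.coeff (m + k) := by
  induction k generalizing m with
  | zero => simp
  | succ k ih => rw [pow_succ', Module.End.mul_apply, divXEnd_apply, coeff_divX, ih]; congr 1; ring

/-- `∂ + ξ`, for a derivation `∂` of the coefficients and the variable `ξ`. -/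
def symD (d : Derivation ℝ A A) : Module.End ℝ A[X] := coeffMap d + mulX

/-- `δ + ∂/∂ξ`. -/
def theta (δ : A) : Module.End ℝ A[X] := mulC δ + derivX

/-- The operator `L(∂ + ξ) - ξ ^ (n + 1)` for
`L = ∂ ^ (n + 1) + u_{n-1} ∂ ^ (n - 1) + ⋯ + u_0`. -/
def symOp (n : ℕ) (d : Derivation ℝ A A) (u : ℕ → A) : Module.End ℝ A[X] :=
  symD d ^ (n + 1) - mulX ^ (n + 1) + ∑ i ∈ Finset.range n, mulC (u i) * symD d ^ i

/-- The quotient of `T f` by `(n + 1) ξ ^ n`. -/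
def quotPart (n : ℕ) (T : Module.End ℝ A[X]) : Module.End ℝ A[X] :=
  ((n : ℝ) + 1)⁻¹ • (divXEnd ^ n * T)

/-- The remainder of `T f` modulo `ξ ^ n`. -/
def remPart (n : ℕ) (T : Module.End ℝ A[X]) : Module.End ℝ A[X] :=
  T - ((n : ℝ) + 1) • (mulX ^ n * quotPart n T)

theorem commute_coeffMap_mulX (φ : A →ₗ[ℝ] A) : Commute (coeffMap φ) (mulX : Module.End ℝ A[X]) := by
  refine LinearMap.ext fun f => Polynomial.ext fun m => ?_
  cases m <;> simp

theorem commute_coeffMap_derivX (φ : A →ₗ[ℝ] A) : Commute (coeffMap φ) derivX := by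
  refine LinearMap.ext fun f => Polynomial.ext fun m => ?_
  have h (a : A) : φ (a * ((m : A) + 1)) = φ a * ((m : A) + 1) := by
    have : ∀ b : A, b * ((m : A) + 1) = ((m : ℝ) + 1) • b := by
      intro b; rw [Algebra.smul_def]; simp [mul_comm]
    rw [this, this, map_smul]
  simp [coeff_derivative, h]

theorem commute_coeffMap {φ ψ : A →ₗ[ℝ] A} (h : ∀ a, φ (ψ a) = ψ (φ a)) :
    Commute (coeffMap φ) (coeffMap ψ) := by
  refine LinearMap.ext fun f => Polynomial.ext fun m => ?_
  simp [h]

theorem commute_mulC_mulX (a : A) : Commute (mulC a) mulX :=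
  LinearMap.ext fun f => by simp; ring

theorem commute_mulC (a b : A) : Commute (mulC a) (mulC b) :=
  LinearMap.ext fun f => by simp; ring

theorem coeffMap_mul_mulC (d : Derivation ℝ A A) (a : A) :
    coeffMap (d : A →ₗ[ℝ] A) * mulC a = mulC a * coeffMap (d : A →ₗ[ℝ] A) + mulC (d a) := by
  refine LinearMap.ext fun f => Polynomial.ext fun m => ?_
  simp; ring

theorem derivX_mul_mulX : (derivX : Module.End ℝ A[X]) * mulX = mulX * derivX + 1 :=
  LinearMap.ext fun f => by simp; ring

theorem commute_derivX_mulC (a : A) : Commute derivX (mulC a) :=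
  LinearMap.ext fun f => by simp

theorem commute_symD_mulX (d : Derivation ℝ A A) : Commute (symD d) mulX :=
  (commute_coeffMap_mulX _).add_left (Commute.refl _)

theorem commute_symD_mulC (d : Derivation ℝ A A) {a : A} (ha : d a = 0) :
    Commute (symD d) (mulC a) := by
  refine Commute.add_left ?_ (commute_mulC_mulX a).symm
  have h0 : (mulC (0 : A) : Module.End ℝ A[X]) = 0 := LinearMap.ext fun f => by simp
  have := coeffMap_mul_mulC d a
  rw [ha, h0, add_zero] at this
  exact this

/-- The commutators [δ, ∂] = -1 and [∂/∂ξ, ξ] = 1 cancel. -/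
theorem commute_theta_symD (d : Derivation ℝ A A) {δ : A} (hδ : d δ = 1) :
    Commute (theta δ) (symD d) := by
  have h1 := coeffMap_mul_mulC d δ
  have h2 := derivX_mul_mulX (A := A)
  have h3 := commute_coeffMap_derivX (d : A →ₗ[ℝ] A)
  have h4 := commute_mulC_mulX δ
  have h5 : (mulC (1 : A) : Module.End ℝ A[X]) = 1 := LinearMap.ext fun f => by simp
  rw [hδ, h5] at h1
  unfold Commute SemiconjBy at *
  simp only [theta, symD, add_mul, mul_add, h1, h2, h3, h4]
  abel

theorem theta_mul_mulX (δ : A) : theta δ * mulX = mulX * theta δ + 1 := by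
  have h4 := commute_mulC_mulX δ
  unfold Commute SemiconjBy at h4
  simp only [theta, add_mul, mul_add, h4, derivX_mul_mulX]
  abel

theorem theta_mul_mulX_pow (δ : A) (n : ℕ) :
    theta δ * mulX ^ (n + 1) = mulX ^ (n + 1) * theta δ + ((n : ℝ) + 1) • mulX ^ n := by
  induction n with
  | zero => simp [theta_mul_mulX]
  | succ n ih =>
    rw [pow_succ, ← mul_assoc, ih, add_mul, mul_assoc, theta_mul_mulX, smul_mul_assoc, ← pow_succ,
      mul_add, mul_one, ← mul_assoc, add_assoc]
    push_cast
    congr 1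
    module

/-- θ commutes with ∂ + ξ and with multiplication by functions, so only the subtracted ξ^(n+1)
contributes to the commutator. -/
theorem theta_mul_symOp (n : ℕ) (d : Derivation ℝ A A) (u : ℕ → A) {δ : A} (hδ : d δ = 1) :
    theta δ * symOp n d u = symOp n d u * theta δ - ((n : ℝ) + 1) • mulX ^ n := by
  have h1 := ((commute_theta_symD d hδ).pow_right (n + 1)).eq
  have h2 : Commute (theta δ) (∑ i ∈ Finset.range n, mulC (u i) * symD d ^ i) := by
    refine Commute.sum_right _ _ _ fun i _ => Commute.mul_right ?_
      ((commute_theta_symD d hδ).pow_right i)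
    exact (commute_mulC δ _).add_left (commute_derivX_mulC _)
  unfold symOp
  rw [mul_add, mul_sub, add_mul, sub_mul, h1, h2.eq, theta_mul_mulX_pow]
  abel

theorem commute_symOp_mulX (n : ℕ) (d : Derivation ℝ A A) (u : ℕ → A) :
    Commute (symOp n d u) mulX := by
  have h := commute_symD_mulX d
  refine ((h.pow_left _).sub_left ((Commute.refl _).pow_left _)).add_left ?_
  exact Commute.sum_left _ _ _ fun i _ => (commute_mulC_mulX _).mul_left (h.pow_left _)

theorem DegLT.smul {n : ℕ} {f : A[X]} (c : ℝ) (hf : DegLT n f) : DegLT n (c • f) :=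
  fun m hm => by simp [hf m hm]

theorem DegLT.mulC {n : ℕ} {f : A[X]} (a : A) (hf : DegLT n f) : DegLT n (mulC a f) :=
  fun m hm => by simp [hf m hm]

theorem DegLT.coeffMap {n : ℕ} {f : A[X]} (φ : A →ₗ[ℝ] A) (hf : DegLT n f) :
    DegLT n (coeffMap φ f) :=
  fun m hm => by simp [hf m hm]

theorem DegLT.mulX_pow {n : ℕ} {f : A[X]} (k : ℕ) (hf : DegLT n f) :
    DegLT (n + k) ((mulX ^ k) f) := fun m hm => by
  rw [mulX_pow_apply, mul_comm, coeff_mul_X_pow', if_pos (by omega)]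
  exact hf _ (by omega)

theorem DegLT.of_mulX_pow {n k : ℕ} {f : A[X]} (hf : DegLT (n + k) ((mulX ^ k) f)) :
    DegLT n f := fun m hm => by
  have := hf (m + k) (by omega)
  rwa [mulX_pow_apply, mul_comm, coeff_mul_X_pow] at this

theorem DegLT.theta {n : ℕ} {f : A[X]} (δ : A) (hf : DegLT n f) : DegLT n (theta δ f) :=
  fun m hm => by simp [HigherHeat.theta, coeff_derivative, hf m hm, hf (m + 1) (by omega)]

theorem DegLT.symD {n : ℕ} {f : A[X]} (d : Derivation ℝ A A) (hf : DegLT n f) :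
    DegLT (n + 1) (symD d f) := by
  have := hf.mulX_pow 1
  rw [pow_one] at this
  rw [HigherHeat.symD, LinearMap.add_apply]
  exact ((hf.coeffMap _).mono (by omega)).add this

theorem DegLT.symD_pow {n : ℕ} {f : A[X]} (d : Derivation ℝ A A) (hf : DegLT n f) (k : ℕ) :
    DegLT (n + k) ((HigherHeat.symD d ^ k) f) := by
  induction k with
  | zero => simpa using hf
  | succ k ih => rw [pow_succ']; exact ih.symD d

theorem symD_pow_sub_degLT {n : ℕ} {f : A[X]} (d : Derivation ℝ A A) (hf : DegLT n f) (k : ℕ) :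
    DegLT (n + k) ((symD d ^ (k + 1) - mulX ^ (k + 1) : Module.End ℝ A[X]) f) := by
  induction k with
  | zero => simpa [symD] using hf.coeffMap (d : A →ₗ[ℝ] A)
  | succ k ih =>
    have : symD d ^ (k + 2) - mulX ^ (k + 2) = symD d * (symD d ^ (k + 1) - mulX ^ (k + 1)) +
        coeffMap (d : A →ₗ[ℝ] A) * mulX ^ (k + 1) := by
      rw [mul_sub, ← pow_succ', pow_succ' mulX (k + 1)]
      nth_rewrite 3 [symD]
      rw [add_mul]
      abel
    rw [this, LinearMap.add_apply]
    exact (ih.symD d).add ((hf.mulX_pow (k + 1)).coeffMap _)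

/-- The part of (∂ + ξ)^(k+1) - ξ^(k+1) of highest degree in ξ is (k+1) ξ^k ∂. This is what makes
the quotient by (n+1) ξ^n act as ∂ on top coefficients. -/
theorem coeff_symD_pow_sub {n : ℕ} {f : A[X]} (d : Derivation ℝ A A) (hf : DegLT (n + 1) f)
    (k : ℕ) : ((symD d ^ (k + 1) - mulX ^ (k + 1) : Module.End ℝ A[X]) f).coeff (n + k) =
      ((k : ℝ) + 1) • d (f.coeff n) := by
  induction k with
  | zero => simp [symD]
  | succ k ih =>
    have : symD d ^ (k + 2) - mulX ^ (k + 2) = symD d * (symD d ^ (k + 1) - mulX ^ (k + 1)) +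
        coeffMap (d : A →ₗ[ℝ] A) * mulX ^ (k + 1) := by
      rw [mul_sub, ← pow_succ', pow_succ' mulX (k + 1)]
      nth_rewrite 3 [symD]
      rw [add_mul]
      abel
    have h0 := symD_pow_sub_degLT d hf k (n + k + 1) (by omega)
    rw [this, LinearMap.add_apply, coeff_add, Module.End.mul_apply, Module.End.mul_apply,
      ← add_assoc n k 1]
    nth_rewrite 1 [symD]
    rw [LinearMap.add_apply, coeff_add, coeff_coeffMap, h0, map_zero, mulX_apply, coeff_X_mul, ih,
      coeff_coeffMap, mulX_pow_apply, mul_comm, add_assoc n k 1, coeff_mul_X_pow]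
    push_cast
    module

theorem DegLT.symOp {m : ℕ} {f : A[X]} (n : ℕ) (d : Derivation ℝ A A) (u : ℕ → A)
    (hf : DegLT m f) : DegLT (m + n) (symOp n d u f) := by
  rw [HigherHeat.symOp, LinearMap.add_apply, LinearMap.sum_apply]
  refine (symD_pow_sub_degLT d hf n).add ?_
  refine DegLT.sum fun i hi => ?_
  exact ((hf.symD_pow d i).mulC (u i)).mono (by have := Finset.mem_range.1 hi; omega)

theorem coeff_symOp {m : ℕ} {f : A[X]} (n : ℕ) (d : Derivation ℝ A A) (u : ℕ → A)
    (hf : DegLT (m + 1) f) : (symOp n d u f).coeff (m + n) = ((n : ℝ) + 1) • d (f.coeff m) := by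
  unfold symOp
  rw [LinearMap.add_apply, coeff_add, coeff_symD_pow_sub d hf, LinearMap.sum_apply,
    finsetSum_coeff, Finset.sum_eq_zero, add_zero]
  intro i hi
  exact ((hf.symD_pow d i).mulC (u i)) _ (by have := Finset.mem_range.1 hi; omega)

theorem DegLT.quotPart {m n : ℕ} {f : A[X]} {T : Module.End ℝ A[X]} (hf : DegLT (m + n) (T f)) :
    DegLT m (quotPart n T f) := fun k hk => by
  simp only [HigherHeat.quotPart, LinearMap.smul_apply, Module.End.mul_apply, coeff_smul,
    coeff_divXEnd_pow]
  rw [hf _ (by omega), smul_zero]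

theorem smul_mulX_pow_mul_quotPart (n : ℕ) (T : Module.End ℝ A[X]) :
    ((n : ℝ) + 1) • (mulX ^ n * quotPart n T) = mulX ^ n * (divXEnd ^ n * T) := by
  have : (n : ℝ) + 1 ≠ 0 := by positivity
  rw [quotPart, mul_smul_comm, smul_smul, mul_inv_cancel₀ this, one_smul]

theorem degLT_remPart (n : ℕ) (T : Module.End ℝ A[X]) (f : A[X]) : DegLT n (remPart n T f) :=
  fun m hm => by
  obtain ⟨k, rfl⟩ := Nat.exists_eq_add_of_le' hm
  rw [remPart, smul_mulX_pow_mul_quotPart, LinearMap.sub_apply, coeff_sub, Module.End.mul_apply,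
    mulX_pow_apply, mul_comm, coeff_mul_X_pow, Module.End.mul_apply, coeff_divXEnd_pow, sub_self]

theorem remPart_apply_of_degLT {n : ℕ} {T : Module.End ℝ A[X]} {f : A[X]} (hf : DegLT n (T f)) :
    remPart n T f = T f := by
  have h : quotPart n T f = 0 := (DegLT.quotPart (m := 0) (by simpa using hf)).eq_zero
  simp [remPart, h]

theorem quotPart_apply_of_degLT {n : ℕ} {T : Module.End ℝ A[X]} {f : A[X]} (hf : DegLT n (T f)) :
    quotPart n T f = 0 := (DegLT.quotPart (m := 0) (by simpa using hf)).eq_zero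

end Operators

/-! ### Transport equations: existence and uniqueness -/

section Transport

variable {A : Type*} [CommRing A] [Algebra ℝ A]

/-- The transport equations for the generating polynomials `h k = ∑ j, H_k^j ξ ^ j` of the
Hadamard coefficients. -/
structure IsTransport (n : ℕ) (κ : ℝ) (d : Derivation ℝ A A) (δ : A) (u : ℕ → A)
    (h : ℕ → A[X]) : Prop where
  zero : h 0 = 1
  deg : ∀ k, DegLT n (h k)
  step : ∀ k : ℕ, ((k : ℝ) + 1) • h (k + 1) +
    theta δ (quotPart n (symOp n d u) (h (k + 1))) = κ • remPart n (symOp n d u) (h k)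

variable {n : ℕ} {d : Derivation ℝ A A} {δ : A} {u : ℕ → A}

theorem DegLT.theta_quotPart {m : ℕ} {f : A[X]} (hf : DegLT m f) :
    DegLT m (HigherHeat.theta δ (HigherHeat.quotPart n (HigherHeat.symOp n d u) f)) :=
  (DegLT.quotPart (hf.symOp n d u)).theta δ

/-- The quotient differentiates the top coefficient, δ multiplies it, and ∂/∂ξ only feeds lower
degrees. Hence θ P is triangular in the degree, with δ ∂ on the diagonal. -/
theorem coeff_theta_quotPart {m : ℕ} {f : A[X]} (hf : DegLT (m + 1) f) :
    (theta δ (quotPart n (symOp n d u) f)).coeff m = δ * d (f.coeff m) := by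
  have h1 : (quotPart n (symOp n d u) f).coeff (m + 1) = 0 :=
    DegLT.quotPart (hf.symOp n d u) _ le_rfl
  have h2 : (quotPart n (symOp n d u) f).coeff m = d (f.coeff m) := by
    simp only [quotPart, LinearMap.smul_apply, Module.End.mul_apply, coeff_smul, coeff_divXEnd_pow]
    have : (n : ℝ) + 1 ≠ 0 := by positivity
    rw [coeff_symOp n d u hf, smul_smul, inv_mul_cancel₀ this, one_smul]
  simp [theta, coeff_derivative, h1, h2]

/-- By triangularity the top coefficient satisfies the scalar equation c a + δ ∂a = 0, so `hU`
removes one degree at a time. The hypothesis `hU` provides the degree bound so that the case c = 0,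
where the scalar equation has nonzero solutions, can be handled by a condition on the top
coefficient. -/
theorem eq_zero_of_transport {c : ℝ} {m : ℕ} {f : A[X]} (hf : DegLT m f)
    (heq : c • f + theta δ (quotPart n (symOp n d u) f) = 0)
    (hU : ∀ k, DegLT (k + 1) f → c • f.coeff k + δ * d (f.coeff k) = 0 → f.coeff k = 0) :
    f = 0 := by
  induction m with
  | zero => exact hf.eq_zero
  | succ m ih =>
    refine ih fun k hk => ?_
    rcases hk.eq_or_lt with rfl | hk
    · refine hU m hf ?_
      have := congrArg (fun p => p.coeff m) heq
      simpa [coeff_theta_quotPart hf] using this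
    · exact hf k hk

/-- Solve the scalar equation for the top coefficient and subtract its contribution from the
right-hand side; this lowers the degree. -/
theorem exists_transport {c : ℝ} (hE : ∀ b : A, ∃ a, c • a + δ * d a = b) {m : ℕ} {F : A[X]}
    (hF : DegLT m F) :
    ∃ f, DegLT m f ∧ c • f + theta δ (quotPart n (symOp n d u) f) = F := by
  induction m generalizing F with
  | zero => exact ⟨0, fun _ _ => by simp, by simp [hF.eq_zero]⟩
  | succ m ih =>
    obtain ⟨a, ha⟩ := hE (F.coeff m)
    have hm : DegLT (m + 1) (monomial m a) := fun k hk => by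
      rw [coeff_monomial, if_neg (by omega)]
    obtain ⟨f, hf, hf'⟩ := ih (F := F - (c • monomial m a +
        theta δ (quotPart n (symOp n d u) (monomial m a)))) (fun k hk => by
      rcases hk.eq_or_lt with rfl | hk
      · rw [coeff_sub, coeff_add, coeff_theta_quotPart hm, coeff_smul, coeff_monomial, if_pos rfl,
          ha, sub_self]
      · exact (hF.sub ((hm.smul c).add hm.theta_quotPart)) k hk)
    refine ⟨f + monomial m a, (hf.mono (by omega)).add hm, ?_⟩
    rw [eq_sub_iff_add_eq] at hf'
    rw [← hf', map_add, map_add, smul_add]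
    abel

theorem exists_isTransport (hn : 1 ≤ n) (κ : ℝ)
    (hE : ∀ (k : ℕ) (b : A), ∃ a, ((k : ℝ) + 1) • a + δ * d a = b) :
    ∃ h, IsTransport n κ d δ u h := by
  have step (k : ℕ) (f : A[X]) := exists_transport (n := n) (u := u) (hE k) (m := n)
    (F := κ • remPart n (symOp n d u) f) ((degLT_remPart _ _ _).smul κ)
  choose s hs hs' using step
  let h (k : ℕ) : A[X] := Nat.rec 1 (fun k f => s k f) k
  have hsucc (k : ℕ) : h (k + 1) = s k (h k) := rfl
  refine ⟨h, rfl, fun k => ?_, fun k => by rw [hsucc]; exact hs' k (h k)⟩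
  cases k with
  | zero =>
    intro m hm
    simp [h, coeff_one, show m ≠ 0 by omega]
  | succ k => rw [hsucc]; exact hs k (h k)

theorem IsTransport.unique {κ : ℝ} {h h' : ℕ → A[X]} (hh : IsTransport n κ d δ u h)
    (hh' : IsTransport n κ d δ u h')
    (hU : ∀ (k : ℕ) (a : A), ((k : ℝ) + 1) • a + δ * d a = 0 → a = 0) (k : ℕ) : h k = h' k := by
  induction k with
  | zero => rw [hh.zero, hh'.zero]
  | succ k ih =>
    rw [← sub_eq_zero]
    refine eq_zero_of_transport (n := n) (u := u) (c := (k : ℝ) + 1)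
      ((hh.deg (k + 1)).sub (hh'.deg (k + 1))) ?_ fun m _ => hU k _
    have h1 := hh.step k
    have h2 := hh'.step k
    rw [ih, ← h2] at h1
    rw [map_sub, map_sub, smul_sub, ← sub_eq_zero.2 h1]
    abel

end Transport

/-! ### Commuting operators and transport defects -/

section Commutation

variable {A : Type*} [CommRing A] [Algebra ℝ A]

/-- Uniqueness of normal forms modulo the kernel relation: a combination of multiples of θ + c t ξ^n
whose coefficients all have degree less than n is trivial. Since θ does not raise the degree while
ξ^n raises it by n, the hypothesis forces the bound on `w` from 2n down to n and then to 0. -/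
theorem eq_zero_of_theta_add_degLT {n : ℕ} {c : ℝ} (hc : c ≠ 0) {δ : A} {w : ℕ → A[X]}
    (hw : ∀ k, DegLT (2 * n) (w k))
    (hz : ∀ k, DegLT n (theta δ (w (k + 1)) + c • (mulX ^ n) (w k))) (k : ℕ) : w k = 0 := by
  have descent {r : ℕ} (hr : n ≤ r) (hwr : ∀ k, DegLT r (w k)) (k : ℕ) :
      DegLT r ((mulX ^ n) (w k)) := by
    have := (((hz k).mono hr).sub ((hwr (k + 1)).theta δ)).smul c⁻¹
    rwa [add_sub_cancel_left, smul_smul, inv_mul_cancel₀ hc, one_smul] at this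
  have h1 (k) : DegLT n (w k) :=
    DegLT.of_mulX_pow (k := n) (by simpa [two_mul] using descent (by omega) hw k)
  exact (DegLT.of_mulX_pow (k := n) (by simpa using descent le_rfl h1 k)).eq_zero

variable {n : ℕ} {κ : ℝ} {δ : A} {S T : Module.End ℝ A[X]} {h : ℕ → A[X]}

/-- The defect in the transport equations built from the operator `T`. -/
def transportDefect (n : ℕ) (κ : ℝ) (δ : A) (T : Module.End ℝ A[X]) (h : ℕ → A[X]) (k : ℕ) :
    A[X] :=
  ((k : ℝ) + 1) • h (k + 1) + theta δ (quotPart n T (h (k + 1))) - κ • remPart n T (h k)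

theorem degLT_transportDefect (hT : ∀ m f, DegLT m f → DegLT (m + n) (T f))
    (hdeg : ∀ k, DegLT n (h k)) (k : ℕ) : DegLT n (transportDefect n κ δ T h k) :=
  (((hdeg _).smul _).add ((DegLT.quotPart (hT _ _ (hdeg _))).theta δ)).sub
    ((degLT_remPart _ _ _).smul _)

/-- If `h` solves the transport equations of `S`, then the defects of the transport equations of
an operator `T` that commutes with `S` solve the transport equations of `S`. -/
theorem transportDefect_transport (hκ : κ ≠ 0)
    (hθS : theta δ * S = S * theta δ - ((n : ℝ) + 1) • mulX ^ n)
    (hθT : theta δ * T = T * theta δ - ((n : ℝ) + 1) • mulX ^ n)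
    (hST : Commute S T) (hSX : Commute S mulX) (hTX : Commute T mulX)
    (hS : ∀ m f, DegLT m f → DegLT (m + n) (S f)) (hT : ∀ m f, DegLT m f → DegLT (m + n) (T f))
    (hdeg : ∀ k, DegLT n (h k)) (hS0 : DegLT n (S (h 0))) (hT0 : DegLT n (T (h 0)))
    (hstep : ∀ k, transportDefect n κ δ S h k = 0) :
    theta δ (quotPart n S (transportDefect n κ δ T h 0)) = 0 ∧
    ∀ k : ℕ, ((k : ℝ) + 1) • transportDefect n κ δ T h (k + 1) +
      theta δ (quotPart n S (transportDefect n κ δ T h (k + 1))) =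
        κ • remPart n S (transportDefect n κ δ T h k) := by
  set g := transportDefect n κ δ T h with hg
  set P := quotPart n S with hP
  set Q := quotPart n T with hQ
  -- With P, Q the quotients for S, T, the sequence `w` is the total multiple of the kernel relation
  -- by which the two reductions of the commuting operators differ. It is chosen so that the
  -- identity `key` holds.
  let w (k : ℕ) : A[X] := (k : ℝ) • (Q (h (k + 1)) - P (h (k + 1))) -
    κ • (S (Q (h k)) - T (P (h k))) + P (g k)
  have hgdeg : ∀ k, DegLT n (g k) := degLT_transportDefect hT hdeg
  have hPdeg {f} (hf : DegLT n f) : DegLT n (P f) := DegLT.quotPart (hS _ _ hf)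
  have hQdeg {f} (hf : DegLT n f) : DegLT n (Q f) := DegLT.quotPart (hT _ _ hf)
  have hwdeg (k) : DegLT (2 * n) (w k) := by
    have le : n ≤ 2 * n := by omega
    refine ((((hQdeg (hdeg _)).sub (hPdeg (hdeg _))).smul _).mono le |>.sub
      (DegLT.smul _ ?_)).add ((hPdeg (hgdeg k)).mono le)
    have h1 := hS _ _ (hQdeg (hdeg k))
    have h2 := hT _ _ (hPdeg (hdeg k))
    rw [two_mul]
    exact h1.sub h2
  have key (k : ℕ) : ((k : ℝ) + 1) • g (k + 1) + theta δ (P (g (k + 1))) - κ • remPart n S (g k) =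
      theta δ (w (k + 1)) + (κ * ((n : ℝ) + 1)) • (mulX ^ n) (w k) := by
    have e1 := hstep k
    have e2 := hstep (k + 1)
    have eS (f) : theta δ (S f) = S (theta δ f) - ((n : ℝ) + 1) • (mulX ^ n) f :=
      LinearMap.congr_fun hθS f
    have eT (f) : theta δ (T f) = T (theta δ f) - ((n : ℝ) + 1) • (mulX ^ n) f :=
      LinearMap.congr_fun hθT f
    have eST (f) : S (T f) = T (S f) := LinearMap.congr_fun hST f
    have eSX (f) : S ((mulX ^ n) f) = (mulX ^ n) (S f) := LinearMap.congr_fun (hSX.pow_right n) f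
    have eTX (f) : T ((mulX ^ n) f) = (mulX ^ n) (T f) := LinearMap.congr_fun (hTX.pow_right n) f
    have rS (f) : remPart n S f = S f - ((n : ℝ) + 1) • (mulX ^ n) (P f) := rfl
    have rT (f) : remPart n T f = T f - ((n : ℝ) + 1) • (mulX ^ n) (Q f) := rfl
    have e3 := congrArg T e1
    have gk (k) : g k = ((k : ℝ) + 1) • h (k + 1) + theta δ (Q (h (k + 1))) -
      κ • remPart n T (h k) := rfl
    simp only [transportDefect, ← hP, rS, map_sub, map_add, map_smul, map_zero] at e2 e3
    simp only [w, rS, map_sub, map_add, map_smul, eS, eT]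
    have e4 : S (g k) = ((k : ℝ) + 1) • S (h (k + 1)) + S (theta δ (Q (h (k + 1)))) -
        κ • (S (T (h k)) - ((n : ℝ) + 1) • S ((mulX ^ n) (Q (h k)))) := by
      rw [gk, rT]; simp only [map_sub, map_add, map_smul]
    have e5 : g (k + 1) = ((k : ℝ) + 1 + 1) • h (k + 1 + 1) + theta δ (Q (h (k + 1 + 1))) -
        κ • (T (h (k + 1)) - ((n : ℝ) + 1) • (mulX ^ n) (Q (h (k + 1)))) := by
      rw [gk, rT]; push_cast; rfl
    rw [e4, eSX, eST]
    rw [eTX] at e3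
    push_cast at e2 ⊢
    generalize theta δ (P (g (k + 1))) = a at *
    rw [e5]
    linear_combination (norm := module) ((k : ℝ) + 1) • e2 - κ • e3
  -- The left side of `key` has degree less than n, so the right side does too, and `w` vanishes.
  have hw0 := eq_zero_of_theta_add_degLT (mul_ne_zero hκ (by positivity : ((n : ℝ) + 1) ≠ 0))
    hwdeg (fun k => by
      rw [← key]
      exact (((hgdeg _).smul _).add ((hPdeg (hgdeg _)).theta δ)).sub ((degLT_remPart _ _ _).smul _))
  constructor
  · have h0 := hw0 0
    -- Both quotients vanish on h_0, so w_0 is just P g_0.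
    have hP0 : P (h 0) = 0 := quotPart_apply_of_degLT hS0
    have hQ0 : Q (h 0) = 0 := quotPart_apply_of_degLT hT0
    simp only [w, hP0, hQ0, map_zero, sub_self, smul_zero, Nat.cast_zero, zero_smul,
      zero_add] at h0
    rw [h0, map_zero]
  · intro k
    have := key k
    rw [hw0, hw0, map_zero, map_zero, smul_zero, add_zero, sub_eq_zero] at this
    exact this

end Commutation

/-! ### Functionals that annihilate the image of θ on the diagonal -/

section DiagonalFunctional

variable {A : Type*} [CommRing A] [Algebra ℝ A]

/-- The functional `∑ i, f_i ξ ^ i ↦ ∑ i, (i choose m) (-∂) ^ (i - m) f_i`. -/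
def adjointCoeff (d : Derivation ℝ A A) (m : ℕ) : A[X] →ₗ[ℝ] A :=
  Polynomial.lsum fun i => (i.choose m : ℝ) • (-(d : A →ₗ[ℝ] A)) ^ (i - m)

theorem adjointCoeff_monomial (d : Derivation ℝ A A) (m i : ℕ) (a : A) :
    adjointCoeff d m (monomial i a) =
      (i.choose m : ℝ) • ((-(d : A →ₗ[ℝ] A)) ^ (i - m)) a := by
  simp only [adjointCoeff, Polynomial.lsum_apply]
  rw [Polynomial.sum_monomial_index _ _ (by simp)]
  rfl

theorem adjointCoeff_of_degLT (d : Derivation ℝ A A) {m : ℕ} {f : A[X]} (hf : DegLT (m + 1) f) :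
    adjointCoeff d m f = f.coeff m := by
  have hlt : f.natDegree < m + 1 := by
    by_contra hcon
    have h1 := hf f.natDegree (by omega)
    have h2 : f = 0 := by simpa using h1
    simp [h2] at hcon
  rw [f.as_sum_range' (m + 1) hlt, map_sum, finsetSum_coeff]
  refine Finset.sum_congr rfl fun i hi => ?_
  rw [adjointCoeff_monomial, coeff_monomial]
  rcases (Nat.lt_succ_iff.1 (Finset.mem_range.1 hi)).eq_or_lt with rfl | h
  · simp
  · rw [Nat.choose_eq_zero_of_lt h, if_neg h.ne]; simp

theorem neg_derivation_pow_mul (d : Derivation ℝ A A) {δ : A} (hδ : d δ = 1) (r : ℕ) (a : A) :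
    ((-(d : A →ₗ[ℝ] A)) ^ (r + 1)) (δ * a) =
      δ * ((-(d : A →ₗ[ℝ] A)) ^ (r + 1)) a - ((r : ℝ) + 1) • ((-(d : A →ₗ[ℝ] A)) ^ r) a := by
  induction r with
  | zero => simp [hδ]; ring
  | succ r ih =>
    rw [pow_succ', Module.End.mul_apply, Module.End.mul_apply, ih]
    have e : ((-(d : A →ₗ[ℝ] A)) ^ (r + 1)) a = -d (((-(d : A →ₗ[ℝ] A)) ^ r) a) := by
      rw [pow_succ', Module.End.mul_apply]; rfl
    generalize ((-(d : A →ₗ[ℝ] A)) ^ (r + 1)) a = b at *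
    simp only [LinearMap.neg_apply, Derivation.coeFn_coe, map_sub, Derivation.leibniz, map_smul,
      hδ, smul_eq_mul, mul_one, mul_neg]
    push_cast
    linear_combination (norm := module) ((r : ℝ) + 1) • e

/-- Moving δ out of (-∂)^(i-m) costs -(i-m) (-∂)^(i-m-1), which cancels the contribution of ∂/∂ξ
because (i choose m)(i - m) = i (i-1 choose m). Where δ = 0 the functionals therefore vanish on the
image of θ. -/
theorem adjointCoeff_theta (d : Derivation ℝ A A) {δ : A} (hδ : d δ = 1) (m : ℕ) (f : A[X]) :
    adjointCoeff d m (theta δ f) = δ * adjointCoeff d m f := by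
  induction f using Polynomial.induction_on' with
  | add p q hp hq => simp [hp, hq, mul_add]
  | monomial i a =>
    rw [theta, LinearMap.add_apply, mulC_apply, derivX_apply, C_mul_monomial,
      derivative_monomial, map_add, adjointCoeff_monomial, adjointCoeff_monomial,
      adjointCoeff_monomial]
    have hcast : a * (i : A) = (i : ℝ) • a := by rw [Algebra.smul_def]; simp [mul_comm]
    rw [hcast, map_smul]
    rcases lt_trichotomy i m with h | rfl | h
    · simp [Nat.choose_eq_zero_of_lt h, Nat.choose_eq_zero_of_lt (show i - 1 < m by omega)]
    · rcases Nat.eq_zero_or_pos i with rfl | hi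
      · simp
      · simp [Nat.choose_eq_zero_of_lt (show i - 1 < i by omega)]
    · obtain ⟨r, rfl⟩ := Nat.exists_eq_add_of_lt h
      have e1 : m + r + 1 - m = r + 1 := by omega
      have e2 : m + r + 1 - 1 - m = r := by omega
      have e3 : m + r + 1 - 1 = m + r := by omega
      have hch : ((m + r + 1).choose m : ℝ) * (r + 1) = (m + r).choose m * ((m + r + 1 : ℕ) : ℝ) := by
        have := Nat.choose_mul_succ_eq (m + r) m
        rw [show m + r + 1 - m = r + 1 by omega] at this
        exact_mod_cast this.symm
      rw [e1, e2, e3, neg_derivation_pow_mul d hδ, smul_sub, smul_smul, smul_smul, hch,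
        mul_smul_comm]
      abel

end DiagonalFunctional

/-! ### The flip of x, y and ξ, and the conjugated operator -/

section Flip

variable {A : Type*} [CommRing A] [Algebra ℝ A]

/-- The map `f(ξ) ↦ (σ f)(-ξ)`. -/
def flip (σ : A →ₐ[ℝ] A) : Module.End ℝ A[X] :=
  Polynomial.lsum fun i => (Polynomial.monomial i).restrictScalars ℝ ∘ₗ
    (((-1 : ℝ) ^ i) • σ.toLinearMap)

@[simp] theorem coeff_flip (σ : A →ₐ[ℝ] A) (f : A[X]) (m : ℕ) :
    (flip σ f).coeff m = (-1 : ℝ) ^ m • σ (f.coeff m) := by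
  induction f using Polynomial.induction_on' with
  | add p q hp hq => simp [hp, hq]
  | monomial k a =>
    simp only [flip, Polynomial.lsum_apply, LinearMap.coe_comp, Function.comp_apply,
      LinearMap.coe_restrictScalars]
    rw [Polynomial.sum_monomial_index _ _ (by simp)]
    simp only [coeff_monomial, LinearMap.smul_apply, AlgHom.toLinearMap_apply]
    split_ifs with h <;> simp [h]

variable {σ : A →ₐ[ℝ] A} {dx dy : Derivation ℝ A A} {δ : A}

theorem flip_mul_flip (hσ : ∀ a, σ (σ a) = a) : flip σ * flip σ = 1 := by
  refine LinearMap.ext fun f => Polynomial.ext fun m => ?_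
  simp [hσ, smul_smul, ← pow_add, ← two_mul]

theorem semiconj_flip_mulX : SemiconjBy (flip σ) mulX ((-1 : ℝ) • mulX) := by
  refine LinearMap.ext fun f => Polynomial.ext fun m => ?_
  cases m <;> simp [pow_succ]

theorem semiconj_flip_mulC (a : A) : SemiconjBy (flip σ) (mulC a) (mulC (σ a)) := by
  refine LinearMap.ext fun f => Polynomial.ext fun m => ?_
  simp

theorem semiconj_flip_derivX : SemiconjBy (flip σ) derivX ((-1 : ℝ) • derivX) := by
  refine LinearMap.ext fun f => Polynomial.ext fun m => ?_
  simp [coeff_derivative, pow_succ]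

theorem semiconj_flip_coeffMap (hd : ∀ a, σ (dx a) = dy (σ a)) :
    SemiconjBy (flip σ) (coeffMap (dx : A →ₗ[ℝ] A)) (coeffMap (dy : A →ₗ[ℝ] A)) := by
  refine LinearMap.ext fun f => Polynomial.ext fun m => ?_
  simp [hd]

theorem flip_mul_theta (hσδ : σ δ = -δ) : flip σ * theta δ = (-1 : ℝ) • (theta δ * flip σ) := by
  have h1 := (semiconj_flip_mulC (σ := σ) δ).eq
  have h2 := (semiconj_flip_derivX (σ := σ)).eq
  have h3 : (mulC (-δ) : Module.End ℝ A[X]) = (-1 : ℝ) • mulC δ :=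
    LinearMap.ext fun f => by simp
  rw [theta, mul_add, add_mul, h1, h2, hσδ, h3, smul_mul_assoc, smul_mul_assoc, smul_add]

theorem semiconj_flip_divXEnd : SemiconjBy (flip σ) divXEnd ((-1 : ℝ) • divXEnd) := by
  refine LinearMap.ext fun f => Polynomial.ext fun m => ?_
  simp [coeff_divX, pow_succ]

/-- `symOp` conjugated by `flip`, and multiplied by `(-1) ^ (n + 1)`. -/
def flipOp (σ : A →ₐ[ℝ] A) (n : ℕ) (d : Derivation ℝ A A) (u : ℕ → A) : Module.End ℝ A[X] :=
  (-1 : ℝ) ^ (n + 1) • (flip σ * symOp n d u * flip σ)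

theorem DegLT.flip {m : ℕ} {f : A[X]} (hf : DegLT m f) : DegLT m (flip σ f) :=
  fun k hk => by simp [hf k hk]

theorem DegLT.flipOp {m : ℕ} {f : A[X]} (n : ℕ) (u : ℕ → A) (hf : DegLT m f) :
    DegLT (m + n) (flipOp σ n dx u f) :=
  ((hf.flip.symOp n dx u).flip).smul _

variable (n : ℕ) (u : ℕ → A)

/-- The flip anticommutes with θ and gives ξ^n the sign (-1)^n. The factor (-1)^(n+1) in `flipOp`
compensates both, so that S and T have the same commutator with θ. -/
theorem theta_mul_flipOp (hσ : ∀ a, σ (σ a) = a) (hσδ : σ δ = -δ) (hδ : dx δ = 1) :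
    theta δ * flipOp σ n dx u = flipOp σ n dx u * theta δ - ((n : ℝ) + 1) • mulX ^ n := by
  have h1 := flip_mul_theta (σ := σ) hσδ
  have h2 : theta δ * flip σ = (-1 : ℝ) • (flip σ * theta δ) := by rw [h1, smul_smul]; simp
  have h3 := theta_mul_symOp n dx u hδ
  have h4 := ((semiconj_flip_mulX (σ := σ)).pow_right n).eq
  have hp : flip σ * mulX ^ n * flip σ = (-1 : ℝ) ^ n • mulX ^ n := by
    rw [h4, mul_assoc, flip_mul_flip hσ, mul_one, _root_.smul_pow]
  have hs : (-1 : ℝ) ^ (n + 1) * (-1) ^ n = -1 := by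
    rw [← pow_add, show n + 1 + n = 2 * n + 1 by ring, pow_succ, pow_mul]; simp
  have key : theta δ * (flip σ * symOp n dx u * flip σ) =
      flip σ * symOp n dx u * flip σ * theta δ +
        ((n : ℝ) + 1) • (flip σ * mulX ^ n * flip σ) := by
    calc theta δ * (flip σ * symOp n dx u * flip σ)
        = (-1 : ℝ) • (flip σ * (theta δ * symOp n dx u) * flip σ) := by
          rw [← mul_assoc, ← mul_assoc, h2, smul_mul_assoc, smul_mul_assoc]; simp only [mul_assoc]
      _ = (-1 : ℝ) • (flip σ * symOp n dx u * (theta δ * flip σ)) +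
          ((n : ℝ) + 1) • (flip σ * mulX ^ n * flip σ) := by
          rw [h3, mul_sub, sub_mul, mul_smul_comm, smul_mul_assoc]; simp only [mul_assoc]; module
      _ = _ := by
          rw [h2, mul_smul_comm, smul_smul]; simp only [mul_assoc, mul_neg, neg_neg, one_smul,
            mul_one]
  rw [flipOp, mul_smul_comm, key, smul_add, hp, smul_mul_assoc, smul_smul, smul_smul,
    mul_right_comm, hs]
  module

/-- Up to a sign, the conjugate is the same expression written in ∂_y - ξ, -ξ and the coefficients σ
u_i. The latter do not depend on x and the u_i do not depend on y, so every building block of one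
operator commutes with every building block of the other. -/
theorem commute_symOp_flipOp (hσ : ∀ a, σ (σ a) = a) (hd : ∀ a, σ (dx a) = dy (σ a))
    (hcomm : ∀ a, dx (dy a) = dy (dx a)) (hu : ∀ i, dy (u i) = 0) :
    Commute (symOp n dx u) (flipOp σ n dx u) := by
  set E : Module.End ℝ A[X] := coeffMap (dy : A →ₗ[ℝ] A) + (-1 : ℝ) • mulX with hE
  have hσu (i) : dx (σ (u i)) = 0 := by
    have := hd (dx (σ (u i)))
    have h2 := hd (σ (u i))
    rw [hσ, hu] at h2
    rw [← hσ (dx (σ (u i))), h2, map_zero]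
  have hsemi : SemiconjBy (flip σ) (symOp n dx u) (E ^ (n + 1) - ((-1 : ℝ) • mulX) ^ (n + 1) +
      ∑ i ∈ Finset.range n, mulC (σ (u i)) * E ^ i) := by
    have hD : SemiconjBy (flip σ) (symD dx) E :=
      (semiconj_flip_coeffMap hd).add_right semiconj_flip_mulX
    refine ((hD.pow_right _).sub_right (semiconj_flip_mulX.pow_right _)).add_right ?_
    unfold SemiconjBy
    rw [Finset.mul_sum, Finset.sum_mul]
    exact Finset.sum_congr rfl fun i _ => (semiconj_flip_mulC _).mul_right (hD.pow_right _)
  have hop : flipOp σ n dx u = (-1 : ℝ) ^ (n + 1) • (E ^ (n + 1) - ((-1 : ℝ) • mulX) ^ (n + 1) +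
      ∑ i ∈ Finset.range n, mulC (σ (u i)) * E ^ i) := by
    rw [flipOp, hsemi.eq, mul_assoc, flip_mul_flip hσ, mul_one]
  rw [hop]
  refine Commute.smul_right ?_ _
  have hX := commute_symOp_mulX n dx u
  have hDC (i) : Commute (symD dx) (mulC (σ (u i))) := commute_symD_mulC dx (hσu i)
  have hDE : Commute (symD dx) E := by
    refine Commute.add_left ((commute_coeffMap hcomm).add_right
      ((commute_coeffMap_mulX _).smul_right _)) ?_
    exact (commute_coeffMap_mulX _).symm.add_right ((Commute.refl mulX).smul_right _)
  have hXE : Commute mulX E :=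
    (commute_coeffMap_mulX _).symm.add_right ((Commute.refl mulX).smul_right _)
  have hCE (i) : Commute (mulC (u i)) E := by
    have h0 : (mulC (0 : A) : Module.End ℝ A[X]) = 0 := LinearMap.ext fun f => by simp
    have := coeffMap_mul_mulC dy (u i)
    rw [hu, h0, add_zero] at this
    exact Commute.add_right (Commute.symm this) ((commute_mulC_mulX _).smul_right _)
  have hSE : Commute (symOp n dx u) E :=
    ((hDE.pow_left _).sub_left (hXE.pow_left _)).add_left
      (Commute.sum_left _ _ _ fun i _ => (hCE i).mul_left (hDE.pow_left _))
  have hSC (i) : Commute (symOp n dx u) (mulC (σ (u i))) :=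
    (((hDC i).pow_left _).sub_left ((commute_mulC_mulX _).symm.pow_left _)).add_left
      (Commute.sum_left _ _ _ fun j _ => (commute_mulC _ _).mul_left ((hDC i).pow_left _))
  exact ((hSE.pow_right _).sub_right ((hX.smul_right _).pow_right _)).add_right
    (Commute.sum_right _ _ _ fun i _ => (hSC i).mul_right (hSE.pow_right _))

theorem commute_flipOp_mulX : Commute (flipOp σ n dx u) mulX := by
  have h0 := (semiconj_flip_mulX (σ := σ)).eq
  have h1 : SemiconjBy (flip σ) ((-1 : ℝ) • mulX) mulX := by
    unfold SemiconjBy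
    rw [mul_smul_comm, h0, smul_mul_assoc, smul_smul]; simp
  have h2 : SemiconjBy (symOp n dx u) ((-1 : ℝ) • mulX) ((-1 : ℝ) • mulX) :=
    (commute_symOp_mulX n dx u).smul_right _
  refine Commute.smul_left ?_ _
  exact SemiconjBy.mul_left (h1.mul_left h2) semiconj_flip_mulX

theorem flip_quotPart_flipOp (hσ : ∀ a, σ (σ a) = a) :
    flip σ * quotPart n (flipOp σ n dx u) =
      (-1 : ℝ) • (quotPart n (symOp n dx u) * flip σ) := by
  have h1 := ((semiconj_flip_divXEnd (σ := σ)).pow_right n).eq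
  have hs : (-1 : ℝ) ^ (n + 1) * (-1) ^ n = -1 := by
    rw [← pow_add, show n + 1 + n = 2 * n + 1 by ring, pow_succ, pow_mul]; simp
  have h3 : flip σ * (flip σ * symOp n dx u * flip σ) = symOp n dx u * flip σ := by
    rw [← mul_assoc, ← mul_assoc, flip_mul_flip hσ, one_mul]
  rw [quotPart, mul_smul_comm, ← mul_assoc, h1, _root_.smul_pow, quotPart, flipOp, mul_assoc,
    mul_smul_comm, h3, smul_mul_smul_comm, mul_comm ((-1 : ℝ) ^ n), hs, smul_mul_assoc, mul_assoc]
  module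

/-- In the flip of θ Q f the signs from θ and from the quotient cancel. The sign here is thus the
only one left in the flipped transport equation, and it accumulates to (-1)^((n+1)k). -/
theorem flip_remPart_flipOp (hσ : ∀ a, σ (σ a) = a) :
    flip σ * remPart n (flipOp σ n dx u) =
      (-1 : ℝ) ^ (n + 1) • (remPart n (symOp n dx u) * flip σ) := by
  have h1 := ((semiconj_flip_mulX (σ := σ)).pow_right n).eq
  have h3 : flip σ * flipOp σ n dx u = (-1 : ℝ) ^ (n + 1) • (symOp n dx u * flip σ) := by
    rw [flipOp, mul_smul_comm, ← mul_assoc, ← mul_assoc, flip_mul_flip hσ, one_mul]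
  rw [remPart, mul_sub, h3, mul_smul_comm, ← mul_assoc, h1, _root_.smul_pow, mul_assoc,
    flip_quotPart_flipOp n u hσ, remPart, sub_mul, smul_mul_assoc, smul_mul_assoc, mul_smul_comm,
    ← mul_assoc, pow_succ]
  module

end Flip

/-! ### Symmetry of solutions of the transport equations -/

section Symmetry

variable {A : Type*} [CommRing A] [Algebra ℝ A]

theorem symD_pow_one (d : Derivation ℝ A A) (i : ℕ) : (symD d ^ i) (1 : A[X]) = X ^ i := by
  induction i with
  | zero => simp
  | succ i ih =>
    rw [pow_succ', Module.End.mul_apply, ih, symD, LinearMap.add_apply, mulX_apply]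
    have : coeffMap (d : A →ₗ[ℝ] A) (X ^ i) = 0 := by
      ext m
      rw [coeff_coeffMap, coeff_X_pow]
      split_ifs <;> simp
    rw [this, zero_add, pow_succ']

theorem symOp_one (n : ℕ) (d : Derivation ℝ A A) (u : ℕ → A) :
    symOp n d u 1 = ∑ i ∈ Finset.range n, monomial i (u i) := by
  simp only [symOp, LinearMap.add_apply, LinearMap.sub_apply, symD_pow_one, mulX_pow_apply,
    mul_one, sub_self, zero_add, LinearMap.sum_apply, Module.End.mul_apply, mulC_apply,
    C_mul_X_pow_eq_monomial]

theorem degLT_symOp_one (n : ℕ) (d : Derivation ℝ A A) (u : ℕ → A) : DegLT n (symOp n d u 1) := by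
  rw [symOp_one]
  refine DegLT.sum fun i hi m hm => ?_
  rw [coeff_monomial, if_neg]
  have := Finset.mem_range.1 hi
  omega

theorem flip_one (σ : A →ₐ[ℝ] A) : flip σ 1 = 1 := by
  ext m
  rw [coeff_flip, coeff_one]
  split_ifs with h <;> simp [h]

theorem flip_monomial (σ : A →ₐ[ℝ] A) (i : ℕ) (a : A) :
    flip σ (monomial i a) = monomial i ((-1 : ℝ) ^ i • σ a) := by
  ext m
  rw [coeff_flip, coeff_monomial, coeff_monomial]
  split_ifs with h <;> simp [h]

theorem flipOp_one (σ : A →ₐ[ℝ] A) (n : ℕ) (d : Derivation ℝ A A) (u : ℕ → A) :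
    flipOp σ n d u 1 = (-1 : ℝ) ^ (n + 1) •
      ∑ i ∈ Finset.range n, monomial i ((-1 : ℝ) ^ i • σ (u i)) := by
  simp only [flipOp, LinearMap.smul_apply, Module.End.mul_apply, flip_one, symOp_one, map_sum,
    flip_monomial]

/-- The functions σ u_i are constant in x, so all terms with a positive power of ∂ vanish. -/
theorem adjointCoeff_flipOp_one {σ : A →ₐ[ℝ] A} {n : ℕ} {d : Derivation ℝ A A} {u : ℕ → A}
    (hu : ∀ i, d (σ (u i)) = 0) {m : ℕ} (hm : m < n) :
    adjointCoeff d m (flipOp σ n d u 1) = ((-1 : ℝ) ^ (n + 1) * (-1) ^ m) • σ (u m) := by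
  rw [flipOp_one, map_smul, map_sum, Finset.sum_eq_single m, adjointCoeff_monomial, mul_smul]
  · simp
  · intro i _ hi
    rw [adjointCoeff_monomial]
    rcases lt_or_gt_of_ne hi with h | h
    · simp [Nat.choose_eq_zero_of_lt h]
    · obtain ⟨r, rfl⟩ := Nat.exists_eq_add_of_lt h
      rw [show m + r + 1 - m = r + 1 by omega, pow_succ, Module.End.mul_apply, map_smul]
      simp [hu]
  · intro h
    simp [hm] at h

/-- The Hadamard coefficients of an operator that equals its formal adjoint up to the sign
`(-1) ^ (n + 1)` are symmetric up to signs. -/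
theorem IsTransport.eq_smul_flip {n : ℕ} {κ : ℝ} {dx dy : Derivation ℝ A A} {δ : A} {u : ℕ → A}
    {h : ℕ → A[X]} {σ : A →ₐ[ℝ] A} {B : Type*} [CommRing B] [Algebra ℝ B] (diag : A →ₐ[ℝ] B)
    (hκ : κ ≠ 0) (hh : IsTransport n κ dx δ u h)
    (hσ : ∀ a, σ (σ a) = a) (hσδ : σ δ = -δ) (hδ : dx δ = 1)
    (hd : ∀ a, σ (dx a) = dy (σ a)) (hcomm : ∀ a, dx (dy a) = dy (dx a))
    (hu : ∀ i, dy (u i) = 0) (hdiag : diag δ = 0) (hdiagσ : ∀ a, diag (σ a) = diag a)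
    (hadj : ∀ m < n, adjointCoeff dx m (∑ i ∈ Finset.range n, monomial i (u i)) =
      ((-1 : ℝ) ^ (n + 1) * (-1) ^ m) • u m)
    (hU : ∀ (k : ℕ) (a : A), ((k : ℝ) + 1) • a + δ * dx a = 0 → a = 0)
    (hU0 : ∀ a : A, δ * dx a = 0 → diag a = 0 → a = 0) (k : ℕ) :
    h k = ((-1 : ℝ) ^ (n + 1)) ^ k • flip σ (h k) := by
  have hσu (i) : dx (σ (u i)) = 0 := by
    have h2 := hd (σ (u i))
    rw [hσ, hu] at h2
    rw [← hσ (dx (σ (u i))), h2, map_zero]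
  set S := symOp n dx u with hS
  set T := flipOp σ n dx u with hT
  have hS1 : DegLT n (S 1) := degLT_symOp_one n dx u
  have hT1 : DegLT n (T 1) := by
    rw [hT, flipOp, LinearMap.smul_apply, Module.End.mul_apply, Module.End.mul_apply, flip_one]
    exact hS1.flip.smul _
  have hstep (k) : transportDefect n κ δ S h k = 0 := by
    rw [transportDefect, hh.step k, sub_self]
  set g := transportDefect n κ δ T h with hg
  obtain ⟨hg0, hgs⟩ := transportDefect_transport (T := T) hκ (theta_mul_symOp n dx u hδ)
    (theta_mul_flipOp n u hσ hσδ hδ) (commute_symOp_flipOp n u hσ hd hcomm hu)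
    (commute_symOp_mulX n dx u) (commute_flipOp_mulX n u) (fun m f hf => hf.symOp n dx u)
    (fun m f hf => hf.flipOp n u) hh.deg (by rw [hh.zero]; exact hS1) (by rw [hh.zero]; exact hT1)
    hstep
  have hgdeg : ∀ k, DegLT n (g k) :=
    degLT_transportDefect (fun m f hf => hf.flipOp n u) hh.deg
  -- Eliminate h_1 with the first transport equation of S: apart from a term in the image of θ, only
  -- κ (S 1 - T 1) is left.
  have hg0' : g 0 = theta δ (quotPart n T (h 1) - quotPart n S (h 1)) + κ • (S 1 - T 1) := by
    have h0 := hstep 0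
    rw [transportDefect, hh.zero, remPart_apply_of_degLT hS1] at h0
    rw [hg, transportDefect, hh.zero, remPart_apply_of_degLT hT1, map_sub]
    linear_combination (norm := module) h0
  -- On the diagonal the θ-term drops out, and the formal adjointness identity makes the functionals
  -- agree on S 1 and T 1.
  have hdiag0 (m) (hm : m < n) : diag (adjointCoeff dx m (g 0)) = 0 := by
    rw [hg0', map_add, adjointCoeff_theta dx hδ, map_smul, map_sub _ (S 1), hT,
      adjointCoeff_flipOp_one hσu hm, hS, symOp_one, hadj m hm]
    simp [hdiag, hdiagσ]
  have hgz (k) : g k = 0 := by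
    induction k with
    | zero =>
      refine eq_zero_of_transport (c := 0) (hgdeg 0) (by rw [zero_smul, zero_add]; exact hg0)
        -- The top coefficient of g_0 solves δ ∂a = 0, and `adjointCoeff` returns exactly this
        -- coefficient once the higher ones are known to vanish. Its diagonal value is therefore
        -- zero.
        fun m hm hm' => ?_
      rcases lt_or_ge m n with hmn | hmn
      · refine hU0 _ (by simpa using hm') ?_
        rw [← adjointCoeff_of_degLT dx hm]
        exact hdiag0 m hmn
      · exact hgdeg 0 m hmn
    | succ k ih =>
      have := hgs k
      rw [← hg, ih, map_zero, smul_zero] at this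
      exact eq_zero_of_transport (hgdeg (k + 1)) this fun m _ => hU k _
  have hss : (-1 : ℝ) ^ (n + 1) * (-1) ^ (n + 1) = 1 := by
    rw [← pow_add, ← two_mul, pow_mul]; simp
  -- All T-defects vanish, so flipping the T-equations exhibits the signed flip of h as a second
  -- solution of the S-equations.
  refine hh.unique (h' := fun k => ((-1 : ℝ) ^ (n + 1)) ^ k • flip σ (h k))
    ⟨?_, fun k => (hh.deg k).flip.smul _, fun k => ?_⟩ hU k
  · simp [hh.zero, flip_one]
  · have h1 := congrArg (flip σ) (hgz k)
    have e1 (f) : flip σ (theta δ f) = (-1 : ℝ) • theta δ (flip σ f) := by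
      simpa only [Module.End.mul_apply, LinearMap.smul_apply] using
        LinearMap.congr_fun (flip_mul_theta hσδ) f
    have e2 (f) : flip σ (quotPart n T f) = (-1 : ℝ) • quotPart n S (flip σ f) := by
      simpa only [Module.End.mul_apply, LinearMap.smul_apply] using
        LinearMap.congr_fun (flip_quotPart_flipOp n u hσ) f
    have e3 (f) : flip σ (remPart n T f) = (-1 : ℝ) ^ (n + 1) • remPart n S (flip σ f) := by
      simpa only [Module.End.mul_apply, LinearMap.smul_apply] using
        LinearMap.congr_fun (flip_remPart_flipOp n u hσ) f
    rw [hg, transportDefect, map_sub, map_add, map_smul, map_smul, e1, e2, e3, map_smul, map_zero]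
      at h1
    simp only [map_smul]
    rw [pow_succ]
    generalize (-1 : ℝ) ^ (n + 1) = ε at *
    have h2 := congrArg (fun v => (ε ^ k * ε) • v) h1
    simp only [smul_zero, smul_sub, smul_add, smul_smul] at h2 ⊢
    rw [show ε ^ k * ε * (κ * ε) = κ * ε ^ k by linear_combination ε ^ k * κ * hss] at h2
    linear_combination (norm := module) h2

end Symmetry

/-! ### Change of coefficient algebra -/

section Functoriality

variable {A B : Type*} [CommRing A] [Algebra ℝ A] [CommRing B] [Algebra ℝ B]

theorem IsTransport.map {n : ℕ} {κ : ℝ} {d : Derivation ℝ A A} {δ : A} {u : ℕ → A}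
    {h : ℕ → A[X]} (hh : IsTransport n κ d δ u h) (ρ : A →ₐ[ℝ] B) (d' : Derivation ℝ B B)
    (hd : ∀ a, ρ (d a) = d' (ρ a)) :
    IsTransport n κ d' (ρ δ) (fun i => ρ (u i)) fun k => (h k).map (ρ : A →+* B) := by
  set r : A[X] → B[X] := fun f => f.map (ρ : A →+* B) with hr
  have rcoeff (f m) : (r f).coeff m = ρ (f.coeff m) := by simp [hr]
  have radd (f g) : r (f + g) = r f + r g := by simp [hr]
  have rsub (f g) : r (f - g) = r f - r g := by simp [hr]
  have rsmul (c : ℝ) (f) : r (c • f) = c • r f := by ext m; simp [rcoeff]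
  have rD (f) : r (symD d f) = symD d' (r f) := by
    simp only [symD, LinearMap.add_apply, radd]
    congr 1
    · ext m; simp [rcoeff, hd]
    · simp [hr]
  have rX (i f) : r ((mulX ^ i) f) = (mulX ^ i) (r f) := by
    simp [hr, mulX_pow_apply]
  have rDp (i f) : r ((symD d ^ i) f) = (symD d' ^ i) (r f) := by
    induction i with
    | zero => simp
    | succ i ih => rw [pow_succ', pow_succ', Module.End.mul_apply, Module.End.mul_apply, rD, ih]
  have rT (f) : r (symOp n d u f) = symOp n d' (fun i => ρ (u i)) (r f) := by
    have rsum (F : ℕ → A[X]) : r (∑ i ∈ Finset.range n, F i) = ∑ i ∈ Finset.range n, r (F i) := by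
      simp only [hr, Polynomial.map_sum]
    simp only [symOp, LinearMap.add_apply, LinearMap.sub_apply, LinearMap.sum_apply, radd, rsub,
      rDp, rX, rsum, Module.End.mul_apply]
    congr 1
    refine Finset.sum_congr rfl fun i _ => ?_
    rw [← rDp]
    simp [hr]
  have rQ (f) : r (quotPart n (symOp n d u) f) = quotPart n (symOp n d' fun i => ρ (u i)) (r f) := by
    ext m
    simp only [quotPart, LinearMap.smul_apply, Module.End.mul_apply, rcoeff, coeff_smul,
      coeff_divXEnd_pow, map_smul, ← rT]
  have rR (f) : r (remPart n (symOp n d u) f) = remPart n (symOp n d' fun i => ρ (u i)) (r f) := by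
    simp only [remPart, LinearMap.smul_apply, LinearMap.sub_apply, Module.End.mul_apply, rsub,
      rsmul, rX, rT, rQ]
  have rθ (f) : r (theta δ f) = theta (ρ δ) (r f) := by
    simp [theta, hr, derivative_map]
  refine ⟨by simp [hh.zero], fun k m hm => ?_, fun k => ?_⟩
  · have := hh.deg k m hm
    simp [this]
  · have := congrArg r (hh.step k)
    rwa [radd, rsmul, rsmul, rθ, rQ, rR] at this

end Functoriality

/-! ### Smooth functions on a planar domain and uniqueness for the scalar equation -/

section SmoothAlgebra

/-- The algebra of the smooth complex-valued functions on a set of the plane. -/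
def smoothSubalgebra (Ω : Set (ℝ × ℝ)) : Subalgebra ℝ (Ω → ℂ) where
  carrier := {f | ∃ F : ℝ × ℝ → ℂ, ContDiffOn ℝ ∞ F Ω ∧ ∀ p : Ω, f p = F p}
  mul_mem' := by
    rintro f g ⟨F, hF, hf⟩ ⟨G, hG, hg⟩
    exact ⟨fun p => F p * G p, hF.mul hG, fun p => by simp [hf, hg]⟩
  add_mem' := by
    rintro f g ⟨F, hF, hf⟩ ⟨G, hG, hg⟩
    exact ⟨fun p => F p + G p, hF.add hG, fun p => by simp [hf, hg]⟩
  algebraMap_mem' r := ⟨fun _ => (r : ℂ), contDiffOn_const, fun p => rfl⟩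

/-- The smooth complex-valued functions on a set of the plane. -/
abbrev SmoothFn (Ω : Set (ℝ × ℝ)) : Type := smoothSubalgebra Ω

variable {Ω : Set (ℝ × ℝ)}

/-- The restriction to `Ω` of a function that is smooth on `Ω`. -/
def SmoothFn.of (F : ℝ × ℝ → ℂ) (hF : ContDiffOn ℝ ∞ F Ω) : SmoothFn Ω :=
  ⟨fun p => F p, F, hF, fun _ => rfl⟩

/-- A smooth function on `Ω`, extended somehow to the plane. -/
def SmoothFn.extend (f : SmoothFn Ω) : ℝ × ℝ → ℂ := f.2.choose

theorem SmoothFn.contDiffOn_extend (f : SmoothFn Ω) : ContDiffOn ℝ ∞ f.extend Ω :=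
  f.2.choose_spec.1

theorem SmoothFn.extend_apply (f : SmoothFn Ω) (p : Ω) : f.extend p = f.1 p :=
  (f.2.choose_spec.2 p).symm

theorem SmoothFn.ext_fun {f g : SmoothFn Ω} (h : ∀ p : Ω, f.1 p = g.1 p) : f = g :=
  Subtype.ext (funext h)

/-- As Ω is open, derivatives at its points do not see which extension was chosen. -/
theorem fderiv_extend_eq (hΩ : IsOpen Ω) (f : SmoothFn Ω) {F : ℝ × ℝ → ℂ}
    (hF : ∀ p : Ω, f.1 p = F p) (p : Ω) : fderiv ℝ f.extend p = fderiv ℝ F p := by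
  refine Filter.EventuallyEq.fderiv_eq ?_
  filter_upwards [hΩ.mem_nhds p.2] with q hq
  rw [f.extend_apply ⟨q, hq⟩, hF]

theorem SmoothFn.differentiableAt_extend (hΩ : IsOpen Ω) (f : SmoothFn Ω) (p : Ω) :
    DifferentiableAt ℝ f.extend p :=
  (f.contDiffOn_extend.contDiffAt (hΩ.mem_nhds p.2)).differentiableAt (by simp)

/-- The directional derivative, as a derivation of the algebra of smooth functions. -/
def partialD (hΩ : IsOpen Ω) (v : ℝ × ℝ) : Derivation ℝ (SmoothFn Ω) (SmoothFn Ω) :=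
  Derivation.mk'
    { toFun := fun f => SmoothFn.of (fun p => fderiv ℝ f.extend p v)
        ((f.contDiffOn_extend.fderiv_of_isOpen hΩ (m := ∞) (by simp)).clm_apply contDiffOn_const)
      map_add' := fun f g => SmoothFn.ext_fun fun p => by
        have := fderiv_extend_eq hΩ (f + g) (F := fun q => f.extend q + g.extend q)
          (fun q => by simp [SmoothFn.extend_apply]) p
        simp only [SmoothFn.of, this]
        rw [fderiv_fun_add (f.differentiableAt_extend hΩ p) (g.differentiableAt_extend hΩ p)]
        rfl
      map_smul' := fun c f => SmoothFn.ext_fun fun p => by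
        have := fderiv_extend_eq hΩ (c • f) (F := fun q => c • f.extend q)
          (fun q => by simp [SmoothFn.extend_apply]) p
        simp only [SmoothFn.of, this]
        rw [fderiv_fun_const_smul (f.differentiableAt_extend hΩ p)]
        rfl }
    fun f g => SmoothFn.ext_fun fun p => by
      have := fderiv_extend_eq hΩ (f * g) (F := fun q => f.extend q * g.extend q)
        (fun q => by simp [SmoothFn.extend_apply]) p
      simp only [SmoothFn.of, LinearMap.coe_mk, AddHom.coe_mk, this]
      rw [fderiv_fun_mul (f.differentiableAt_extend hΩ p) (g.differentiableAt_extend hΩ p)]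
      simp [SmoothFn.extend_apply]

theorem partialD_apply (hΩ : IsOpen Ω) (v : ℝ × ℝ) (f : SmoothFn Ω) {F : ℝ × ℝ → ℂ}
    (hF : ∀ p : Ω, f.1 p = F p) (p : Ω) : (partialD hΩ v f).1 p = fderiv ℝ F p v := by
  rw [← fderiv_extend_eq hΩ f hF]
  rfl

theorem partialD_comm (hΩ : IsOpen Ω) (v w : ℝ × ℝ) (f : SmoothFn Ω) :
    partialD hΩ v (partialD hΩ w f) = partialD hΩ w (partialD hΩ v f) := by
  have key (v w : ℝ × ℝ) (p : Ω) : (partialD hΩ v (partialD hΩ w f)).1 p =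
      fderiv ℝ (fderiv ℝ f.extend) p v w := by
    rw [partialD_apply hΩ v _ (F := fun q => fderiv ℝ f.extend q w) (fun q => rfl)]
    have hd : DifferentiableAt ℝ (fderiv ℝ f.extend) p :=
      ((f.contDiffOn_extend.fderiv_of_isOpen hΩ (m := ∞) (by simp)).contDiffAt
        (hΩ.mem_nhds p.2)).differentiableAt (by simp)
    rw [fderiv_clm_apply hd (by fun_prop)]
    simp
  refine SmoothFn.ext_fun fun p => ?_
  rw [key, key]
  exact ((f.contDiffOn_extend.contDiffAt (hΩ.mem_nhds p.2)).isSymmSndFDerivAt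
    (by simp only [minSmoothness_of_isRCLikeNormedField]; exact WithTop.coe_le_coe.2 (le_top : (2 : ℕ∞) ≤ ⊤))).eq v w

theorem SmoothFn.continuousOn_extend (f : SmoothFn Ω) : ContinuousOn f.extend Ω :=
  f.contDiffOn_extend.continuousOn

/-- The function `x - y`. -/
def diffFn (Ω : Set (ℝ × ℝ)) : SmoothFn Ω :=
  SmoothFn.of (fun p => ((p.1 - p.2 : ℝ) : ℂ))
    (Complex.ofRealCLM.contDiff.comp (contDiff_fst.sub contDiff_snd)).contDiffOn

theorem partialD_diffFn (hΩ : IsOpen Ω) : partialD hΩ (1, 0) (diffFn Ω) = 1 := by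
  refine SmoothFn.ext_fun fun p => ?_
  rw [partialD_apply hΩ _ _ (F := fun p => ((p.1 - p.2 : ℝ) : ℂ)) (fun q => rfl)]
  have h : HasFDerivAt (fun p : ℝ × ℝ => ((p.1 - p.2 : ℝ) : ℂ))
      (Complex.ofRealCLM ∘L (ContinuousLinearMap.fst ℝ ℝ ℝ - ContinuousLinearMap.snd ℝ ℝ ℝ)) p :=
    (Complex.ofRealCLM ∘L
      (ContinuousLinearMap.fst ℝ ℝ ℝ - ContinuousLinearMap.snd ℝ ℝ ℝ)).hasFDerivAt
  rw [h.fderiv]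
  simp

/-- Continuity along a horizontal line through the diagonal point. This covers the diagonal, where
one cannot divide by x - y and the independence of the kernels is not established. -/
theorem eq_zero_of_eq_zero_off_diagonal (hΩ : IsOpen Ω) {f : SmoothFn Ω}
    (h : ∀ p : Ω, p.1.1 ≠ p.1.2 → f.1 p = 0) : f = 0 := by
  refine SmoothFn.ext_fun fun p => ?_
  by_cases hp : p.1.1 = p.1.2
  · obtain ⟨⟨x, y⟩, hxy⟩ := p
    obtain rfl : x = y := hp
    have hc : ContinuousAt (fun s : ℝ => f.extend (s, x)) x :=
      ContinuousAt.comp (f := fun s : ℝ => (s, x)) (g := f.extend)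
        (f.continuousOn_extend.continuousAt (hΩ.mem_nhds hxy)) (by fun_prop)
    have hz : ∀ᶠ s in nhdsWithin x {x}ᶜ, f.extend (s, x) = 0 := by
      have hnear : ∀ᶠ s in nhds x, (s, x) ∈ Ω :=
        (show ContinuousAt (fun s : ℝ => (s, x)) x by fun_prop).eventually (hΩ.mem_nhds hxy)
      filter_upwards [nhdsWithin_le_nhds hnear, self_mem_nhdsWithin] with s hs hsx
      rw [f.extend_apply ⟨_, hs⟩]
      exact h ⟨_, hs⟩ hsx
    have h1 : Filter.Tendsto (fun s : ℝ => f.extend (s, x)) (nhdsWithin x {x}ᶜ)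
        (nhds (f.extend (x, x))) := hc.tendsto.mono_left nhdsWithin_le_nhds
    have h2 : Filter.Tendsto (fun s : ℝ => f.extend (s, x)) (nhdsWithin x {x}ᶜ) (nhds 0) :=
      tendsto_const_nhds.congr' (hz.mono fun s hs => hs.symm)
    have := tendsto_nhds_unique h1 h2
    rw [f.extend_apply ⟨_, hxy⟩] at this
    exact this
  · exact h p hp

/-- The horizontal segments from points of `Ω` to the diagonal lie in `Ω`. -/
def HorizontallyStarShaped (Ω : Set (ℝ × ℝ)) : Prop :=
  ∀ p ∈ Ω, ∀ s ∈ Set.uIcc p.1 p.2, (s, p.2) ∈ Ω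

theorem hasDerivAt_slice (hΩ : IsOpen Ω) (f : SmoothFn Ω) {x y : ℝ} (h : (x, y) ∈ Ω) :
    HasDerivAt (fun s => f.extend (s, y)) ((partialD hΩ (1, 0) f).1 ⟨_, h⟩) x := by
  have h1 : HasDerivAt (fun s : ℝ => (s, y)) ((1 : ℝ), (0 : ℝ)) x :=
    (hasDerivAt_id x).prodMk (hasDerivAt_const x y)
  exact (f.differentiableAt_extend hΩ ⟨_, h⟩).hasFDerivAt.comp_hasDerivAt x h1

theorem eq_diagonal_of_partialD_eq_zero (hΩ : IsOpen Ω) (hs : HorizontallyStarShaped Ω)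
    {f : SmoothFn Ω} (hf : partialD hΩ (1, 0) f = 0) {x y : ℝ} (h : (x, y) ∈ Ω) :
    f.1 ⟨_, h⟩ = f.1 ⟨(y, y), hs _ h _ Set.right_mem_uIcc⟩ := by
  have := (convex_uIcc x y).norm_image_sub_le_of_norm_hasDerivWithin_le
    (f := fun s => f.extend (s, y)) (f' := fun _ => 0) (C := 0) (fun s hs' => by
      have := hasDerivAt_slice hΩ f (hs _ h s hs')
      rw [hf] at this
      exact this.hasDerivWithinAt) (by simp) Set.right_mem_uIcc Set.left_mem_uIcc
  rw [zero_mul, norm_le_zero_iff, sub_eq_zero] at this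
  rw [← f.extend_apply, ← f.extend_apply]
  exact this

/-- The restriction of a smooth function to the diagonal. -/
def diagHom (Ω : Set (ℝ × ℝ)) : SmoothFn Ω →ₐ[ℝ] ({p : Ω // p.1.1 = p.1.2} → ℂ) where
  toFun f p := f.1 p.1
  map_one' := rfl
  map_mul' _ _ := rfl
  map_zero' := rfl
  map_add' _ _ := rfl
  commutes' _ := rfl

theorem eq_zero_of_diffFn_mul_eq_zero (hΩ : IsOpen Ω) {f : SmoothFn Ω} (k : ℕ)
    (h : diffFn Ω ^ k * f = 0) : f = 0 := by
  refine eq_zero_of_eq_zero_off_diagonal hΩ fun p hp => ?_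
  have h1 : ((p.1.1 - p.1.2 : ℝ) : ℂ) ^ k * f.1 p = 0 := congrFun (congrArg Subtype.val h) p
  refine (mul_eq_zero.1 h1).resolve_left (pow_ne_zero _ ?_)
  exact_mod_cast sub_ne_zero.2 hp

theorem eq_zero_of_diffFn_mul_partialD_eq_zero (hΩ : IsOpen Ω) (hs : HorizontallyStarShaped Ω)
    (f : SmoothFn Ω) (hf : diffFn Ω * partialD hΩ (1, 0) f = 0) (hd : diagHom Ω f = 0) :
    f = 0 := by
  have h0 := eq_zero_of_diffFn_mul_eq_zero hΩ 1 (by rwa [pow_one])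
  refine SmoothFn.ext_fun fun p => ?_
  obtain ⟨⟨x, y⟩, h⟩ := p
  rw [eq_diagonal_of_partialD_eq_zero hΩ hs h0 h]
  exact congrFun hd ⟨⟨(y, y), _⟩, rfl⟩

/-- Integrating factor: ∂(δ^(k+1) f) = δ^k ((k+1) f + δ ∂f). Hence δ^(k+1) f is constant on
horizontal segments, and it vanishes at their diagonal ends. -/
theorem eq_zero_of_smul_add_eq_zero (hΩ : IsOpen Ω) (hs : HorizontallyStarShaped Ω) (k : ℕ)
    (f : SmoothFn Ω) (hf : ((k : ℝ) + 1) • f + diffFn Ω * partialD hΩ (1, 0) f = 0) :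
    f = 0 := by
  refine eq_zero_of_diffFn_mul_eq_zero hΩ (k + 1) ?_
  have h0 : partialD hΩ (1, 0) (diffFn Ω ^ (k + 1) * f) = 0 := by
    have hc : ((k : ℝ) + 1) • f = ((k : SmoothFn Ω) + 1) * f := by
      rw [Algebra.smul_def]; simp
    rw [hc] at hf
    rw [Derivation.leibniz, Derivation.leibniz_pow, partialD_diffFn]
    simp only [smul_eq_mul, nsmul_eq_mul, mul_one, add_tsub_cancel_right]
    push_cast
    linear_combination diffFn Ω ^ k * hf
  refine SmoothFn.ext_fun fun p => ?_
  obtain ⟨⟨x, y⟩, h⟩ := p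
  rw [eq_diagonal_of_partialD_eq_zero hΩ hs h0 h]
  have : ((y - y : ℝ) : ℂ) ^ (k + 1) * f.1 ⟨(y, y), hs _ h _ Set.right_mem_uIcc⟩ = 0 := by simp
  exact this

end SmoothAlgebra

/-! ### Solving the scalar transport equation by an integral -/

section ParametricIntegral

variable {Ω : Set (ℝ × ℝ)}

/-- The point `(y + r (x - y), y)`, as a linear function of `(x, y)`. -/
def toDiag (r : ℝ) : ℝ × ℝ →L[ℝ] ℝ × ℝ :=
  (ContinuousLinearMap.snd ℝ ℝ ℝ).prod (ContinuousLinearMap.snd ℝ ℝ ℝ) +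
    r • (ContinuousLinearMap.fst ℝ ℝ ℝ - ContinuousLinearMap.snd ℝ ℝ ℝ).prod 0

theorem toDiag_apply (r : ℝ) (p : ℝ × ℝ) : toDiag r p = (p.2 + r * (p.1 - p.2), p.2) := by
  simp [toDiag]

theorem toDiag_mem (hs : HorizontallyStarShaped Ω) {r : ℝ} (hr : r ∈ Set.Icc (0 : ℝ) 1)
    {p : ℝ × ℝ} (hp : p ∈ Ω) : toDiag r p ∈ Ω := by
  rw [toDiag_apply]
  refine hs p hp _ ?_
  rw [Set.mem_uIcc]
  rcases le_total p.1 p.2 with h | h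
  · left; constructor <;> nlinarith [hr.1, hr.2]
  · right; constructor <;> nlinarith [hr.1, hr.2]

theorem continuous_toDiag : Continuous fun q : ℝ × (ℝ × ℝ) => toDiag q.1 q.2 := by
  simp only [toDiag_apply]
  fun_prop

variable {G : Type*} [NormedAddCommGroup G] [NormedSpace ℝ G]

theorem continuousOn_toDiag (hs : HorizontallyStarShaped Ω) {G : Type*} [TopologicalSpace G]
    {f : ℝ × ℝ → G} (hf : ContinuousOn f Ω) {p : ℝ × ℝ} (hp : p ∈ Ω) :
    ContinuousOn (fun r : ℝ => f (toDiag r p)) (Set.uIcc 0 1) := by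
  rw [Set.uIcc_of_le zero_le_one]
  exact hf.comp (continuous_toDiag.comp (by fun_prop : Continuous fun r : ℝ => (r, p))).continuousOn
    fun r hr => toDiag_mem hs hr hp

theorem hasFDerivAt_integral_toDiag (hΩ : IsOpen Ω) (hs : HorizontallyStarShaped Ω)
    {f : ℝ × ℝ → G} (hf : ContDiffOn ℝ ∞ f Ω) {w : ℝ → ℝ} (hw : Continuous w) {p : ℝ × ℝ}
    (hp : p ∈ Ω) :
    HasFDerivAt (fun p => ∫ r in (0 : ℝ)..1, w r • f (toDiag r p))
      (∫ r in (0 : ℝ)..1, w r • (fderiv ℝ f (toDiag r p) ∘L toDiag r)) p := by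
  have hf' : ContinuousOn (fderiv ℝ f) Ω := hf.continuousOn_fderiv_of_isOpen hΩ (by simp)
  -- On a closed ball inside Ω the differentiated integrand is jointly continuous for r in [0, 1],
  -- so compactness supplies a constant dominating function.
  obtain ⟨ε, hε, hball⟩ := Metric.nhds_basis_closedBall.mem_iff.1 (hΩ.mem_nhds hp)
  have htd : Continuous toDiag := by unfold toDiag; fun_prop
  have hcont {q : ℝ × ℝ} (hq : q ∈ Ω) : ContinuousOn
      (fun r => w r • (fderiv ℝ f (toDiag r q) ∘L toDiag r)) (Set.uIcc 0 1) :=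
    hw.continuousOn.smul ((continuousOn_toDiag hs hf' hq).clm_comp htd.continuousOn)
  have hcont0 {q : ℝ × ℝ} (hq : q ∈ Ω) : ContinuousOn
      (fun r => w r • f (toDiag r q)) (Set.uIcc 0 1) :=
    hw.continuousOn.smul (continuousOn_toDiag hs hf.continuousOn hq)
  have hcomp : ContinuousOn (fun q : ℝ × (ℝ × ℝ) =>
      w q.1 • (fderiv ℝ f (toDiag q.1 q.2) ∘L toDiag q.1))
      (Set.Icc 0 1 ×ˢ Metric.closedBall p ε) := by
    refine (hw.comp continuous_fst).continuousOn.smul (ContinuousOn.clm_comp ?_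
      (htd.comp continuous_fst).continuousOn)
    exact hf'.comp continuous_toDiag.continuousOn fun q hq => toDiag_mem hs hq.1 (hball hq.2)
  obtain ⟨C, hC⟩ := (isCompact_Icc.prod (isCompact_closedBall p ε)).exists_bound_of_continuousOn
    hcomp
  refine (intervalIntegral.hasFDerivAt_integral_of_dominated_of_fderiv_le
    (F := fun q r => w r • f (toDiag r q))
    (F' := fun q r => w r • (fderiv ℝ f (toDiag r q) ∘L toDiag r)) (bound := fun _ => C)
    (Metric.ball_mem_nhds p hε) ?_ ?_ ?_ ?_ ?_ ?_)
  · filter_upwards [hΩ.mem_nhds hp] with q hq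
    exact ((hcont0 hq).mono Set.uIoc_subset_uIcc).aestronglyMeasurable measurableSet_uIoc
  · exact (hcont0 hp).intervalIntegrable
  · exact ((hcont hp).mono Set.uIoc_subset_uIcc).aestronglyMeasurable measurableSet_uIoc
  · refine Filter.Eventually.of_forall fun r hr q hq => hC (r, q) ⟨?_, Metric.ball_subset_closedBall hq⟩
    rw [Set.uIoc_of_le zero_le_one] at hr
    exact ⟨hr.1.le, hr.2⟩
  · exact intervalIntegrable_const
  · refine Filter.Eventually.of_forall fun r hr q hq => ?_
    rw [Set.uIoc_of_le zero_le_one] at hr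
    have hmem := toDiag_mem hs ⟨hr.1.le, hr.2⟩ (hball (Metric.ball_subset_closedBall hq))
    have h1 : HasFDerivAt f (fderiv ℝ f (toDiag r q)) (toDiag r q) :=
      ((hf.contDiffAt (hΩ.mem_nhds hmem)).differentiableAt (by simp)).hasFDerivAt
    exact (h1.comp q (toDiag r).hasFDerivAt).const_smul (w r)

/-- Since `toDiag r` is affine in r, the derivative is built from integrals of the same kind, for
the function `fderiv ℝ f` and the weights w(r) and r w(r). The induction therefore runs over all
target spaces and weights at once. -/
theorem contDiffOn_integral_toDiag (hΩ : IsOpen Ω) (hs : HorizontallyStarShaped Ω) (n : ℕ) :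
    ∀ {G : Type} [NormedAddCommGroup G] [NormedSpace ℝ G] [CompleteSpace G]
    {f : ℝ × ℝ → G} (_ : ContDiffOn ℝ ∞ f Ω) {w : ℝ → ℝ} (_ : Continuous w),
    ContDiffOn ℝ n (fun p => ∫ r in (0 : ℝ)..1, w r • f (toDiag r p)) Ω := by
  induction n with
  | zero =>
    intro G _ _ _ f hf w hw
    rw [Nat.cast_zero, contDiffOn_zero]
    exact fun p hp => (hasFDerivAt_integral_toDiag hΩ hs hf hw hp).continuousAt.continuousWithinAt
  | succ n ih =>
    intro G _ _ _ f hf w hw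
    rw [Nat.cast_succ, contDiffOn_succ_iff_fderiv_of_isOpen hΩ]
    refine ⟨fun p hp => (hasFDerivAt_integral_toDiag hΩ hs hf hw
      hp).differentiableAt.differentiableWithinAt, by simp, ?_⟩
    have hf' : ContDiffOn ℝ ∞ (fderiv ℝ f) Ω := hf.fderiv_of_isOpen hΩ (by simp)
    set L₀ : ℝ × ℝ →L[ℝ] ℝ × ℝ :=
      (ContinuousLinearMap.snd ℝ ℝ ℝ).prod (ContinuousLinearMap.snd ℝ ℝ ℝ)
    set L₁ : ℝ × ℝ →L[ℝ] ℝ × ℝ :=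
      (ContinuousLinearMap.fst ℝ ℝ ℝ - ContinuousLinearMap.snd ℝ ℝ ℝ).prod 0
    have h1 : ContDiffOn ℝ n (fun p =>
        (∫ r in (0 : ℝ)..1, w r • fderiv ℝ f (toDiag r p)) ∘L L₀ +
        (∫ r in (0 : ℝ)..1, (w r * r) • fderiv ℝ f (toDiag r p)) ∘L L₁) Ω :=
      ((ih hf' hw).clm_comp contDiffOn_const).add
        ((ih hf' (hw.mul continuous_id)).clm_comp contDiffOn_const)
    refine h1.congr fun p hp => ?_
    have hi {w : ℝ → ℝ} (hw : Continuous w) : IntervalIntegrable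
        (fun r => w r • fderiv ℝ f (toDiag r p)) MeasureTheory.volume 0 1 :=
      (hw.continuousOn.smul (continuousOn_toDiag hs hf'.continuousOn hp)).intervalIntegrable
    rw [(hasFDerivAt_integral_toDiag hΩ hs hf hw hp).fderiv]
    have hc (L : ℝ × ℝ →L[ℝ] ℝ × ℝ) {w : ℝ → ℝ} (hw : Continuous w) :
        (∫ r in (0 : ℝ)..1, w r • fderiv ℝ f (toDiag r p)) ∘L L =
          ∫ r in (0 : ℝ)..1, (w r • fderiv ℝ f (toDiag r p)) ∘L L :=
      (((ContinuousLinearMap.compL ℝ (ℝ × ℝ) (ℝ × ℝ) G).flip L).intervalIntegral_comp_comm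
        (hi hw)).symm
    have hic (L : ℝ × ℝ →L[ℝ] ℝ × ℝ) {w : ℝ → ℝ} (hw : Continuous w) : IntervalIntegrable
        (fun r => (w r • fderiv ℝ f (toDiag r p)) ∘L L) MeasureTheory.volume 0 1 :=
      ((hw.continuousOn.smul (continuousOn_toDiag hs hf'.continuousOn hp)).clm_comp
        continuousOn_const).intervalIntegrable
    have hwr : Continuous fun r => w r * r := hw.mul continuous_id
    rw [hc L₀ hw, hc L₁ hwr, ← intervalIntegral.integral_add (hic L₀ hw) (hic L₁ hwr)]
    congr 1
    funext r
    refine ContinuousLinearMap.ext fun v => ?_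
    have e : toDiag r v = L₀ v + r • L₁ v := rfl
    simp [e, mul_smul]

/-- The solution is a(x, y) = ∫_0^1 r^k b(y + r(x - y), y) dr. The equation is the fundamental
theorem of calculus for r^(k+1) b(y + r(x - y), y) on [0, 1]. -/
theorem exists_smul_add_eq (hΩ : IsOpen Ω) (hs : HorizontallyStarShaped Ω) (k : ℕ)
    (b : SmoothFn Ω) : ∃ a, ((k : ℝ) + 1) • a + diffFn Ω * partialD hΩ (1, 0) a = b := by
  have hf := b.contDiffOn_extend
  have hw : Continuous fun r : ℝ => r ^ k := by fun_prop
  refine ⟨SmoothFn.of (fun p => ∫ r in (0 : ℝ)..1, r ^ k • b.extend (toDiag r p))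
    (contDiffOn_infty.2 fun n => contDiffOn_integral_toDiag hΩ hs n hf hw), ?_⟩
  refine SmoothFn.ext_fun fun p => ?_
  obtain ⟨⟨x, y⟩, hp⟩ := p
  have h1 := partialD_apply hΩ (1, 0) (SmoothFn.of
    (fun p => ∫ r in (0 : ℝ)..1, r ^ k • b.extend (toDiag r p))
    (contDiffOn_infty.2 fun n => contDiffOn_integral_toDiag hΩ hs n hf hw))
    (F := fun p => ∫ r in (0 : ℝ)..1, r ^ k • b.extend (toDiag r p)) (fun _ => rfl) ⟨(x, y), hp⟩
  rw [(hasFDerivAt_integral_toDiag hΩ hs hf hw hp).fderiv] at h1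
  have hf' : ContinuousOn (fderiv ℝ b.extend) Ω := hf.continuousOn_fderiv_of_isOpen hΩ (by simp)
  have htd : Continuous toDiag := by unfold toDiag; fun_prop
  have hi : IntervalIntegrable (fun r => r ^ k • (fderiv ℝ b.extend (toDiag r (x, y)) ∘L toDiag r))
      MeasureTheory.volume 0 1 :=
    (hw.continuousOn.smul ((continuousOn_toDiag hs hf' hp).clm_comp
      htd.continuousOn)).intervalIntegrable
  rw [ContinuousLinearMap.intervalIntegral_apply hi] at h1
  have hderiv (r : ℝ) (hr : r ∈ Set.uIcc (0 : ℝ) 1) :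
      HasDerivAt (fun r : ℝ => r ^ (k + 1) • b.extend (toDiag r (x, y)))
        (((k : ℝ) + 1) • (r ^ k • b.extend (toDiag r (x, y))) + (x - y) •
          ((r ^ k • (fderiv ℝ b.extend (toDiag r (x, y)) ∘L toDiag r)) (1, 0))) r := by
    rw [Set.uIcc_of_le zero_le_one] at hr
    have hmem := toDiag_mem hs hr hp
    have e1 : HasDerivAt (fun r : ℝ => toDiag r (x, y)) (x - y, (0 : ℝ)) r := by
      simp only [toDiag_apply]
      refine HasDerivAt.prodMk ?_ (hasDerivAt_const r y)
      simpa using ((hasDerivAt_id r).mul_const (x - y)).const_add y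
    have e2 := (b.differentiableAt_extend hΩ ⟨_, hmem⟩).hasFDerivAt.comp_hasDerivAt r e1
    have e3 := (hasDerivAt_pow (k + 1) r).smul e2
    refine HasDerivAt.congr_deriv (f := fun r : ℝ => r ^ (k + 1) • b.extend (toDiag r (x, y))) e3 ?_
    have e4 : toDiag r (1, 0) = r • ((1 : ℝ), (0 : ℝ)) := by simp [toDiag_apply]
    have e5 : ((x - y, (0 : ℝ)) : ℝ × ℝ) = (x - y) • ((1 : ℝ), (0 : ℝ)) := by simp
    rw [e5]
    simp only [_root_.smul_apply, ContinuousLinearMap.comp_apply, e4, map_smul,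
      Nat.cast_add, Nat.cast_one, add_tsub_cancel_right, Function.comp_apply]
    module
  have hi1 : IntervalIntegrable (fun r => r ^ k • b.extend (toDiag r (x, y)))
      MeasureTheory.volume 0 1 :=
    (hw.continuousOn.smul (continuousOn_toDiag hs hf.continuousOn hp)).intervalIntegrable
  have hi2 : IntervalIntegrable (fun r => (r ^ k • (fderiv ℝ b.extend (toDiag r (x, y)) ∘L
      toDiag r)) (1, 0)) MeasureTheory.volume 0 1 :=
    ((hw.continuousOn.smul ((continuousOn_toDiag hs hf' hp).clm_comp
      htd.continuousOn)).clm_apply continuousOn_const).intervalIntegrable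
  have hi1' : IntervalIntegrable (fun r => ((k : ℝ) + 1) • (r ^ k • b.extend (toDiag r (x, y))))
      MeasureTheory.volume 0 1 := hi1.smul ((k : ℝ) + 1)
  have hi2' : IntervalIntegrable (fun r => (x - y) • ((r ^ k • (fderiv ℝ b.extend
      (toDiag r (x, y)) ∘L toDiag r)) (1, 0))) MeasureTheory.volume 0 1 := hi2.smul (x - y)
  have hftc := intervalIntegral.integral_eq_sub_of_hasDerivAt hderiv (hi1'.add hi2')
  rw [intervalIntegral.integral_add hi1' hi2', intervalIntegral.integral_smul,
    intervalIntegral.integral_smul] at hftc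
  rw [← h1] at hftc
  have hend : toDiag 1 (x, y) = (x, y) := by simp [toDiag_apply]
  rw [hend, b.extend_apply ⟨_, hp⟩] at hftc
  simp only [one_pow, one_smul, ne_eq, Nat.add_eq_zero_iff, one_ne_zero, and_false,
    not_false_eq_true, zero_pow, zero_smul, sub_zero] at hftc
  rw [← hftc]
  simp [SmoothFn.of, diffFn]

end ParametricIntegral

/-! ### The Airy-type integral: decay, derivatives, recurrence, nonvanishing -/

section AiryIntegral

open MeasureTheory

/-- The point `c + i s` of the line of integration. -/
def airyPt (N : ℕ) (κ : ℝ) (s : ℝ) : ℂ := (airyAbscissa N κ : ℂ) + (s : ℂ) * Complex.I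

variable {N : ℕ} {κ : ℝ}

/-- For even N the exponent is -s^N on the imaginary axis. For odd N the top term κ (i s)^N is
purely imaginary, and the choice of c turns the next term N κ c (i s)^(N-1) into -N s^(N-1), which
dominates the rest. -/
theorem exists_re_airyPt_pow_le (hN : 2 ≤ N) (hκ : IsHeatSign N κ) :
    ∃ B : ℝ, ∀ s : ℝ, ((κ : ℂ) * airyPt N κ s ^ N).re ≤ B - s ^ 2 := by
  rcases Nat.even_or_odd N with hev | hodd
  · obtain ⟨m, rfl⟩ := even_iff_exists_two_mul.1 hev
    refine ⟨1, fun s => ?_⟩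
    have h1 : airyPt (2 * m) κ s = s * Complex.I := by simp [airyPt, airyAbscissa, hev]
    have h2 : κ = (-1) ^ (m + 1) := by simpa using hκ.1 hev
    have h3 : (κ : ℂ) * (s * Complex.I) ^ (2 * m) = ((-(s ^ 2) ^ m : ℝ) : ℂ) := by
      rw [mul_pow, pow_mul Complex.I, Complex.I_sq, h2, pow_mul (s : ℂ)]
      push_cast
      have : (-1 : ℂ) ^ m * (-1) ^ m = 1 := by rw [← mul_pow]; simp
      linear_combination (-((s : ℂ) ^ 2) ^ m) * this
    rw [h1, h3, Complex.ofReal_re]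
    rcases le_total 1 (s ^ 2) with h | h
    · have := le_self_pow₀ h (show m ≠ 0 by omega)
      linarith
    · have : 0 ≤ (s ^ 2) ^ m := by positivity
      linarith
  · obtain ⟨m, rfl⟩ := hodd
    have hm : 1 ≤ m := by omega
    have hodd : Odd (2 * m + 1) := ⟨m, rfl⟩
    set c : ℝ := airyAbscissa (2 * m + 1) κ with hc
    have hκ2 : κ * κ = 1 := by rcases hκ.2 hodd with h | h <;> simp [h]
    have hcdef : c = κ * (-1) ^ (m + 1) := by
      rw [hc, airyAbscissa, if_neg (Nat.not_even_iff_odd.2 hodd),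
        show (2 * m + 1 + 1) / 2 = m + 1 by omega]
    have hc1 : |c| = 1 := by
      rw [hcdef, abs_mul, abs_pow, abs_neg, abs_one, one_pow, mul_one]
      rcases hκ.2 hodd with h | h <;> simp [h]
    have hκ1 : |κ| = 1 := by rcases hκ.2 hodd with h | h <;> simp [h]
    -- The threshold 2^N bounds the sum of the binomial coefficients, so the lower terms are at most
    -- |s|^(N-1) beyond it.
    have hlarge (s : ℝ) (hs : (2 : ℝ) ^ (2 * m + 1) ≤ |s|) :
        ((κ : ℂ) * airyPt (2 * m + 1) κ s ^ (2 * m + 1)).re ≤ -s ^ 2 := by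
      have hs1 : 1 ≤ |s| := le_trans (one_le_pow₀ (by norm_num)) hs
      have hexp : (κ : ℂ) * airyPt (2 * m + 1) κ s ^ (2 * m + 1) =
          (κ : ℂ) * (∑ l ∈ Finset.range (2 * m), ((s : ℂ) * Complex.I) ^ l *
            (c : ℂ) ^ (2 * m + 1 - l) * ((2 * m + 1).choose l : ℂ)) +
          ((-(2 * m + 1) * s ^ (2 * m) : ℝ) : ℂ) +
          ((κ * (-1) ^ m * s ^ (2 * m + 1) : ℝ) : ℂ) * Complex.I := by
        rw [airyPt, ← hc, add_comm, add_pow, Finset.sum_range_succ, Finset.sum_range_succ,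
          mul_add, mul_add]
        congr 1
        · congr 1
          rw [mul_pow, pow_mul Complex.I, Complex.I_sq, show 2 * m + 1 - 2 * m = 1 by omega,
            pow_one, Nat.choose_succ_self_right, hcdef]
          push_cast
          have e1 : (-1 : ℂ) ^ m * (-1) ^ m = 1 := by rw [← mul_pow]; simp
          have e2 : (κ : ℂ) * κ = 1 := by exact_mod_cast hκ2
          rw [pow_succ (-1 : ℂ) m]
          linear_combination (-(2 * m + 1) * (s : ℂ) ^ (2 * m)) * e1 +
            (-(2 * m + 1) * (s : ℂ) ^ (2 * m)) * ((-1) ^ m * (-1) ^ m) * e2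
        · rw [mul_pow, pow_succ Complex.I, pow_mul Complex.I, Complex.I_sq]
          push_cast
          simp
          ring
      have hsum : ‖(κ : ℂ) * (∑ l ∈ Finset.range (2 * m), ((s : ℂ) * Complex.I) ^ l *
          (c : ℂ) ^ (2 * m + 1 - l) * ((2 * m + 1).choose l : ℂ))‖ ≤ |s| ^ (2 * m) := by
        rw [norm_mul, Complex.norm_real, Real.norm_eq_abs, hκ1, one_mul]
        have e : |s| ^ (2 * m) = |s| * |s| ^ (2 * m - 1) := by
          rw [← pow_succ']; congr 1; omega
        calc _ ≤ ∑ l ∈ Finset.range (2 * m), |s| ^ (2 * m - 1) * ((2 * m + 1).choose l : ℝ) := by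
              refine norm_sum_le_of_le _ fun l hl => ?_
              have hl' := Finset.mem_range.1 hl
              rw [norm_mul, norm_mul, norm_pow, norm_mul, norm_pow, Complex.norm_real,
                Complex.norm_real, Complex.norm_I, Real.norm_eq_abs, Real.norm_eq_abs, hc1,
                one_pow, mul_one, mul_one, Complex.norm_natCast]
              gcongr
              omega
          _ ≤ |s| ^ (2 * m - 1) * 2 ^ (2 * m + 1) := by
              rw [← Finset.mul_sum]
              gcongr
              have := Nat.sum_range_choose (2 * m + 1)
              have h2 : ∑ l ∈ Finset.range (2 * m), (2 * m + 1).choose l ≤ 2 ^ (2 * m + 1) := by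
                rw [← this]
                exact Finset.sum_le_sum_of_subset (Finset.range_subset_range.2 (by omega))
              exact_mod_cast h2
          _ ≤ |s| ^ (2 * m) := by
              rw [e, mul_comm]
              gcongr
      have hre := (Complex.re_le_norm _).trans hsum
      have him : (((κ * (-1) ^ m * s ^ (2 * m + 1) : ℝ) : ℂ) * Complex.I).re = 0 := by
        rw [Complex.re_ofReal_mul, Complex.I_re, mul_zero]
      rw [hexp, Complex.add_re, Complex.add_re, Complex.ofReal_re, him, add_zero]
      have h2 : |s| ^ (2 * m) = s ^ (2 * m) := by rw [pow_mul, sq_abs, ← pow_mul]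
      have h3 : s ^ 2 ≤ s ^ (2 * m) := by
        rw [pow_mul]
        refine le_self_pow₀ ?_ (by omega)
        rw [← sq_abs]
        exact one_le_pow₀ hs1
      have hm' : (1 : ℝ) ≤ m := by exact_mod_cast hm
      have h4 : 0 ≤ s ^ 2 := sq_nonneg s
      nlinarith
    have hcont : Continuous fun s : ℝ =>
        ((κ : ℂ) * airyPt (2 * m + 1) κ s ^ (2 * m + 1)).re + s ^ 2 := by
      unfold airyPt
      fun_prop
    obtain ⟨B, hB⟩ := (isCompact_Icc (a := -(2 : ℝ) ^ (2 * m + 1))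
      (b := 2 ^ (2 * m + 1))).exists_bound_of_continuousOn hcont.continuousOn
    refine ⟨max B 0, fun s => ?_⟩
    rcases le_total ((2 : ℝ) ^ (2 * m + 1)) |s| with h | h
    · have := hlarge s h
      have := le_max_right B 0
      linarith
    · have h1 := hB s (abs_le.1 h)
      rw [Real.norm_eq_abs] at h1
      have h2 := (abs_le.1 h1).2
      have := le_max_left B 0
      linarith

/-- The integrand of the `m`-th derivative of the Airy-type function. -/
def airyIntegrand (N : ℕ) (κ : ℝ) (m : ℕ) (z : ℂ) (s : ℝ) : ℂ :=
  airyPt N κ s ^ m * Complex.exp (z * airyPt N κ s + (κ : ℂ) * airyPt N κ s ^ N)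

/-- The `m`-th derivative of the Airy-type function, on the complex plane. -/
def airyMoment (N : ℕ) (κ : ℝ) (m : ℕ) (z : ℂ) : ℂ :=
  (1 / (2 * (Real.pi : ℂ))) * ∫ s : ℝ, airyIntegrand N κ m z s

theorem continuous_airyIntegrand (m : ℕ) (z : ℂ) : Continuous (airyIntegrand N κ m z) := by
  unfold airyIntegrand airyPt
  fun_prop

theorem exists_norm_airyIntegrand_le (hN : 2 ≤ N) (hκ : IsHeatSign N κ) (m : ℕ) (R : ℝ) :
    ∃ C : ℝ, ∀ (z : ℂ) (s : ℝ), ‖z‖ ≤ R →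
      ‖airyIntegrand N κ m z s‖ ≤ C * Real.exp (-(1 / 2) * s ^ 2) := by
  obtain ⟨B, hB⟩ := exists_re_airyPt_pow_le hN hκ
  set c := |airyAbscissa N κ|
  -- The power is absorbed by p^m ≤ m! e^p, and (|R|+1)|s| ≤ (|R|+1)²/2 + s²/2 spends half of the
  -- Gaussian decay.
  refine ⟨m.factorial * Real.exp (B + (|R| + 1) * c + (|R| + 1) ^ 2 / 2), fun z s hz => ?_⟩
  have hpt : ‖airyPt N κ s‖ ≤ c + |s| := by
    refine (norm_add_le _ _).trans ?_
    simp [c]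
  have h0 := norm_nonneg (airyPt N κ s)
  have hpow : ‖airyPt N κ s‖ ^ m ≤ m.factorial * Real.exp ‖airyPt N κ s‖ := by
    have := Real.pow_div_factorial_le_exp _ h0 m
    rw [div_le_iff₀ (by positivity)] at this
    linarith
  have hzre : (z * airyPt N κ s).re ≤ |R| * ‖airyPt N κ s‖ := by
    refine (Complex.re_le_norm _).trans ?_
    rw [norm_mul]
    gcongr
    exact hz.trans (le_abs_self R)
  rw [airyIntegrand, norm_mul, norm_pow, Complex.norm_exp, Complex.add_re]
  calc ‖airyPt N κ s‖ ^ m * Real.exp ((z * airyPt N κ s).re + (κ * airyPt N κ s ^ N).re)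
      ≤ (m.factorial * Real.exp ‖airyPt N κ s‖) *
          Real.exp (|R| * ‖airyPt N κ s‖ + (B - s ^ 2)) := by
        gcongr
        exact hB s
    _ = m.factorial * Real.exp ((|R| + 1) * ‖airyPt N κ s‖ + B - s ^ 2) := by
        rw [mul_assoc, ← Real.exp_add]; congr 2; ring
    _ ≤ m.factorial * Real.exp ((B + (|R| + 1) * c + (|R| + 1) ^ 2 / 2) + -(1 / 2) * s ^ 2) := by
        gcongr
        have h1 : (|R| + 1) * ‖airyPt N κ s‖ ≤ (|R| + 1) * (c + |s|) := by gcongr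
        nlinarith [sq_nonneg (|R| + 1 - |s|), sq_abs s]
    _ = _ := by rw [Real.exp_add]; ring

theorem integrable_airyIntegrand (hN : 2 ≤ N) (hκ : IsHeatSign N κ) (m : ℕ) (z : ℂ) :
    Integrable (airyIntegrand N κ m z) := by
  obtain ⟨C, hC⟩ := exists_norm_airyIntegrand_le hN hκ m ‖z‖
  refine ((integrable_exp_neg_mul_sq (by norm_num : (0 : ℝ) < 1 / 2)).const_mul C).mono'
    (continuous_airyIntegrand m z).aestronglyMeasurable ?_
  exact Filter.Eventually.of_forall fun s => hC z s le_rfl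

theorem hasDerivAt_airyMoment (hN : 2 ≤ N) (hκ : IsHeatSign N κ) (m : ℕ) (z : ℂ) :
    HasDerivAt (airyMoment N κ m) (airyMoment N κ (m + 1) z) z := by
  obtain ⟨C, hC⟩ := exists_norm_airyIntegrand_le hN hκ (m + 1) (‖z‖ + 1)
  have := (hasDerivAt_integral_of_dominated_loc_of_deriv_le (μ := volume)
    (F := airyIntegrand N κ m) (F' := airyIntegrand N κ (m + 1))
    (bound := fun s => C * Real.exp (-(1 / 2) * s ^ 2)) (Metric.ball_mem_nhds z one_pos)
    (Filter.Eventually.of_forall fun w => (continuous_airyIntegrand m w).aestronglyMeasurable)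
    (integrable_airyIntegrand hN hκ m z) (continuous_airyIntegrand _ z).aestronglyMeasurable
    (Filter.Eventually.of_forall fun s w hw => hC w s ?_)
    ((integrable_exp_neg_mul_sq (by norm_num : (0 : ℝ) < 1 / 2)).const_mul C)
    (Filter.Eventually.of_forall fun s w _ => ?_)).2
  · exact this.const_mul _
  · have h1 := norm_le_norm_add_norm_sub' w z
    rw [Metric.mem_ball, dist_eq_norm] at hw
    linarith
  · have h1 : HasDerivAt (fun w : ℂ => w * airyPt N κ s + (κ : ℂ) * airyPt N κ s ^ N)
        (airyPt N κ s) w := by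
      simpa using ((hasDerivAt_id w).mul_const (airyPt N κ s)).add_const
        ((κ : ℂ) * airyPt N κ s ^ N)
    have h2 := (h1.cexp).const_mul (airyPt N κ s ^ m)
    refine h2.congr_deriv ?_
    simp only [airyIntegrand]
    ring

/-- The s-derivative of the integrand has integral zero. For m = 0 the truncated index m - 1 is
harmless, being multiplied by 0. -/
theorem airyMoment_recurrence (hN : 2 ≤ N) (hκ : IsHeatSign N κ) (m : ℕ) (z : ℂ) :
    z * airyMoment N κ m z + m * airyMoment N κ (m - 1) z +
      κ * N * airyMoment N κ (m + (N - 1)) z = 0 := by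
  have hint (k : ℕ) := integrable_airyIntegrand hN hκ k z
  have hderiv (s : ℝ) : HasDerivAt (airyIntegrand N κ m z)
      (Complex.I * (z * airyIntegrand N κ m z s + m * airyIntegrand N κ (m - 1) z s +
        κ * N * airyIntegrand N κ (m + (N - 1)) z s)) s := by
    have h1 : HasDerivAt (airyPt N κ) Complex.I s := by
      have := ((Complex.ofRealCLM.hasDerivAt (x := s)).mul_const
        Complex.I).const_add (airyAbscissa N κ : ℂ)
      simp only [Complex.ofRealCLM_apply, Complex.ofReal_one, one_mul] at this
      exact this
    have h2 : HasDerivAt (fun s => z * airyPt N κ s + (κ : ℂ) * airyPt N κ s ^ N)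
        (z * Complex.I + κ * (N * airyPt N κ s ^ (N - 1) * Complex.I)) s :=
      (h1.const_mul z).add ((h1.pow N).const_mul _)
    refine ((h1.pow m).mul h2.cexp).congr_deriv ?_
    simp only [airyIntegrand, pow_add, Pi.pow_apply]
    ring
  have hsum : Integrable fun s => z * airyIntegrand N κ m z s +
      m * airyIntegrand N κ (m - 1) z s + κ * N * airyIntegrand N κ (m + (N - 1)) z s :=
    (((hint m).const_mul z).add ((hint (m - 1)).const_mul _)).add ((hint _).const_mul _)
  have hsum' : Integrable fun s => z * airyIntegrand N κ m z s +
      m * airyIntegrand N κ (m - 1) z s :=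
    ((hint m).const_mul z).add ((hint (m - 1)).const_mul _)
  have h0 := integral_eq_zero_of_hasDerivAt_of_integrable hderiv (hsum.const_mul _) (hint m)
  rw [integral_const_mul, integral_add hsum' ((hint _).const_mul _),
    integral_add ((hint m).const_mul z) ((hint (m - 1)).const_mul _),
    integral_const_mul, integral_const_mul, integral_const_mul] at h0
  have h1 := (mul_eq_zero.1 h0).resolve_left Complex.I_ne_zero
  simp only [airyMoment]
  linear_combination (1 / (2 * (Real.pi : ℂ))) * h1

/-- On the real line the function is, up to a nowhere vanishing factor and a rescaling, the Fourier
transform of s ↦ exp(κ (c + i s)^N). If it were zero, Fourier inversion would make this exponential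
vanish. -/
theorem exists_airyMoment_ne_zero (hN : 2 ≤ N) (hκ : IsHeatSign N κ) :
    ∃ x : ℝ, airyMoment N κ 0 x ≠ 0 := by
  by_contra! hcon
  set f : ℝ → ℂ := fun s => Complex.exp ((κ : ℂ) * airyPt N κ s ^ N) with hf
  have hfeq : airyIntegrand N κ 0 0 = f := by
    funext s; simp [airyIntegrand, hf]
  have hfc : Continuous f := hfeq ▸ continuous_airyIntegrand 0 0
  have hfi : Integrable f := hfeq ▸ integrable_airyIntegrand hN hκ 0 0
  have hF : FourierTransform.fourier f = 0 := by
    funext w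
    rw [Real.fourier_real_eq_integral_exp_smul]
    have h1 := hcon (-2 * Real.pi * w)
    have hpi : (1 / (2 * (Real.pi : ℂ))) ≠ 0 := by
      simp [Real.pi_ne_zero]
    have h2 := (mul_eq_zero.1 h1).resolve_left hpi
    have h3 : airyIntegrand N κ 0 ((-2 * Real.pi * w : ℝ) : ℂ) = fun s : ℝ =>
        Complex.exp ((-2 * Real.pi * w * airyAbscissa N κ : ℝ) : ℂ) *
          (Complex.exp (((-2 * Real.pi * s * w : ℝ) : ℂ) * Complex.I) • f s) := by
      funext s
      simp only [airyIntegrand, hf, smul_eq_mul, pow_zero, one_mul, ← Complex.exp_add]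
      congr 1
      simp only [airyPt]
      push_cast
      ring
    rw [h3, integral_const_mul] at h2
    exact (mul_eq_zero.1 h2).resolve_left (Complex.exp_ne_zero _)
  have hinv := hfc.fourierInv_fourier_eq hfi (by rw [hF]; exact integrable_zero _ _ _)
  have h0 : f 0 = 0 := by
    rw [← hinv, hF, Real.fourierInv_eq]
    simp
  exact Complex.exp_ne_zero _ h0

theorem airyMoment_not_eventually_zero (hN : 2 ≤ N) (hκ : IsHeatSign N κ) {x₀ : ℝ}
    (h : ∀ᶠ x : ℝ in nhds x₀, airyMoment N κ 0 x = 0) : False := by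
  obtain ⟨x, hx⟩ := exists_airyMoment_ne_zero hN hκ
  have han : AnalyticOnNhd ℂ (airyMoment N κ 0) Set.univ :=
    DifferentiableOn.analyticOnNhd (fun z _ =>
      (hasDerivAt_airyMoment hN hκ 0 z).differentiableAt.differentiableWithinAt) isOpen_univ
  refine hx (han.eqOn_zero_of_preconnected_of_frequently_eq_zero isPreconnected_univ
    (Set.mem_univ (x₀ : ℂ)) ?_ (Set.mem_univ _))
  have hfr : ∃ᶠ x : ℝ in nhdsWithin x₀ {x₀}ᶜ, airyMoment N κ 0 x = 0 :=
    (h.filter_mono nhdsWithin_le_nhds).frequently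
  have htend : Filter.Tendsto (fun x : ℝ => (x : ℂ)) (nhdsWithin x₀ {x₀}ᶜ)
      (nhdsWithin (x₀ : ℂ) {(x₀ : ℂ)}ᶜ) := by
    refine tendsto_nhdsWithin_iff.2 ⟨?_, ?_⟩
    · exact (Complex.continuous_ofReal.tendsto x₀).mono_left nhdsWithin_le_nhds
    · filter_upwards [self_mem_nhdsWithin] with y hy
      simpa using hy
  exact htend.frequently hfr

theorem airy_eq_airyMoment (x : ℝ) : airy N κ x = airyMoment N κ 0 x := by
  simp [airy, airyMoment, airyIntegrand, airyPt]

theorem iteratedDeriv_airy (hN : 2 ≤ N) (hκ : IsHeatSign N κ) (m : ℕ) :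
    iteratedDeriv m (airy N κ) = fun x : ℝ => airyMoment N κ m x := by
  induction m with
  | zero => funext x; rw [iteratedDeriv_zero, airy_eq_airyMoment]
  | succ m ih =>
    rw [iteratedDeriv_succ, ih]
    funext x
    exact (hasDerivAt_airyMoment hN hκ m x).comp_ofReal.deriv

end AiryIntegral

/-! ### Linear independence of the Airy derivatives over the polynomials -/

section AiryIndependence

variable {n : ℕ} {κ : ℝ}

/-- The value at `x` of `q(∂)` applied to the Airy-type function. -/
def airyEval (N : ℕ) (κ : ℝ) (x : ℝ) : ℂ[X] →ₗ[ℂ] ℂ :=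
  Polynomial.lsum fun m => LinearMap.mulRight ℂ (airyMoment N κ m x)

theorem airyEval_monomial (N : ℕ) (x : ℝ) (m : ℕ) (a : ℂ) :
    airyEval N κ x (monomial m a) = a * airyMoment N κ m x := by
  simp only [airyEval, Polynomial.lsum_apply]
  rw [Polynomial.sum_monomial_index _ _ (by simp)]
  rfl

theorem hasDerivAt_airyEval {N : ℕ} (hN : 2 ≤ N) (hκ : IsHeatSign N κ) (q : ℂ[X]) (x : ℝ) :
    HasDerivAt (fun x => airyEval N κ x q) (airyEval N κ x (X * q)) x := by
  induction q using Polynomial.induction_on' with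
  | add p q hp hq =>
    simp only [map_add, mul_add]
    exact hp.add hq
  | monomial m a =>
    simp only [airyEval_monomial, X_mul_monomial]
    exact ((hasDerivAt_airyMoment hN hκ m x).comp_ofReal).const_mul a

/-- The operator on symbols that corresponds to the multiplication by the independent variable. -/
def positionOp (n : ℕ) (κ : ℝ) (q : ℂ[X]) : ℂ[X] :=
  -(C ((κ : ℂ) * (n + 1)) * (X ^ n * q)) - derivative q

theorem mul_airyEval (hn : 1 ≤ n) (hκ : IsHeatSign (n + 1) κ) (q : ℂ[X]) (x : ℝ) :
    (x : ℂ) * airyEval (n + 1) κ x q = airyEval (n + 1) κ x (positionOp n κ q) := by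
  unfold positionOp
  induction q using Polynomial.induction_on' with
  | add p q hp hq =>
    rw [map_add, mul_add, hp, hq, ← map_add]
    congr 1
    simp only [mul_add, derivative_add]
    ring
  | monomial m a =>
    have h := airyMoment_recurrence (by omega) hκ m (x : ℂ)
    rw [X_pow_mul_monomial, C_mul_monomial, derivative_monomial, map_sub, map_neg,
      airyEval_monomial, airyEval_monomial, airyEval_monomial]
    push_cast at h
    linear_combination a * h

/-- No nonzero constant-coefficient operator annihilates the Airy function on an open set. If q(∂)
does, so does ∂^n q(∂); multiplying q(∂)A = 0 by x and using the recurrence shows that q'(∂) does as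
well. The degree thus descends to a constant, which analyticity excludes. -/
theorem eq_zero_of_airyEval_eq_zero (hn : 1 ≤ n) (hκ : IsHeatSign (n + 1) κ) {S : Set ℝ}
    (hS : IsOpen S) (hne : S.Nonempty) (d : ℕ) :
    ∀ q : ℂ[X], q.natDegree ≤ d → (∀ x ∈ S, airyEval (n + 1) κ x q = 0) → q = 0 := by
  have hX (q : ℂ[X]) (hq : ∀ x ∈ S, airyEval (n + 1) κ x q = 0) :
      ∀ x ∈ S, airyEval (n + 1) κ x (X * q) = 0 := by
    intro x hx
    rw [← (hasDerivAt_airyEval (by omega) hκ q x).deriv]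
    have : (fun x => airyEval (n + 1) κ x q) =ᶠ[nhds x] fun _ => 0 := by
      filter_upwards [hS.mem_nhds hx] with y hy using hq y hy
    rw [this.deriv_eq, deriv_const]
  have hXn (k : ℕ) (q : ℂ[X]) (hq : ∀ x ∈ S, airyEval (n + 1) κ x q = 0) :
      ∀ x ∈ S, airyEval (n + 1) κ x (X ^ k * q) = 0 := by
    induction k with
    | zero => simpa using hq
    | succ k ih => rw [pow_succ', mul_assoc]; exact hX _ ih
  have hder (q : ℂ[X]) (hq : ∀ x ∈ S, airyEval (n + 1) κ x q = 0) :
      ∀ x ∈ S, airyEval (n + 1) κ x (derivative q) = 0 := by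
    intro x hx
    have h1 := mul_airyEval hn hκ q x
    rw [hq x hx, mul_zero, positionOp, map_sub, map_neg, ← smul_eq_C_mul, map_smul,
      hXn n q hq x hx] at h1
    simpa using h1.symm
  have hconst (q : ℂ[X]) (hd : q.natDegree = 0) (hq : ∀ x ∈ S, airyEval (n + 1) κ x q = 0) :
      q = 0 := by
    obtain ⟨a, rfl⟩ := natDegree_eq_zero.1 hd
    by_contra ha
    obtain ⟨x, hx⟩ := hne
    refine airyMoment_not_eventually_zero (x₀ := x) (by omega) hκ ?_
    filter_upwards [hS.mem_nhds hx] with y hy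
    have := hq y hy
    rw [← monomial_zero_left, airyEval_monomial] at this
    exact (mul_eq_zero.1 this).resolve_left (by simpa using ha)
  induction d with
  | zero => exact fun q hd hq => hconst q (by omega) hq
  | succ d ih =>
    intro q hd hq
    have h0 := ih (derivative q) ((natDegree_derivative_le q).trans (by omega)) (hder q hq)
    exact hconst q (derivative_eq_zero.1 h0) hq

/-- The operator raises the degree by exactly n, with leading factor -κ(n+1) ≠ 0. -/
theorem eq_zero_of_degLT_positionOp (hκ : κ ≠ 0) {f : ℂ[X]} (h : DegLT n (positionOp n κ f)) :
    f = 0 := by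
  have h1 := h (f.natDegree + n) (by omega)
  have hne : ((κ : ℂ) * (n + 1)) ≠ 0 := by
    refine mul_ne_zero (by exact_mod_cast hκ) ?_
    exact_mod_cast Nat.succ_ne_zero n
  rw [positionOp, coeff_sub, coeff_neg, coeff_C_mul, mul_comm (X ^ n), coeff_mul_X_pow,
    coeff_derivative, coeff_eq_zero_of_natDegree_lt (show f.natDegree < f.natDegree + n + 1 by omega),
    zero_mul, sub_zero, neg_eq_zero] at h1
  simpa using (mul_eq_zero.1 h1).resolve_left hne

/-- The derivatives of order less than `n` of the Airy-type function are linearly independent over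
the polynomials on every nonempty open set. -/
theorem airy_linearIndependent (hn : 1 ≤ n) (hκ : IsHeatSign (n + 1) κ) (hκ0 : κ ≠ 0) {S : Set ℝ}
    (hS : IsOpen S) (hne : S.Nonempty) {K : ℕ} {r : ℕ → ℂ[X]} (hr : ∀ m, DegLT n (r m))
    (h : ∀ x ∈ S, ∑ m ∈ Finset.range K, (x : ℂ) ^ m * airyEval (n + 1) κ x (r m) = 0) :
    ∀ m < K, r m = 0 := by
  have hpow (m : ℕ) (q : ℂ[X]) (x : ℝ) : (x : ℂ) ^ m * airyEval (n + 1) κ x q =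
      airyEval (n + 1) κ x ((positionOp n κ)^[m] q) := by
    induction m generalizing q with
    | zero => simp
    | succ m ih => rw [pow_succ, mul_assoc, mul_airyEval hn hκ, ih, Function.iterate_succ_apply]
  -- Multiplications by x are moved into the symbol, so the relation becomes one for a
  -- constant-coefficient operator.
  have h0 : ∑ m ∈ Finset.range K, (positionOp n κ)^[m] (r m) = 0 := by
    refine eq_zero_of_airyEval_eq_zero hn hκ hS hne _ _ le_rfl fun x hx => ?_
    rw [map_sum, ← h x hx]
    exact Finset.sum_congr rfl fun m _ => (hpow m _ x).symm
  clear h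
  have hadd (f g : ℂ[X]) : positionOp n κ (f + g) = positionOp n κ f + positionOp n κ g := by
    simp only [positionOp, mul_add, derivative_add]; ring
  have hzero : positionOp n κ 0 = 0 := by simp [positionOp]
  induction K generalizing r with
  | zero => intro m hm; omega
  | succ K ih =>
    let Z : ℂ[X] →+ ℂ[X] := ⟨⟨positionOp n κ, hzero⟩, hadd⟩
    rw [Finset.sum_range_succ'] at h0
    have hZ : ∑ m ∈ Finset.range K, (positionOp n κ)^[m + 1] (r (m + 1)) =
        positionOp n κ (∑ m ∈ Finset.range K, (positionOp n κ)^[m] (r (m + 1))) := by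
      change _ = Z _
      rw [map_sum]
      exact Finset.sum_congr rfl fun m _ => Function.iterate_succ_apply' _ _ _
    rw [hZ, Function.iterate_zero, id] at h0
    -- The terms with m ≥ 1 form an image of `positionOp` equal to -r_0, of degree less than n.
    -- Hence both parts vanish and the induction peels off r_0.
    have hf := eq_zero_of_degLT_positionOp (n := n) hκ0
      (f := ∑ m ∈ Finset.range K, (positionOp n κ)^[m] (r (m + 1))) (by
        rw [eq_neg_of_add_eq_zero_left h0]
        intro m hm
        simp [hr 0 m hm])
    rw [hf, hzero, zero_add] at h0
    intro m hm
    cases m with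
    | zero => exact h0
    | succ m => exact ih (r := fun m => r (m + 1)) (fun m => hr _) hf m (by omega)

end AiryIndependence

/-! ### The kernels a_j and their derivatives -/

section AiryTerm

variable {N : ℕ} {κ : ℝ}

theorem airyTerm_eq (hN : 2 ≤ N) (hκ : IsHeatSign N κ) (j : ℕ) (x y : ℝ) {t : ℝ} (ht : 0 < t) :
    airyTerm N κ j x y t = (((t ^ (1 / (N : ℝ)) : ℝ) : ℂ) ^ (j + 1))⁻¹ *
      airyMoment N κ j (((x - y) / t ^ (1 / (N : ℝ)) : ℝ) : ℂ) := by
  rw [airyTerm, iteratedDeriv_airy hN hκ]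
  congr 1
  rw [← Complex.ofReal_pow, ← Complex.ofReal_inv]
  congr 1
  rw [← Real.rpow_natCast, ← Real.rpow_mul ht.le, ← Real.rpow_neg ht.le]
  congr 1
  push_cast
  ring

theorem rpow_one_div_pow (hN : 2 ≤ N) {t : ℝ} (ht : 0 < t) : (t ^ (1 / (N : ℝ))) ^ N = t := by
  rw [one_div]
  exact Real.rpow_inv_natCast_pow ht.le (by omega)

theorem airyTerm_recurrence (hN : 2 ≤ N) (hκ : IsHeatSign N κ) (m : ℕ) (x y : ℝ) {t : ℝ}
    (ht : 0 < t) :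
    ((x - y : ℝ) : ℂ) * airyTerm N κ m x y t + m * airyTerm N κ (m - 1) x y t +
      κ * N * t * airyTerm N κ (m + (N - 1)) x y t = 0 := by
  have hq : 0 < t ^ (1 / (N : ℝ)) := Real.rpow_pos_of_pos ht _
  have hqt := rpow_one_div_pow hN ht
  have hrec := airyMoment_recurrence hN hκ m (((x - y) / t ^ (1 / (N : ℝ)) : ℝ) : ℂ)
  simp only [airyTerm_eq hN hκ _ x y ht]
  generalize t ^ (1 / (N : ℝ)) = q at *
  have hq0 : (q : ℂ) ≠ 0 := by exact_mod_cast hq.ne'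
  have h1 : (t : ℂ) = (q : ℂ) ^ N := by rw [← hqt]; push_cast; rfl
  have h2 : (t : ℂ) * ((q : ℂ) ^ (m + (N - 1) + 1))⁻¹ = ((q : ℂ) ^ m)⁻¹ := by
    rw [h1, show m + (N - 1) + 1 = m + N by omega, pow_add]
    field_simp
  have h3 : (m : ℂ) * ((q : ℂ) ^ (m - 1 + 1))⁻¹ = m * ((q : ℂ) ^ m)⁻¹ := by
    cases m <;> simp
  have h4 : ((x - y : ℝ) : ℂ) * ((q : ℂ) ^ (m + 1))⁻¹ =
      ((q : ℂ) ^ m)⁻¹ * (((x - y) / q : ℝ) : ℂ) := by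
    push_cast
    rw [pow_succ]
    field_simp
  linear_combination ((q : ℂ) ^ m)⁻¹ * hrec + airyMoment N κ m (((x - y) / q : ℝ) : ℂ) * h4 +
    airyMoment N κ (m - 1) (((x - y) / q : ℝ) : ℂ) * h3 +
    κ * N * airyMoment N κ (m + (N - 1)) (((x - y) / q : ℝ) : ℂ) * h2

theorem hasDerivAt_airyTerm_fst (hN : 2 ≤ N) (hκ : IsHeatSign N κ) (j : ℕ) (x y : ℝ) {t : ℝ}
    (ht : 0 < t) :
    HasDerivAt (fun x => airyTerm N κ j x y t) (airyTerm N κ (j + 1) x y t) x := by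
  simp only [airyTerm_eq hN hκ _ _ y ht]
  set q := t ^ (1 / (N : ℝ))
  have h1 : HasDerivAt (fun x : ℝ => (x - y) / q) (1 / q) x :=
    ((hasDerivAt_id x).sub_const y).div_const q
  have h2 := ((hasDerivAt_airyMoment hN hκ j (((x - y) / q : ℝ) : ℂ)).comp_ofReal).scomp x h1
  refine (h2.const_mul (((q : ℂ) ^ (j + 1))⁻¹)).congr_deriv ?_
  rw [Complex.real_smul, pow_succ (q : ℂ) (j + 1)]
  push_cast
  rw [mul_inv]
  ring

/-- Differentiating the scaling gives -((x - y) a_{j+1} + (j+1) a_j) / (N t), which the recurrence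
of index j + 1 identifies with κ a_{j+N}. -/
theorem hasDerivAt_airyTerm_time (hN : 2 ≤ N) (hκ : IsHeatSign N κ) (j : ℕ) (x y : ℝ) {t : ℝ}
    (ht : 0 < t) :
    HasDerivAt (fun t => airyTerm N κ j x y t) (κ * airyTerm N κ (j + N) x y t) t := by
  have hev : (fun t => airyTerm N κ j x y t) =ᶠ[nhds t] fun t =>
      (((t ^ (1 / (N : ℝ)) : ℝ) : ℂ) ^ (j + 1))⁻¹ *
      airyMoment N κ j (((x - y) / t ^ (1 / (N : ℝ)) : ℝ) : ℂ) := by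
    filter_upwards [lt_mem_nhds ht] with τ hτ using airyTerm_eq hN hκ j x y hτ
  refine HasDerivAt.congr_of_eventuallyEq ?_ hev
  have hN0 : (N : ℝ) ≠ 0 := by positivity
  have hrec := airyTerm_recurrence hN hκ (j + 1) x y ht
  have hNj : j + 1 + (N - 1) = j + N := by omega
  rw [hNj, Nat.add_sub_cancel] at hrec
  rw [airyTerm_eq hN hκ (j + 1) x y ht, airyTerm_eq hN hκ j x y ht] at hrec
  generalize airyTerm N κ (j + N) x y t = T at *
  have hq : 0 < t ^ (1 / (N : ℝ)) := Real.rpow_pos_of_pos ht _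
  have hd : HasDerivAt (fun t : ℝ => t ^ (1 / (N : ℝ))) (t ^ (1 / (N : ℝ)) / (N * t)) t := by
    refine (Real.hasDerivAt_rpow_const (Or.inl ht.ne')).congr_deriv ?_
    rw [Real.rpow_sub ht, Real.rpow_one]
    field_simp
  set Q : ℝ → ℝ := fun t => t ^ (1 / (N : ℝ)) with hQ
  change HasDerivAt (fun t => ((Q t : ℂ) ^ (j + 1))⁻¹ *
    airyMoment N κ j (((x - y) / Q t : ℝ) : ℂ)) (κ * T) t
  change HasDerivAt Q (Q t / (N * t)) t at hd
  change 0 < Q t at hq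
  change ((x - y : ℝ) : ℂ) * (((Q t : ℂ) ^ (j + 1 + 1))⁻¹ *
    airyMoment N κ (j + 1) (((x - y) / Q t : ℝ) : ℂ)) + _ * (((Q t : ℂ) ^ (j + 1))⁻¹ *
    airyMoment N κ j (((x - y) / Q t : ℝ) : ℂ)) + _ = 0 at hrec
  have hq0 : (Q t : ℂ) ≠ 0 := by exact_mod_cast hq.ne'
  have ht0 : (t : ℂ) ≠ 0 := by exact_mod_cast ht.ne'
  have hNC : (N : ℂ) ≠ 0 := by exact_mod_cast hN0
  have h1 : HasDerivAt (fun t => (x - y) / Q t) (-((x - y) * (Q t / (N * t))) / Q t ^ 2) t := by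
    refine ((hasDerivAt_const t (x - y)).div hd hq.ne').congr_deriv ?_
    ring
  have h2 := ((hasDerivAt_airyMoment hN hκ j (((x - y) / Q t : ℝ) : ℂ)).comp_ofReal).scomp t h1
  have h3 : HasDerivAt (fun t => ((Q t : ℂ) ^ (j + 1))⁻¹)
      (-(((j + 1 : ℕ) : ℂ) * (Q t : ℂ) ^ j * ((Q t / (N * t) : ℝ) : ℂ)) /
        ((Q t : ℂ) ^ (j + 1)) ^ 2) t := by
    have := (hd.ofReal_comp.pow (j + 1)).inv (pow_ne_zero _ hq0)
    exact this
  refine (h3.mul h2).congr_deriv ?_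
  simp only [Function.comp_apply, Complex.real_smul]
  push_cast at hrec ⊢
  generalize airyMoment N κ j (((x : ℂ) - y) / (Q t : ℂ)) = a at *
  generalize airyMoment N κ (j + 1) (((x : ℂ) - y) / (Q t : ℂ)) = b at *
  have e : (κ : ℂ) * T = -(((x - y : ℂ)) * (((Q t : ℂ) ^ (j + 1 + 1))⁻¹ * b) +
      ((j : ℂ) + 1) * (((Q t : ℂ) ^ (j + 1))⁻¹ * a)) / (N * t) := by
    rw [eq_div_iff (mul_ne_zero hNC ht0)]
    linear_combination hrec
  rw [e]
  generalize (Q t : ℂ) = q at *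
  field_simp
  ring

end AiryTerm

/-! ### Independence of the functions t^k a_j off the diagonal -/

section TermEval

variable {n : ℕ} {κ : ℝ}

/-- The functional `∑ m, q_m ξ ^ m ↦ ∑ m, q_m a_m(x, y, t)`. -/
def termEval (N : ℕ) (κ : ℝ) (x y t : ℝ) : ℂ[X] →ₗ[ℂ] ℂ :=
  Polynomial.lsum fun m => LinearMap.mulRight ℂ (airyTerm N κ m x y t)

theorem termEval_monomial (N : ℕ) (x y t : ℝ) (m : ℕ) (a : ℂ) :
    termEval N κ x y t (monomial m a) = a * airyTerm N κ m x y t := by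
  simp only [termEval, Polynomial.lsum_apply]
  rw [Polynomial.sum_monomial_index _ _ (by simp)]
  rfl

theorem DegLT.eq_sum_monomial {A : Type*} [CommRing A] {f : A[X]} (hf : DegLT n f) :
    f = ∑ j ∈ Finset.range n, monomial j (f.coeff j) := by
  ext m
  rw [finsetSum_coeff]
  simp only [coeff_monomial]
  rw [Finset.sum_ite_eq']
  split_ifs with h
  · rfl
  · exact hf m (by simpa using h)

theorem termEval_of_degLT (N : ℕ) (x y t : ℝ) {q : ℂ[X]} (hq : DegLT n q) :
    termEval N κ x y t q = ∑ j ∈ Finset.range n, q.coeff j * airyTerm N κ j x y t := by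
  conv_lhs => rw [hq.eq_sum_monomial]
  rw [map_sum]
  exact Finset.sum_congr rfl fun j _ => termEval_monomial _ _ _ _ _ _

theorem hasDerivAt_termEval {N : ℕ} (hN : 2 ≤ N) (hκ : IsHeatSign N κ) (x y : ℝ) {t : ℝ}
    (ht : 0 < t) (q : ℂ[X]) :
    HasDerivAt (fun τ => termEval N κ x y τ q) (κ * termEval N κ x y t (X ^ N * q)) t := by
  induction q using Polynomial.induction_on' with
  | add p q hp hq =>
    simp only [map_add, mul_add]
    exact hp.add hq
  | monomial m a =>
    simp only [termEval_monomial, X_pow_mul_monomial]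
    refine ((hasDerivAt_airyTerm_time hN hκ m x y ht).const_mul a).congr_deriv ?_
    ring

/-- Off the diagonal, the functions `t ^ k a_j` with `j < n` are linearly independent. -/
theorem termEval_linearIndependent (hn : 1 ≤ n) (hκ : IsHeatSign (n + 1) κ) (hκ0 : κ ≠ 0)
    {x y : ℝ} (hxy : x ≠ y) {K : ℕ} {c : ℕ → ℂ[X]} (hc : ∀ k, DegLT n (c k))
    (h : ∀ t : ℝ, 0 < t →
      ∑ k ∈ Finset.range K, (t : ℂ) ^ k * termEval (n + 1) κ x y t (c k) = 0) :
    ∀ k < K, c k = 0 := by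
  have hd : x - y ≠ 0 := sub_ne_zero.2 hxy
  set d : ℝ := x - y with hd_def
  have hdC : (d : ℂ) ≠ 0 := by exact_mod_cast hd
  -- With d = x - y and t = (d/z)^(n+1), the function z^((n+1)K) t^k a_j equals d^((n+1)k - j - 1)
  -- z^(e k j) A^(j)(z); the prefactor clears the negative powers of z. For fixed j the exponent
  -- determines k, so b k j can be read off from r (e k j).
  set b : ℕ → ℕ → ℂ := fun k j => (c k).coeff j * (d : ℂ) ^ ((n + 1) * k) * ((d : ℂ) ^ (j + 1))⁻¹
  set e : ℕ → ℕ → ℕ := fun k j => (n + 1) * (K - k) + j + 1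
  set M : ℕ := (n + 1) * K + n + 2
  have he (k j : ℕ) (hj : j < n) : e k j < M := by
    have : (n + 1) * (K - k) ≤ (n + 1) * K := Nat.mul_le_mul_left _ (by omega)
    simp only [e, M]
    omega
  set r : ℕ → ℂ[X] := fun m => ∑ k ∈ Finset.range K, ∑ j ∈ Finset.range n,
    if e k j = m then monomial j (b k j) else 0 with hr_def
  have hr (m : ℕ) : DegLT n (r m) := by
    refine DegLT.sum fun k _ => DegLT.sum fun j hj => ?_
    split_ifs
    · intro i hi
      rw [coeff_monomial, if_neg (by have := Finset.mem_range.1 hj; omega)]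
    · intro i _; simp
  -- The half-line on which d / z is positive, hence a genuine value of t^(1/N).
  have hS : IsOpen {z : ℝ | 0 < d * z} := isOpen_lt continuous_const (by fun_prop)
  have hr0 := airy_linearIndependent hn hκ hκ0 hS ⟨d, mul_self_pos.2 hd⟩ (K := M) hr (by
    intro z hz
    have hz0 : z ≠ 0 := by rintro rfl; simp at hz
    have hzC : (z : ℂ) ≠ 0 := by exact_mod_cast hz0
    have hq : 0 < d / z := by
      rw [div_pos_iff]; exact mul_pos_iff.1 hz
    have hq1 : ((d / z) ^ (n + 1)) ^ (1 / ((n + 1 : ℕ) : ℝ)) = d / z := by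
      rw [one_div]; exact Real.pow_rpow_inv_natCast hq.le (by omega)
    have ht := h ((d / z) ^ (n + 1)) (by positivity)
    have hsum : ∑ m ∈ Finset.range M, (z : ℂ) ^ m * airyEval (n + 1) κ z (r m) =
        ∑ k ∈ Finset.range K, ∑ j ∈ Finset.range n,
          (z : ℂ) ^ e k j * (b k j * airyMoment (n + 1) κ j z) := by
      simp only [hr_def, map_sum, Finset.mul_sum]
      rw [Finset.sum_comm]
      refine Finset.sum_congr rfl fun k _ => ?_
      rw [Finset.sum_comm]
      refine Finset.sum_congr rfl fun j hj => ?_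
      rw [Finset.sum_eq_single (e k j)]
      · rw [if_pos rfl, airyEval_monomial]
      · intro m _ hm
        rw [if_neg hm.symm, map_zero, mul_zero]
      · intro hm
        exact absurd (Finset.mem_range.2 (he k j (Finset.mem_range.1 hj))) hm
    rw [hsum, ← mul_zero ((z : ℂ) ^ ((n + 1) * K)), ← ht, Finset.mul_sum]
    refine Finset.sum_congr rfl fun k hk => ?_
    rw [termEval_of_degLT _ _ _ _ (hc k), Finset.mul_sum, Finset.mul_sum]
    refine Finset.sum_congr rfl fun j _ => ?_
    rw [airyTerm_eq (by omega) hκ j x y (by positivity), hq1, ← hd_def,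
      show d / (d / z) = z by field_simp]
    have hK : (z : ℂ) ^ ((n + 1) * K) = (z : ℂ) ^ ((n + 1) * (K - k)) * (z : ℂ) ^ ((n + 1) * k) := by
      rw [← pow_add, ← mul_add]
      congr 2
      have := Finset.mem_range.1 hk
      omega
    simp only [e, b]
    rw [hK]
    push_cast
    rw [show (n + 1) * (K - k) + j + 1 = (n + 1) * (K - k) + (j + 1) by ring, pow_add,
      ← pow_mul, div_pow, div_pow, inv_div]
    field_simp)
  intro k hk
  ext j
  rw [coeff_zero]
  rcases lt_or_ge j n with hj | hj
  · have h1 := congrArg (fun p => p.coeff j) (hr0 (e k j) (he k j hj))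
    simp only [hr_def, finsetSum_coeff, coeff_zero] at h1
    rw [Finset.sum_eq_single k, Finset.sum_eq_single j, if_pos rfl, coeff_monomial, if_pos rfl]
      at h1
    · simp only [b] at h1
      have h2 : (d : ℂ) ^ ((n + 1) * k) ≠ 0 := pow_ne_zero _ hdC
      have h3 : ((d : ℂ) ^ (j + 1))⁻¹ ≠ 0 := inv_ne_zero (pow_ne_zero _ hdC)
      exact (mul_eq_zero.1 ((mul_eq_zero.1 h1).resolve_right h3)).resolve_right h2
    · intro i _ hi
      split_ifs
      · rw [coeff_monomial, if_neg hi]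
      · simp
    · intro hj'; exact absurd (Finset.mem_range.2 hj) hj'
    · intro l hl hlk
      refine Finset.sum_eq_zero fun i _ => ?_
      split_ifs with hei
      · rw [coeff_monomial, if_neg]
        rintro rfl
        apply hlk
        simp only [e] at hei
        have hei' : (n + 1) * (K - l) = (n + 1) * (K - k) := by omega
        have := Nat.eq_of_mul_eq_mul_left (by omega) hei'
        have := Finset.mem_range.1 hl
        omega
      · simp
    · intro hk'; exact absurd (Finset.mem_range.2 hk) hk'
  · exact hc k j hj

end TermEval

/-! ### Substituting the kernels for the powers of ξ -/

section KernelMap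

variable {N : ℕ} {κ t : ℝ} {Ω : Set (ℝ × ℝ)}

theorem contDiff_airyTerm (hN : 2 ≤ N) (hκ : IsHeatSign N κ) (ht : 0 < t) (m : ℕ) :
    ContDiff ℝ ∞ fun p : ℝ × ℝ => airyTerm N κ m p.1 p.2 t := by
  have h1 : ContDiff ℂ ∞ (airyMoment N κ m) :=
    Differentiable.contDiff fun z => (hasDerivAt_airyMoment hN hκ m z).differentiableAt
  have h2 : ContDiff ℝ ∞ fun p : ℝ × ℝ => (((p.1 - p.2) / t ^ (1 / (N : ℝ)) : ℝ) : ℂ) :=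
    Complex.ofRealCLM.contDiff.comp ((contDiff_fst.sub contDiff_snd).div_const _)
  simp only [airyTerm_eq hN hκ m _ _ ht]
  exact contDiff_const.mul ((h1.restrict_scalars ℝ).comp h2)

/-- The function `a_m(x, y, t)` for a fixed `t`, as a smooth function. -/
def airyFn (Ω : Set (ℝ × ℝ)) (hN : 2 ≤ N) (hκ : IsHeatSign N κ) (ht : 0 < t) (m : ℕ) :
    SmoothFn Ω :=
  SmoothFn.of (fun p => airyTerm N κ m p.1 p.2 t) (contDiff_airyTerm hN hκ ht m).contDiffOn

variable (hN : 2 ≤ N) (hκ : IsHeatSign N κ) (ht : 0 < t)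

theorem partialD_airyFn (hΩ : IsOpen Ω) (m : ℕ) :
    partialD hΩ (1, 0) (airyFn Ω hN hκ ht m) = airyFn Ω hN hκ ht (m + 1) := by
  refine SmoothFn.ext_fun fun p => ?_
  obtain ⟨⟨x, y⟩, hp⟩ := p
  rw [partialD_apply hΩ _ _ (F := fun p => airyTerm N κ m p.1 p.2 t) (fun q => rfl)]
  have h1 : HasDerivAt (fun s : ℝ => (s, y)) ((1 : ℝ), (0 : ℝ)) x :=
    (hasDerivAt_id x).prodMk (hasDerivAt_const x y)
  have h2 : HasFDerivAt (fun p : ℝ × ℝ => airyTerm N κ m p.1 p.2 t)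
      (fderiv ℝ (fun p : ℝ × ℝ => airyTerm N κ m p.1 p.2 t) (x, y)) (x, y) :=
    ((contDiff_airyTerm hN hκ ht m).differentiable (by simp) _).hasFDerivAt
  have h3 := HasFDerivAt.comp_hasDerivAt x (f := fun s : ℝ => (s, y)) h2 h1
  exact h3.unique (hasDerivAt_airyTerm_fst hN hκ m x y ht)

/-- The map `∑ m, f_m ξ ^ m ↦ ∑ m, f_m a_m`. -/
def kernelMap (Ω : Set (ℝ × ℝ)) (hN : 2 ≤ N) (hκ : IsHeatSign N κ) (ht : 0 < t) :
    (SmoothFn Ω)[X] →ₗ[ℝ] SmoothFn Ω :=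
  Polynomial.lsum fun m => LinearMap.mulRight ℝ (airyFn Ω hN hκ ht m)

theorem kernelMap_monomial (m : ℕ) (a : SmoothFn Ω) :
    kernelMap Ω hN hκ ht (monomial m a) = a * airyFn Ω hN hκ ht m := by
  simp only [kernelMap, Polynomial.lsum_apply]
  rw [Polynomial.sum_monomial_index _ _ (by simp)]
  rfl

theorem partialD_kernelMap (hΩ : IsOpen Ω) (f : (SmoothFn Ω)[X]) :
    partialD hΩ (1, 0) (kernelMap Ω hN hκ ht f) =
      kernelMap Ω hN hκ ht (symD (partialD hΩ (1, 0)) f) := by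
  induction f using Polynomial.induction_on' with
  | add p q hp hq => simp only [map_add, hp, hq]
  | monomial m a =>
    have h : coeffMap (partialD hΩ (1, 0) : SmoothFn Ω →ₗ[ℝ] SmoothFn Ω) (monomial m a) =
        monomial m (partialD hΩ (1, 0) a) := by
      ext1 i
      rw [coeff_coeffMap, coeff_monomial, coeff_monomial]
      split_ifs <;> simp
    rw [symD, LinearMap.add_apply, mulX_apply, X_mul_monomial, h, map_add, kernelMap_monomial,
      kernelMap_monomial, kernelMap_monomial, Derivation.leibniz, partialD_airyFn]
    simp only [smul_eq_mul]
    ring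

theorem iterate_partialD_kernelMap (hΩ : IsOpen Ω) (i : ℕ) (f : (SmoothFn Ω)[X]) :
    (partialD hΩ (1, 0))^[i] (kernelMap Ω hN hκ ht f) =
      kernelMap Ω hN hκ ht ((symD (partialD hΩ (1, 0)) ^ i) f) := by
  induction i with
  | zero => simp
  | succ i ih =>
    rw [Function.iterate_succ_apply', ih, partialD_kernelMap, pow_succ', Module.End.mul_apply]

theorem mul_kernelMap (a : SmoothFn Ω) (f : (SmoothFn Ω)[X]) :
    a * kernelMap Ω hN hκ ht f = kernelMap Ω hN hκ ht (mulC a f) := by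
  induction f using Polynomial.induction_on' with
  | add p q hp hq => simp only [map_add, mul_add, hp, hq]
  | monomial m b =>
    rw [mulC_apply, C_mul_monomial, kernelMap_monomial, kernelMap_monomial, mul_assoc]

theorem kernelMap_theta (f : (SmoothFn Ω)[X]) :
    kernelMap Ω hN hκ ht (theta (diffFn Ω) f) +
      (κ * N * t) • kernelMap Ω hN hκ ht ((mulX ^ (N - 1)) f) = 0 := by
  induction f using Polynomial.induction_on' with
  | add p q hp hq =>
    simp only [map_add, smul_add]
    linear_combination (norm := module) hp + hq
  | monomial m a =>
    rw [theta, LinearMap.add_apply, mulC_apply, derivX_apply, C_mul_monomial, derivative_monomial,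
      mulX_pow_apply, X_pow_mul_monomial, map_add, kernelMap_monomial, kernelMap_monomial,
      kernelMap_monomial]
    refine SmoothFn.ext_fun fun p => ?_
    have h := airyTerm_recurrence hN hκ m p.1.1 p.1.2 ht
    change ((p.1.1 - p.1.2 : ℝ) : ℂ) * a.1 p * airyTerm N κ m p.1.1 p.1.2 t +
      a.1 p * (m : SmoothFn Ω).1 p * airyTerm N κ (m - 1) p.1.1 p.1.2 t +
      (κ * N * t) • (a.1 p * airyTerm N κ (m + (N - 1)) p.1.1 p.1.2 t) = 0
    have hm : (m : SmoothFn Ω).1 p = (m : ℂ) := by simp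
    rw [hm, Complex.real_smul]
    push_cast at h ⊢
    linear_combination a.1 p * h

/-- The evaluation of smooth functions at a point. -/
def evalHom (p : Ω) : SmoothFn Ω →+* ℂ where
  toFun f := f.1 p
  map_one' := rfl
  map_mul' _ _ := rfl
  map_zero' := rfl
  map_add' _ _ := rfl

@[simp] theorem evalHom_apply (p : Ω) (f : SmoothFn Ω) : evalHom p f = f.1 p := rfl

theorem kernelMap_apply (p : Ω) (f : (SmoothFn Ω)[X]) :
    (kernelMap Ω hN hκ ht f).1 p = termEval N κ p.1.1 p.1.2 t (f.map (evalHom p)) := by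
  induction f using Polynomial.induction_on' with
  | add f g hf hg =>
    rw [map_add, Polynomial.map_add, map_add, ← hf, ← hg]
    rfl
  | monomial m a =>
    rw [kernelMap_monomial, map_monomial, termEval_monomial]
    rfl

theorem iteratedDeriv_slice (hΩ : IsOpen Ω) (g : SmoothFn Ω) {F : ℝ × ℝ → ℂ}
    (hF : ∀ p : Ω, g.1 p = F p) (i : ℕ) {x y : ℝ} (h : (x, y) ∈ Ω) :
    iteratedDeriv i (fun s => F (s, y)) x = ((partialD hΩ (1, 0))^[i] g).1 ⟨(x, y), h⟩ := by
  induction i generalizing x with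
  | zero => simp [hF]
  | succ i ih =>
    rw [iteratedDeriv_succ, Function.iterate_succ_apply',
      ← (hasDerivAt_slice hΩ ((partialD hΩ (1, 0))^[i] g) h).deriv]
    refine Filter.EventuallyEq.deriv_eq ?_
    have hnear : ∀ᶠ s in nhds x, (s, y) ∈ Ω :=
      (show ContinuousAt (fun s : ℝ => (s, y)) x by fun_prop).eventually (hΩ.mem_nhds h)
    filter_upwards [hnear] with s hs
    rw [ih hs, SmoothFn.extend_apply _ ⟨(s, y), hs⟩]

end KernelMap

/-- Applying `∂_t - κ L` termwise to `∑ k, t ^ k E (h k)`, where `E` turns `ξ` into `∂_x` and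
`κ ξ ^ (n + 1)` into `∂_t`, leaves the transport defects and one term of top order. -/
theorem sum_sub_eq_sum_transportDefect {A : Type*} [CommRing A] [Algebra ℝ A] {n : ℕ} {κ t : ℝ}
    {δ : A} {S : Module.End ℝ A[X]} {h : ℕ → A[X]} (h0 : DegLT n (S (h 0)))
    {E : A[X] →ₗ[ℝ] ℂ}
    (hE : ∀ f, E (theta δ f) + (κ * ((n : ℝ) + 1) * t) • E ((mulX ^ n) f) = 0) (K : ℕ) :
    (t : ℂ) * (∑ k ∈ Finset.range (K + 1), ((k : ℂ) * (t : ℂ) ^ (k - 1) * E (h k) +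
        (t : ℂ) ^ k * (κ * E ((mulX ^ (n + 1)) (h k)))) -
      κ * ∑ k ∈ Finset.range (K + 1), (t : ℂ) ^ k * (E (S (h k)) + E ((mulX ^ (n + 1)) (h k)))) =
    t * (∑ k ∈ Finset.range K, (t : ℂ) ^ k * E (transportDefect n κ δ S h k) -
      (t : ℂ) ^ K * (κ * E (remPart n S (h K)))) := by
  induction K with
  | zero =>
    rw [remPart_apply_of_degLT h0]
    simp
    ring
  | succ K ih =>
    rw [Finset.sum_range_succ _ (K + 1), Finset.sum_range_succ _ (K + 1),
      Finset.sum_range_succ (fun k => (t : ℂ) ^ k * E (transportDefect n κ δ S h k)) K]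
    -- The kernel relation trades κ t^(K+1) (n+1) ξ^n P h_{K+1} for -t^K θ P h_{K+1}, which
    -- completes the defect of index K.
    have h1 := hE (quotPart n S (h (K + 1)))
    have h2 : E (S (h (K + 1))) = E (remPart n S (h (K + 1))) +
        ((n : ℝ) + 1) • E ((mulX ^ n) (quotPart n S (h (K + 1)))) := by
      rw [remPart, LinearMap.sub_apply, map_sub, LinearMap.smul_apply, map_smul,
        Module.End.mul_apply, sub_add_cancel]
    have h3 : E (transportDefect n κ δ S h K) = ((K : ℝ) + 1) • E (h (K + 1)) +
        E (theta δ (quotPart n S (h (K + 1)))) - κ • E (remPart n S (h K)) := by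
      rw [transportDefect, map_sub, map_add, map_smul, map_smul]
    rw [h2, h3]
    simp only [Complex.real_smul] at h1 ⊢
    push_cast at h1 ⊢
    linear_combination ih - (t : ℂ) ^ (K + 1) * h1

theorem symOp_apply_add {A : Type*} [CommRing A] [Algebra ℝ A] (n : ℕ) (d : Derivation ℝ A A)
    (u : ℕ → A) (f : A[X]) : symOp n d u f + (mulX ^ (n + 1)) f =
      (symD d ^ (n + 1)) f + ∑ i ∈ Finset.range n, mulC (u i) ((symD d ^ i) f) := by
  rw [symOp, LinearMap.add_apply, LinearMap.sub_apply, LinearMap.sum_apply, add_right_comm,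
    sub_add_cancel]
  rfl

/-! ### From formal solutions to transport equations -/

section Transport

variable {n : ℕ} {κ : ℝ} {D : Set ℝ} {u : ℕ → ℝ → ℂ} {Ω : Set (ℝ × ℝ)} {H : ℕ → ℕ → ℝ → ℝ → ℂ}

/-- The coefficients of the differential operator, as functions of two variables. -/
def coeffFn (hu : ∀ i < n, ContDiffOn ℝ ∞ (u i) D) (hΩ : Set.MapsTo Prod.fst Ω D) (i : ℕ) :
    SmoothFn Ω :=
  if h : i < n then SmoothFn.of (fun p => u i p.1) ((hu i h).comp contDiff_fst.contDiffOn hΩ)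
  else 0

theorem coeffFn_apply (hu : ∀ i < n, ContDiffOn ℝ ∞ (u i) D) (hΩ : Set.MapsTo Prod.fst Ω D)
    {i : ℕ} (hi : i < n) (p : Ω) : (coeffFn hu hΩ i).1 p = u i p.1.1 := by
  rw [coeffFn, dif_pos hi]
  rfl

/-- The generating polynomial `∑ j, H_k^j ξ ^ j`, which is `1` for `k = 0`. -/
def hadamardPoly (hH : ∀ k j, 1 ≤ k → j < n → ContDiffOn ℝ ∞ (fun p : ℝ × ℝ => H k j p.1 p.2) Ω)
    (k : ℕ) : (SmoothFn Ω)[X] :=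
  if h : 1 ≤ k then ∑ j : Fin n, monomial j (SmoothFn.of _ (hH k j h j.2)) else 1

variable (hH : ∀ k j, 1 ≤ k → j < n → ContDiffOn ℝ ∞ (fun p : ℝ × ℝ => H k j p.1 p.2) Ω)

theorem hadamardPoly_zero : hadamardPoly hH 0 = 1 := dif_neg (by simp)

theorem degLT_one {A : Type*} [CommRing A] (hn : 1 ≤ n) : DegLT n (1 : A[X]) := fun m hm => by
  rw [coeff_one, if_neg (by omega)]

theorem degLT_hadamardPoly (hn : 1 ≤ n) (k : ℕ) : DegLT n (hadamardPoly hH k) := by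
  rw [hadamardPoly]
  split_ifs with h
  · refine DegLT.sum fun j _ m hm => ?_
    rw [coeff_monomial, if_neg (by omega)]
  · exact degLT_one hn

theorem coeff_hadamardPoly {k j : ℕ} (hk : 1 ≤ k) (hj : j < n) (p : Ω) :
    ((hadamardPoly hH k).coeff j).1 p = H k j p.1.1 p.1.2 := by
  rw [hadamardPoly, dif_pos hk, finsetSum_coeff, Finset.sum_eq_single ⟨j, hj⟩]
  · rw [coeff_monomial, if_pos rfl]
    rfl
  · intro i _ hi
    rw [coeff_monomial, if_neg (fun h => hi (Fin.ext h))]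
  · simp

theorem DegLT.map {A B : Type*} [CommRing A] [CommRing B] (φ : A →+* B) {f : A[X]}
    (hf : DegLT n f) : DegLT n (f.map φ) := fun m hm => by
  rw [coeff_map, hf m hm, map_zero]

theorem truncatedKernel_eq_sum (hn : 1 ≤ n) (K : ℕ) (p : Ω) (t : ℝ) :
    truncatedKernel (n + 1) κ H K p.1.1 p.1.2 t = ∑ k ∈ Finset.range (K + 1), (t : ℂ) ^ k *
      termEval (n + 1) κ p.1.1 p.1.2 t ((hadamardPoly hH k).map (evalHom p)) := by
  induction K with
  | zero =>
    have h1 : termEval (n + 1) κ p.1.1 p.1.2 t 1 = airyTerm (n + 1) κ 0 p.1.1 p.1.2 t := by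
      rw [← monomial_zero_one, termEval_monomial, one_mul]
    simp [truncatedKernel, hadamardPoly_zero, h1]
  | succ K ih =>
    rw [Finset.sum_range_succ, ← ih,
      termEval_of_degLT _ _ _ _ ((degLT_hadamardPoly hH hn (K + 1)).map _)]
    simp only [truncatedKernel, Nat.add_sub_cancel]
    rw [add_assoc, Finset.mul_sum, ← Finset.sum_add_distrib]
    congr 1
    refine Finset.sum_congr rfl fun j hj => ?_
    rw [Finset.sum_Icc_succ_top (by omega), coeff_map, evalHom_apply,
      coeff_hadamardPoly hH (by omega) (Finset.mem_range.1 hj)]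
    ring

/-- Substitution of the kernel functions at the point `p` for the powers of the variable. -/
def pointEval {N : ℕ} {t : ℝ} (hN : 2 ≤ N) (hκ : IsHeatSign N κ) (ht : 0 < t) (p : Ω) :
    (SmoothFn Ω)[X] →ₗ[ℝ] ℂ :=
  LinearMap.proj p ∘ₗ (smoothSubalgebra Ω).val.toLinearMap ∘ₗ kernelMap Ω hN hκ ht

theorem pointEval_apply {N : ℕ} {t : ℝ} (hN : 2 ≤ N) (hκ : IsHeatSign N κ) (ht : 0 < t) (p : Ω)
    (f : (SmoothFn Ω)[X]) :
    pointEval hN hκ ht p f = termEval N κ p.1.1 p.1.2 t (f.map (evalHom p)) :=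
  kernelMap_apply hN hκ ht p f

theorem deriv_truncatedKernel (hn : 1 ≤ n) (hκ : IsHeatSign (n + 1) κ) {t : ℝ} (ht : 0 < t)
    (hN : 2 ≤ n + 1) (K : ℕ) (p : Ω) :
    deriv (fun τ => truncatedKernel (n + 1) κ H K p.1.1 p.1.2 τ) t =
      ∑ k ∈ Finset.range (K + 1),
        ((k : ℂ) * (t : ℂ) ^ (k - 1) * pointEval hN hκ ht p (hadamardPoly hH k) +
        (t : ℂ) ^ k * (κ * pointEval hN hκ ht p ((mulX ^ (n + 1)) (hadamardPoly hH k)))) := by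
  simp only [truncatedKernel_eq_sum hH hn, pointEval_apply]
  refine (HasDerivAt.fun_sum fun k _ => ?_).deriv
  have h1 : HasDerivAt (fun τ : ℝ => (τ : ℂ) ^ k) ((k : ℂ) * (t : ℂ) ^ (k - 1)) t := by
    simpa using (hasDerivAt_pow k (t : ℂ)).comp_ofReal
  have h2 := hasDerivAt_termEval hN hκ p.1.1 p.1.2 ht ((hadamardPoly hH k).map (evalHom p))
  rw [mulX_pow_apply, Polynomial.map_mul, Polynomial.map_pow, map_X]
  exact h1.mul h2

theorem diffOp_truncatedKernel (hn : 1 ≤ n) (hκ : IsHeatSign (n + 1) κ) {t : ℝ} (ht : 0 < t)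
    (hN : 2 ≤ n + 1) (hu : ∀ i < n, ContDiffOn ℝ ∞ (u i) D) (hΩ : IsOpen Ω)
    (hΩD : Set.MapsTo Prod.fst Ω D) (K : ℕ) (p : Ω) :
    diffOp (n + 1) u (fun ξ => truncatedKernel (n + 1) κ H K ξ p.1.2 t) p.1.1 =
      ∑ k ∈ Finset.range (K + 1), (t : ℂ) ^ k *
        (pointEval hN hκ ht p
            (symOp n (partialD hΩ (1, 0)) (coeffFn hu hΩD) (hadamardPoly hH k)) +
          pointEval hN hκ ht p ((mulX ^ (n + 1)) (hadamardPoly hH k))) := by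
  set f : (SmoothFn Ω)[X] := ∑ k ∈ Finset.range (K + 1), (t ^ k : ℝ) • hadamardPoly hH k with hf
  have hF (q : Ω) : (kernelMap Ω hN hκ ht f).1 q =
      (fun q : ℝ × ℝ => truncatedKernel (n + 1) κ H K q.1 q.2 t) q := by
    change pointEval hN hκ ht q f = truncatedKernel (n + 1) κ H K q.1.1 q.1.2 t
    rw [truncatedKernel_eq_sum hH hn, hf, map_sum]
    refine Finset.sum_congr rfl fun k _ => ?_
    rw [map_smul, pointEval_apply, Complex.real_smul, Complex.ofReal_pow]
  have hslice (i : ℕ) :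
      iteratedDeriv i (fun ξ => truncatedKernel (n + 1) κ H K ξ p.1.2 t) p.1.1 =
        pointEval hN hκ ht p ((symD (partialD hΩ (1, 0)) ^ i) f) := by
    have := iteratedDeriv_slice hΩ (kernelMap Ω hN hκ ht f)
      (F := fun q => truncatedKernel (n + 1) κ H K q.1 q.2 t) hF i (x := p.1.1) (y := p.1.2) p.2
    rw [iterate_partialD_kernelMap] at this
    exact this
  have hmul (i : ℕ) (hi : i < n) (g : (SmoothFn Ω)[X]) :
      u i p.1.1 * pointEval hN hκ ht p g = pointEval hN hκ ht p (mulC (coeffFn hu hΩD i) g) := by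
    rw [← coeffFn_apply hu hΩD hi p]
    exact congrFun (congrArg Subtype.val (mul_kernelMap hN hκ ht (coeffFn hu hΩD i) g)) p
  have hsym : diffOp (n + 1) u (fun ξ => truncatedKernel (n + 1) κ H K ξ p.1.2 t) p.1.1 =
      pointEval hN hκ ht p (symOp n (partialD hΩ (1, 0)) (coeffFn hu hΩD) f) +
        pointEval hN hκ ht p ((mulX ^ (n + 1)) f) := by
    rw [← map_add (pointEval hN hκ ht p), symOp_apply_add, map_add,
      map_sum (pointEval hN hκ ht p) _ (Finset.range n), diffOp, hslice, Nat.add_sub_cancel]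
    refine congrArg₂ (· + ·) rfl (Finset.sum_congr rfl fun i hi => ?_)
    rw [hslice, hmul i (Finset.mem_range.1 hi)]
  rw [hsym, hf]
  simp only [map_sum, map_smul, Complex.real_smul, Complex.ofReal_pow, mul_add,
    Finset.sum_add_distrib]

theorem isTransport_hadamardPoly (hn : 1 ≤ n) (hκ : IsHeatSign (n + 1) κ) (hκ0 : κ ≠ 0)
    (hu : ∀ i < n, ContDiffOn ℝ ∞ (u i) D) (hΩ : IsOpen Ω) (hΩD : Set.MapsTo Prod.fst Ω D)
    (hsol : IsFormalSolution (n + 1) κ u Ω H) :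
    IsTransport n κ (partialD hΩ (1, 0)) (diffFn Ω) (coeffFn hu hΩD) (hadamardPoly hH) := by
  have hN : 2 ≤ n + 1 := by omega
  refine ⟨hadamardPoly_zero hH, degLT_hadamardPoly hH hn, fun k => ?_⟩
  rw [← sub_eq_zero]
  change transportDefect n κ (diffFn Ω) (symOp n (partialD hΩ (1, 0)) (coeffFn hu hΩD))
    (hadamardPoly hH) k = 0
  set S := symOp n (partialD hΩ (1, 0)) (coeffFn hu hΩD) with hS
  set h := hadamardPoly hH with hh
  have hdeg (l : ℕ) : DegLT n (transportDefect n κ (diffFn Ω) S h l) :=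
    degLT_transportDefect (fun m f hf => hf.symOp n _ _) (degLT_hadamardPoly hH hn) l
  ext1 j
  rw [coeff_zero]
  refine eq_zero_of_eq_zero_off_diagonal hΩ fun p hp => ?_
  -- Truncation at k + 1 makes the defect of index k a coefficient below the top power of t. The
  -- unknown remainder R only enters the top coefficient.
  obtain ⟨R, hR⟩ := hsol (k + 1)
  set ρ : ℂ[X] := ∑ j ∈ Finset.range n, monomial j (R j p.1.1 p.1.2) with hρ
  have hρdeg : DegLT n ρ := DegLT.sum fun j hj m hm => by
    rw [coeff_monomial, if_neg (by have := Finset.mem_range.1 hj; omega)]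
  have key := termEval_linearIndependent hn hκ hκ0 hp (K := k + 1 + 1)
    (c := fun l => if l < k + 1 then (transportDefect n κ (diffFn Ω) S h l).map (evalHom p)
      else - ((κ • remPart n S (h (k + 1))).map (evalHom p) + ρ)) (by
      intro l
      split_ifs
      · exact (hdeg l).map _
      · intro m hm
        rw [coeff_neg, (((degLT_remPart n S _).smul κ).map _).add hρdeg m hm, neg_zero]) (by
      intro t ht
      have htC : (t : ℂ) ≠ 0 := by exact_mod_cast ht.ne'
      have h1 := hR p.1.1 p.1.2 p.2 t ht
      rw [deriv_truncatedKernel hH hn hκ ht hN, diffOp_truncatedKernel hH hn hκ ht hN hu hΩ hΩD]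
        at h1
      have h2 := sum_sub_eq_sum_transportDefect (n := n) (κ := κ) (t := t) (δ := diffFn Ω) (S := S)
        (h := h) (by rw [hh, hadamardPoly_zero]; exact degLT_symOp_one n _ _)
        (E := pointEval hN hκ ht p) (fun f => by
          have := congrFun (congrArg Subtype.val (kernelMap_theta (Ω := Ω) hN hκ ht f)) p
          simp only [Nat.add_sub_cancel, Nat.cast_add, Nat.cast_one] at this
          exact this) (k + 1)
      rw [h1] at h2
      have h3 := mul_left_cancel₀ htC h2
      have h4 : termEval (n + 1) κ p.1.1 p.1.2 t ρ =
          ∑ j ∈ Finset.range n, R j p.1.1 p.1.2 * airyTerm (n + 1) κ j p.1.1 p.1.2 t := by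
        rw [hρ, map_sum]
        exact Finset.sum_congr rfl fun j _ => termEval_monomial _ _ _ _ _ _
      rw [Finset.sum_range_succ, if_neg (lt_irrefl _), map_neg, map_add, h4, ← pointEval_apply hN hκ ht,
        map_smul, Complex.real_smul]
      have h5 : ∑ l ∈ Finset.range (k + 1), (t : ℂ) ^ l * termEval (n + 1) κ p.1.1 p.1.2 t
          (if l < k + 1 then (transportDefect n κ (diffFn Ω) S h l).map (evalHom p)
            else - ((κ • remPart n S (h (k + 1))).map (evalHom p) + ρ)) =
          ∑ l ∈ Finset.range (k + 1), (t : ℂ) ^ l *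
            pointEval hN hκ ht p (transportDefect n κ (diffFn Ω) S h l) := by
        refine Finset.sum_congr rfl fun l hl => ?_
        rw [if_pos (Finset.mem_range.1 hl), pointEval_apply]
      rw [h5]
      rw [Nat.add_sub_cancel] at h3
      linear_combination -h3) k (by omega)
  rw [if_pos (by omega)] at key
  have := congrArg (fun q => q.coeff j) key
  simpa only [coeff_map, evalHom_apply, coeff_zero] using this

end Transport

/-! ### Coefficients of the formal adjoint -/

section Adjoint

theorem iteratedDeriv_sub_pow_self (x : ℝ) (i l : ℕ) :
    iteratedDeriv i (fun s : ℝ => (s - x) ^ l • (1 : ℂ)) x = if i = l then (l.factorial : ℂ) else 0 := by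
  have hc : ContDiffAt ℝ i (fun s : ℝ => (s - x) ^ l) x := by fun_prop
  have h := congrFun (iteratedDeriv_comp_sub_const i (fun s : ℝ => s ^ l) x) x
  simp only [sub_self] at h
  rw [iteratedDeriv_smul_const hc, h, iteratedDeriv_fun_pow_zero]
  split_ifs <;> simp

theorem iteratedDeriv_mul_sub_pow_self {f : ℝ → ℂ} {x : ℝ} (hf : ContDiffAt ℝ ∞ f x) (i l : ℕ) :
    iteratedDeriv i (fun s => f s * ((s - x) ^ l • (1 : ℂ))) x =
      l.factorial * (i.choose l * iteratedDeriv (i - l) f x) := by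
  have hc : ContDiffAt ℝ i (fun s : ℝ => (s - x) ^ l • (1 : ℂ)) x := by fun_prop
  have h := iteratedDeriv_mul hc (hf.of_le (by exact_mod_cast le_top) : ContDiffAt ℝ i f x)
  have e : (fun s => f s * ((s - x) ^ l • (1 : ℂ))) = (fun s => (s - x) ^ l • (1 : ℂ)) * f := by
    funext s
    exact mul_comm _ _
  rw [e, h]
  simp only [iteratedDeriv_sub_pow_self]
  rcases lt_or_ge i l with hil | hil
  · rw [Nat.choose_eq_zero_of_lt hil, Finset.sum_eq_zero]
    · simp
    · intro m hm
      rw [if_neg (by have := Finset.mem_range.1 hm; omega)]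
      simp
  · rw [Finset.sum_eq_single l]
    · rw [if_pos rfl]
      ring
    · intro m _ hm
      rw [if_neg hm]
      simp
    · intro hl
      exact absurd (Finset.mem_range.2 (by omega)) hl

variable {n : ℕ} {D : Set ℝ} {u : ℕ → ℝ → ℂ}

/-- Comparison of the coefficients in `L^* = (-1) ^ (n + 1) L`. -/
theorem sum_choose_mul_iteratedDeriv (hD : IsOpen D) (hu : ∀ i < n, ContDiffOn ℝ ∞ (u i) D)
    (hadj : ∀ f : ℝ → ℂ, ContDiffOn ℝ ∞ f D → ∀ x ∈ D,
      adjointOp (n + 1) u f x = (-1) ^ (n + 1) * diffOp (n + 1) u f x)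
    {x : ℝ} (hx : x ∈ D) {l : ℕ} (hl : l < n) :
    ∑ i ∈ Finset.range n, (-1) ^ i * (i.choose l * iteratedDeriv (i - l) (u i) x) =
      (-1) ^ (n + 1) * u l x := by
  -- Testing on (s - x)^l at s = x isolates l! times the coefficient of ∂^l on both sides; the
  -- leading terms of order n + 1 cancel.
  have h := hadj (fun s : ℝ => (s - x) ^ l • (1 : ℂ))
    (by have : ContDiff ℝ ∞ fun s : ℝ => (s - x) ^ l • (1 : ℂ) := by fun_prop
        exact this.contDiffOn) x hx
  have h1 : ∑ i ∈ Finset.range n, u i x * iteratedDeriv i (fun s : ℝ => (s - x) ^ l • (1 : ℂ)) x =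
      l.factorial * u l x := by
    rw [Finset.sum_eq_single l]
    · rw [iteratedDeriv_sub_pow_self, if_pos rfl, mul_comm]
    · intro i _ hi
      rw [iteratedDeriv_sub_pow_self, if_neg hi, mul_zero]
    · intro hl'
      exact absurd (Finset.mem_range.2 hl) hl'
  have h2 : ∑ i ∈ Finset.range n, (-1) ^ i *
        iteratedDeriv i (fun s => u i s * ((s - x) ^ l • (1 : ℂ))) x =
      l.factorial * ∑ i ∈ Finset.range n, (-1) ^ i *
        (i.choose l * iteratedDeriv (i - l) (u i) x) := by
    rw [Finset.mul_sum]
    refine Finset.sum_congr rfl fun i hi => ?_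
    rw [iteratedDeriv_mul_sub_pow_self
      ((hu i (Finset.mem_range.1 hi)).contDiffAt (hD.mem_nhds hx))]
    ring
  rw [adjointOp, diffOp, Nat.add_sub_cancel, h1, h2] at h
  have h0 : (l.factorial : ℂ) ≠ 0 := by exact_mod_cast l.factorial_ne_zero
  apply mul_left_cancel₀ h0
  linear_combination h

variable {Ω : Set (ℝ × ℝ)}

theorem neg_pow_apply {A : Type*} [CommRing A] [Algebra ℝ A] (d : Derivation ℝ A A) (k : ℕ)
    (a : A) : ((-(d : A →ₗ[ℝ] A)) ^ k) a = (-1 : ℝ) ^ k • d^[k] a := by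
  induction k with
  | zero => simp
  | succ k ih =>
    rw [pow_succ', Module.End.mul_apply, ih, Function.iterate_succ_apply', pow_succ]
    simp

theorem adjointCoeff_coeffFn (hD : IsOpen D) (hu : ∀ i < n, ContDiffOn ℝ ∞ (u i) D)
    (hadj : ∀ f : ℝ → ℂ, ContDiffOn ℝ ∞ f D → ∀ x ∈ D,
      adjointOp (n + 1) u f x = (-1) ^ (n + 1) * diffOp (n + 1) u f x)
    (hΩ : IsOpen Ω) (hΩD : Set.MapsTo Prod.fst Ω D) {m : ℕ} (hm : m < n) :
    adjointCoeff (partialD hΩ (1, 0)) m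
      (∑ i ∈ Finset.range n, monomial i (coeffFn hu hΩD i)) =
      ((-1 : ℝ) ^ (n + 1) * (-1) ^ m) • coeffFn hu hΩD m := by
  refine SmoothFn.ext_fun fun p => ?_
  have h := sum_choose_mul_iteratedDeriv hD hu hadj (hΩD p.2) hm
  have e (i : ℕ) (hi : i < n) :
      (adjointCoeff (partialD hΩ (1, 0)) m (monomial i (coeffFn hu hΩD i))).1 p =
        (-1) ^ m * ((-1) ^ i * (i.choose m * iteratedDeriv (i - m) (u i) p.1.1)) := by
    rw [adjointCoeff_monomial, neg_pow_apply]
    have h1 := iteratedDeriv_slice hΩ (coeffFn hu hΩD i) (F := fun q => u i q.1)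
      (coeffFn_apply hu hΩD hi) (i - m) (x := p.1.1) (y := p.1.2) p.2
    change (i.choose m : ℝ) • ((-1 : ℝ) ^ (i - m) •
      ((partialD hΩ (1, 0))^[i - m] (coeffFn hu hΩD i)).1 ⟨(p.1.1, p.1.2), p.2⟩) = _
    rw [← h1]
    simp only [Complex.real_smul]
    push_cast
    rcases lt_or_ge i m with him | him
    · simp [Nat.choose_eq_zero_of_lt him]
    · have h2 : (-1 : ℂ) ^ i = (-1) ^ (i - m) * (-1) ^ m := by
        rw [← pow_add, Nat.sub_add_cancel him]
      have h3 : (-1 : ℂ) ^ m * (-1) ^ m = 1 := by rw [← mul_pow]; simp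
      rw [h2]
      linear_combination (-(i.choose m : ℂ) * (-1) ^ (i - m) *
        iteratedDeriv (i - m) (u i) p.1.1) * h3
  rw [map_sum]
  have hsum : (∑ i ∈ Finset.range n, adjointCoeff (partialD hΩ (1, 0)) m
      (monomial i (coeffFn hu hΩD i))).1 p = ∑ i ∈ Finset.range n,
      (adjointCoeff (partialD hΩ (1, 0)) m (monomial i (coeffFn hu hΩD i))).1 p :=
    map_sum (evalHom p) _ _
  rw [hsum, Finset.sum_congr rfl fun i hi => e i (Finset.mem_range.1 hi), ← Finset.mul_sum, h]
  change _ = ((-1 : ℝ) ^ (n + 1) * (-1) ^ m) • (coeffFn hu hΩD m).1 p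
  rw [coeffFn_apply hu hΩD hm, Complex.real_smul]
  push_cast
  ring

theorem partialD_coeffFn (hD : IsOpen D) (hu : ∀ i < n, ContDiffOn ℝ ∞ (u i) D) (hΩ : IsOpen Ω)
    (hΩD : Set.MapsTo Prod.fst Ω D) (i : ℕ) : partialD hΩ (0, 1) (coeffFn hu hΩD i) = 0 := by
  by_cases hi : i < n
  · refine SmoothFn.ext_fun fun p => ?_
    rw [partialD_apply hΩ _ _ (F := fun q => u i q.1) (coeffFn_apply hu hΩD hi)]
    have h1 : HasFDerivAt (u i) (fderiv ℝ (u i) p.1.1) p.1.1 :=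
      (((hu i hi).contDiffAt (hD.mem_nhds (hΩD p.2))).differentiableAt (by simp)).hasFDerivAt
    have h2 := HasFDerivAt.comp p.1 h1 (hasFDerivAt_fst (𝕜 := ℝ) (p := p.1))
    change fderiv ℝ (u i ∘ Prod.fst) p.1 (0, 1) = 0
    rw [h2.fderiv]
    simp
  · rw [coeffFn, dif_neg hi, map_zero]

end Adjoint

/-! ### Restriction and exchange of variables -/

section Maps

variable {Ω Ω' : Set (ℝ × ℝ)}

/-- The restriction of smooth functions to a smaller set. -/
def restrictHom (hsub : Ω' ⊆ Ω) : SmoothFn Ω →ₐ[ℝ] SmoothFn Ω' where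
  toFun f := ⟨fun p => f.1 ⟨p.1, hsub p.2⟩, f.extend, f.contDiffOn_extend.mono hsub,
    fun p => (f.extend_apply ⟨p.1, hsub p.2⟩).symm⟩
  map_one' := rfl
  map_mul' _ _ := rfl
  map_zero' := rfl
  map_add' _ _ := rfl
  commutes' _ := rfl

theorem restrictHom_apply (hsub : Ω' ⊆ Ω) (f : SmoothFn Ω) (p : Ω') :
    (restrictHom hsub f).1 p = f.1 ⟨p.1, hsub p.2⟩ := rfl

theorem restrictHom_partialD (hsub : Ω' ⊆ Ω) (hΩ : IsOpen Ω) (hΩ' : IsOpen Ω') (v : ℝ × ℝ)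
    (f : SmoothFn Ω) :
    restrictHom hsub (partialD hΩ v f) = partialD hΩ' v (restrictHom hsub f) := by
  refine SmoothFn.ext_fun fun p => ?_
  rw [partialD_apply hΩ' v _ (F := f.extend) (fun q => (f.extend_apply ⟨q.1, hsub q.2⟩).symm)]
  rfl

/-- The exchange of the two variables. -/
def swapHom (hswap : ∀ p ∈ Ω, p.swap ∈ Ω) : SmoothFn Ω →ₐ[ℝ] SmoothFn Ω where
  toFun f := ⟨fun p => f.1 ⟨p.1.swap, hswap _ p.2⟩, fun q => f.extend q.swap,
    f.contDiffOn_extend.comp (contDiff_snd.prodMk contDiff_fst).contDiffOn hswap,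
    fun p => (f.extend_apply ⟨p.1.swap, hswap _ p.2⟩).symm⟩
  map_one' := rfl
  map_mul' _ _ := rfl
  map_zero' := rfl
  map_add' _ _ := rfl
  commutes' _ := rfl

theorem swapHom_partialD (hswap : ∀ p ∈ Ω, p.swap ∈ Ω) (hΩ : IsOpen Ω) (f : SmoothFn Ω) :
    swapHom hswap (partialD hΩ (1, 0) f) = partialD hΩ (0, 1) (swapHom hswap f) := by
  refine SmoothFn.ext_fun fun p => ?_
  rw [partialD_apply hΩ (0, 1) _ (F := fun q => f.extend q.swap)
    (fun q => (f.extend_apply ⟨q.1.swap, hswap _ q.2⟩).symm)]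
  have h1 : HasFDerivAt f.extend (fderiv ℝ f.extend p.1.swap) p.1.swap :=
    (f.differentiableAt_extend hΩ ⟨p.1.swap, hswap _ p.2⟩).hasFDerivAt
  have h2 : HasFDerivAt (Prod.swap : ℝ × ℝ → ℝ × ℝ)
      ((ContinuousLinearMap.snd ℝ ℝ ℝ).prod (ContinuousLinearMap.fst ℝ ℝ ℝ)) p.1 :=
    ((ContinuousLinearMap.snd ℝ ℝ ℝ).prod (ContinuousLinearMap.fst ℝ ℝ ℝ)).hasFDerivAt
  have h3 := HasFDerivAt.comp p.1 h1 h2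
  change fderiv ℝ f.extend p.1.swap (1, 0) = fderiv ℝ (f.extend ∘ Prod.swap) p.1 (0, 1)
  rw [h3.fderiv]
  simp

end Maps

theorem IsHeatSign.ne_zero {N : ℕ} {κ : ℝ} (h : IsHeatSign N κ) : κ ≠ 0 := by
  rcases Nat.even_or_odd N with hN | hN
  · rw [h.1 hN]
    exact pow_ne_zero _ (by norm_num)
  · rcases h.2 hN with h | h <;> rw [h] <;> norm_num

theorem IsFormalSolution.mono {N : ℕ} {κ : ℝ} {u : ℕ → ℝ → ℂ} {U Ω : Set (ℝ × ℝ)}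
    {H : ℕ → ℕ → ℝ → ℝ → ℂ} (h : IsFormalSolution N κ u U H) (hsub : Ω ⊆ U) :
    IsFormalSolution N κ u Ω H := fun K => by
  obtain ⟨R, hR⟩ := h K
  exact ⟨R, fun x y hxy => hR x y (hsub hxy)⟩

theorem horizontallyStarShaped_prod {I J : Set ℝ} (hI : I.OrdConnected) (hJ : J ⊆ I) :
    HorizontallyStarShaped (I ×ˢ J) := fun _ hp _ hs =>
  ⟨hI.uIcc_subset hp.1 (hJ hp.2) hs, hp.2⟩

/-! ### Localization to a square around the segment -/

section Interval

variable {n : ℕ} {κ : ℝ} {D : Set ℝ} {u : ℕ → ℝ → ℂ} {U : Set (ℝ × ℝ)}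
  {H : ℕ → ℕ → ℝ → ℝ → ℂ} {I : Set ℝ}

theorem mapsTo_fst_prod (hID : I ⊆ D) {J : Set ℝ} : Set.MapsTo Prod.fst (I ×ˢ J) D :=
  fun _ hp => hID hp.1

/-- The solution of the transport equations on the square of an interval agrees with a given
family of Hadamard coefficients where the latter is defined. -/
theorem coeff_eq_of_isTransport (hn : 1 ≤ n) (hκ : IsHeatSign (n + 1) κ)
    (hu : ∀ i < n, ContDiffOn ℝ ∞ (u i) D) (hH : IsHadamardFamily (n + 1) κ u D U H)
    (hI : IsOpen I) (hIc : I.OrdConnected) (hID : I ⊆ D) {h : ℕ → (SmoothFn (I ×ˢ I))[X]}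
    (hh : IsTransport n κ (partialD (hI.prod hI) (1, 0)) (diffFn (I ×ˢ I))
      (coeffFn hu (mapsTo_fst_prod hID)) h)
    {J : Set ℝ} (hJ : IsOpen J) (hJI : J ⊆ I) (hJU : I ×ˢ J ⊆ U) {k j : ℕ} (hk : 1 ≤ k) (hj : j < n)
    {x y : ℝ} (hx : x ∈ I) (hy : y ∈ J) :
    ((h k).coeff j).1 ⟨(x, y), hx, hJI hy⟩ = H k j x y := by
  have hΩ : IsOpen (I ×ˢ J) := hI.prod hJ
  have hsub : I ×ˢ J ⊆ I ×ˢ I := Set.prod_mono_right hJI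
  have hsm : ∀ k j, 1 ≤ k → j < n →
      ContDiffOn ℝ ∞ (fun p : ℝ × ℝ => H k j p.1 p.2) (I ×ˢ J) :=
    fun k j hk hj => (hH.smooth k j hk hj).mono hJU
  have h1 := isTransport_hadamardPoly hsm hn hκ hκ.ne_zero hu hΩ (mapsTo_fst_prod hID)
    (hH.solution.mono hJU)
  have h2 := hh.map (restrictHom hsub) (partialD hΩ (1, 0))
    (restrictHom_partialD hsub (hI.prod hI) hΩ (1, 0))
  have hc : (fun i => restrictHom hsub (coeffFn hu (mapsTo_fst_prod hID) i)) =
      coeffFn hu (mapsTo_fst_prod hID) := by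
    funext i
    by_cases hi : i < n
    · refine SmoothFn.ext_fun fun p => ?_
      rw [restrictHom_apply, coeffFn_apply hu _ hi, coeffFn_apply hu _ hi]
    · rw [coeffFn, dif_neg hi, coeffFn, dif_neg hi, map_zero]
  rw [hc] at h2
  -- The equations differentiate only in x and treat y as a parameter, so uniqueness holds on a
  -- strip that contains the horizontal segments to the diagonal.
  have h3 := h2.unique h1
    (eq_zero_of_smul_add_eq_zero hΩ (horizontallyStarShaped_prod hIc hJI)) k
  have h4 := congrArg (fun q => (q.coeff j).1 ⟨(x, y), hx, hy⟩) h3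
  simp only [coeff_map] at h4
  rw [coeff_hadamardPoly hsm hk hj] at h4
  exact h4

theorem symmetry_of_adjoint (hn : 1 ≤ n) (hκ : IsHeatSign (n + 1) κ) (hD : IsOpen D)
    (hu : ∀ i < n, ContDiffOn ℝ ∞ (u i) D) (hH : IsHadamardFamily (n + 1) κ u D U H)
    (hadj : ∀ f : ℝ → ℂ, ContDiffOn ℝ ∞ f D → ∀ x ∈ D,
      adjointOp (n + 1) u f x = (-1) ^ (n + 1) * diffOp (n + 1) u f x)
    {k j : ℕ} (hk : 1 ≤ k) (hj : j < n) {x y : ℝ} (hxy : (x, y) ∈ symmetricCore U) :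
    H k j x y = ((-1) ^ (n + 1)) ^ k * (-1) ^ j * H k j y x := by
  -- The tube lemma thickens the two horizontal segments of `symmetricCore` to strips inside U, at
  -- heights near y and near x.
  obtain ⟨W₁, J₁, hW₁, hJ₁, hCW₁, hyJ₁, hU₁⟩ := generalized_tube_lemma
    (isCompact_uIcc (a := x) (b := y)) (isCompact_singleton (x := y)) hH.isOpen (by
      rintro ⟨s, _⟩ ⟨hs, rfl⟩
      exact (hxy s hs).1)
  obtain ⟨W₂, J₂, hW₂, hJ₂, hCW₂, hxJ₂, hU₂⟩ := generalized_tube_lemma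
    (isCompact_uIcc (a := x) (b := y)) (isCompact_singleton (x := x)) hH.isOpen (by
      rintro ⟨s, _⟩ ⟨hs, rfl⟩
      exact (hxy s hs).2)
  rw [Set.singleton_subset_iff] at hyJ₁ hxJ₂
  obtain ⟨ε, hε, hεW⟩ := (isCompact_uIcc (a := x) (b := y)).exists_thickening_subset_open
    (hW₁.inter hW₂) (Set.subset_inter hCW₁ hCW₂)
  set I := Metric.thickening ε (Set.uIcc x y) with hI_def
  have hI : IsOpen I := Metric.isOpen_thickening
  have hIc : I.OrdConnected := ((convex_uIcc x y).thickening ε).ordConnected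
  have hCI : Set.uIcc x y ⊆ I := Metric.self_subset_thickening hε _
  have hx : x ∈ I := hCI Set.left_mem_uIcc
  have hy : y ∈ I := hCI Set.right_mem_uIcc
  have hID : I ⊆ D := fun s hs =>
    (hH.subset (hU₁ (show (s, y) ∈ W₁ ×ˢ J₁ from ⟨(hεW hs).1, hyJ₁⟩))).1
  have hΩ : IsOpen (I ×ˢ I) := hI.prod hI
  have hstar := horizontallyStarShaped_prod hIc subset_rfl
  have hswap : ∀ p ∈ I ×ˢ I, p.swap ∈ I ×ˢ I := fun p hp => ⟨hp.2, hp.1⟩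
  -- H may be undefined on parts of I × I, so the flip is applied to a solution constructed on the
  -- whole square.
  obtain ⟨h, hh⟩ := exists_isTransport (d := partialD hΩ (1, 0)) (δ := diffFn (I ×ˢ I))
    (u := coeffFn hu (mapsTo_fst_prod hID)) hn κ (exists_smul_add_eq hΩ hstar)
  have key := hh.eq_smul_flip (dy := partialD hΩ (0, 1)) (σ := swapHom hswap) (diagHom (I ×ˢ I))
    hκ.ne_zero (fun _ => rfl)
    (SmoothFn.ext_fun fun p => by
      change ((p.1.2 - p.1.1 : ℝ) : ℂ) = -((p.1.1 - p.1.2 : ℝ) : ℂ)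
      push_cast
      ring)
    (partialD_diffFn hΩ) (swapHom_partialD hswap hΩ) (partialD_comm hΩ (1, 0) (0, 1))
    (partialD_coeffFn hD hu hΩ _)
    (funext fun p => by
      change ((p.1.1.1 - p.1.1.2 : ℝ) : ℂ) = 0
      rw [p.2, sub_self, Complex.ofReal_zero])
    (fun a => funext fun p => by
      obtain ⟨⟨⟨s, r⟩, hp⟩, hsr⟩ := p
      obtain rfl : s = r := hsr
      rfl)
    (fun m hm => adjointCoeff_coeffFn hD hu hadj hΩ _ hm)
    (eq_zero_of_smul_add_eq_zero hΩ hstar) (eq_zero_of_diffFn_mul_partialD_eq_zero hΩ hstar) k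
  have hval := congrArg (fun q => (q.coeff j).1 ⟨(x, y), hx, hy⟩) key
  simp only [coeff_smul, coeff_flip] at hval
  change _ = ((-1 : ℝ) ^ (n + 1)) ^ k • ((-1 : ℝ) ^ j • ((h k).coeff j).1 ⟨(y, x), hy, hx⟩) at hval
  -- The strip at height y identifies the value at (x, y) with H, and the strip at height x the
  -- value at (y, x).
  have hxy' := coeff_eq_of_isTransport hn hκ hu hH hI hIc hID hh (hJ₁.inter hI)
    Set.inter_subset_right (fun p hp => hU₁ ⟨(hεW hp.1).1, hp.2.1⟩) hk hj hx ⟨hyJ₁, hy⟩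
  have hyx' := coeff_eq_of_isTransport hn hκ hu hH hI hIc hID hh (hJ₂.inter hI)
    Set.inter_subset_right (fun p hp => hU₂ ⟨(hεW hp.1).2, hp.2.1⟩) hk hj hy ⟨hxJ₂, hx⟩
  rw [hxy', hyx', Complex.real_smul, Complex.real_smul] at hval
  rw [hval]
  push_cast
  ring

end Interval

end HigherHeat

end

/-! ### The symmetry for even and odd order -/

theorem corollary4p7 (N : ℕ) (hN : 2 ≤ N) (κ : ℝ) (hκ : HigherHeat.IsHeatSign N κ)
    (D : Set ℝ) (hD : IsOpen D) (u : ℕ → ℝ → ℂ)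
    (hu : ∀ i : ℕ, i < N - 1 → ContDiffOn ℝ ∞ (u i) D)
    (U : Set (ℝ × ℝ)) (H : ℕ → ℕ → ℝ → ℝ → ℂ)
    (hH : HigherHeat.IsHadamardFamily N κ u D U H) :
    (Even N → HigherHeat.IsFormallySelfAdjoint N u D →
      ∀ n j : ℕ, 1 ≤ n → j < N - 1 → ∀ x y : ℝ, (x, y) ∈ HigherHeat.symmetricCore U →
        H n j x y = (-1) ^ j * H n j y x) ∧
    (Odd N → HigherHeat.IsFormallySkewAdjoint N u D →
      ∀ n j : ℕ, 1 ≤ n → j < N - 1 → ∀ x y : ℝ, (x, y) ∈ HigherHeat.symmetricCore U →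
        H n j x y = (-1) ^ (n + j) * H n j y x) := by
  obtain ⟨m, rfl⟩ : ∃ m, N = m + 1 := ⟨N - 1, by omega⟩
  simp only [Nat.add_sub_cancel] at hu ⊢
  constructor
  · intro hE hadj n j hn hj x y hxy
    rw [HigherHeat.symmetry_of_adjoint (by omega) hκ hD hu hH
      (fun f hf s hs => by rw [hadj f hf s hs, hE.neg_one_pow, one_mul]) hn hj hxy,
      hE.neg_one_pow, one_pow, one_mul]
  · intro hO hadj n j hn hj x y hxy
    rw [HigherHeat.symmetry_of_adjoint (by omega) hκ hD hu hH
      (fun f hf s hs => by rw [hadj f hf s hs, hO.neg_one_pow, neg_one_mul]) hn hj hxy,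
      hO.neg_one_pow, pow_add]
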